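/- Let $G$ be a finite connected graph with vertex set $V$ and edge set $E$ (loops and parallel edges allowed). For a vector $\ell=(L(e))_{e\in E}$ of positive lengths, let $\Gamma(\ell)$ be the metric graph in which each edge $e$ is identified with $[0,L(e)]$. For a vector $\tilde\ell=(\tilde L(e))_{e\in E}$ of nonnegative lengths, let $\Gamma=\Gamma(\tilde\ell)$ be the limit metric graph: its edges are the edges $e$ with $\tilde L(e)>0$ (the set of these is $E_+$), identified with $[0,\tilde L(e)]$, and every edge $e$ with $\tilde L(e)=0$ is collapsed to a vertex $v_e$ of $\Gamma$ (that is, its two end vertices are glued together). On a metric graph consider the (real) Laplacian $f\mapsto -f''$ with standard vertex conditions (edgewise $H^2$ functions, continuous at the vertices, with the derivatives directed towards the vertex summing to zero at every vertex), and let $0=\mu_1<\mu_2\le\mu_3\le\dots$ be its eigenvalues, counted with multiplicity. For a function $f\in H^1(\Gamma)$ define the function $\mathcal J_\ell f$ edgewise on $\Gamma(\ell)$ by $$(\mathcal J_\ell f)_e(x)=\sqrt{\tfrac{L(e)}{\tilde L(e)}}\;f_e\Big(\tfrac{\tilde L(e)}{L(e)}\,x\Big)\quad(e\in E_+),\qquad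 (\mathcal J_\ell f)_e(x)=f(v_e)\quad(e\in E\setminus E_+),\qquad 0\le x\le L(e).$$ Let $k\ge 1$ and suppose that $\mu_k(\Gamma)$ is a simple eigenvalue. Then, as $\ell\to\tilde\ell$ (through vectors of positive lengths): 1. $\mu_k(\Gamma(\ell))$ is simple for all $\ell$ sufficiently close to $\tilde\ell$; 2. $\mu_k(\Gamma(\ell))\to\mu_k(\Gamma)$; 3. if $\psi_k$ is an eigenfunction for $\mu_k(\Gamma)$ with $\|\psi_k\|_{L^2(\Gamma)}=1$, and $\psi_{k,\ell}$ are eigenfunctions for $\mu_k(\Gamma(\ell))$ with $\|\psi_{k,\ell}\|_{L^2(\Gamma(\ell))}=1$, then there are signs $\sigma_\ell\in\{1,-1\}$ such that $$\sum_{e\in E}\big\|(\sigma_\ell\psi_{k,\ell}-\mathcal J_\ell\psi_k)_e\big\|^2_{H^1(0,L(e))}\to 0\qquad\text{and}\qquad \max_{e\in E}\ \sup_{x\in[0,L(e)]}\big|(\sigma_\ell\psi_{k,\ell}-\mathcal J_\ell\psi_k)_e(x)\big|\to 0.$$ -/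

import Mathlib

open MeasureTheory Filter Topology
open scoped ENNReal

noncomputable section

/-- A discrete graph with vertex set `V` and edge set `E`. Each edge has an originating and a
terminal vertex; loops and parallel edges are allowed. -/
structure DiscreteGraph (V E : Type*) where
  /-- the vertex from which an edge originates -/
  orig : E → V
  /-- the vertex at which an edge terminates -/
  term : E → V

/-- Any two vertices are joined by a path (traversing edges in either direction). -/
def DiscreteGraph.Connected {V E : Type*} (G : DiscreteGraph V E) : Prop :=
  Nonempty V ∧ ∀ u v : V, Relation.EqvGen (fun a b => ∃ e, G.orig e = a ∧ G.term e = b) u v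

/-- A metric graph: a discrete graph in which every edge `e` has a positive length and is identified
with the interval `[0, len e]`, the endpoint `0` being `orig e` and `len e` being `term e`. -/
structure MetricGraph (V E : Type*) extends DiscreteGraph V E where
  /-- the edge lengths -/
  len : E → ℝ
  len_pos : ∀ e, 0 < len e

namespace MetricGraph

variable {V E : Type*} (Γ : MetricGraph V E)

/-- Real functions on the disjoint union of the closed edges `[0, len e]`. -/
abbrev Fun : Type _ := (e : E) → Set.Icc (0 : ℝ) (Γ.len e) → ℝ

/-- The endpoint `0` of an edge. -/
def left (e : E) : Set.Icc (0 : ℝ) (Γ.len e) := ⟨0, le_refl _, (Γ.len_pos e).le⟩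

/-- The endpoint `len e` of an edge. -/
def right (e : E) : Set.Icc (0 : ℝ) (Γ.len e) := ⟨Γ.len e, (Γ.len_pos e).le, le_refl _⟩

/-- The restriction `f_e` as a function of a real variable. Only its values on `[0, len e]`, where
it agrees with `f e`, are ever used. -/
def onLine (f : Γ.Fun) (e : E) : ℝ → ℝ := Set.IccExtend (Γ.len_pos e).le (f e)

/-- The vertex at an end of an edge: `(e, false)` is the originating end, `(e, true)` the terminal
one. -/
def endVertex (p : E × Bool) : V := if p.2 then Γ.term p.1 else Γ.orig p.1

/-- The value of `f` at an end of an edge. -/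
def endValue (f : Γ.Fun) (p : E × Bool) : ℝ :=
  if p.2 then f p.1 (Γ.right p.1) else f p.1 (Γ.left p.1)

/-- The space `C(Γ)`: functions continuous on each edge having, at each vertex, a value which is
independent of the choice of the incident edge. -/
def MemC (f : Γ.Fun) : Prop :=
  (∀ e, Continuous (f e)) ∧
    ∀ p q : E × Bool, Γ.endVertex p = Γ.endVertex q → Γ.endValue f p = Γ.endValue f q

open Classical in
/-- The value `f(v)` of a function `f ∈ C(Γ)` at a vertex `v`, read off on any edge incident to `v`
(and `0` if there is no such edge). -/
def vertexValue (f : Γ.Fun) (v : V) : ℝ :=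
  if h : ∃ p : E × Bool, Γ.endVertex p = v then Γ.endValue f h.choose else 0

/-- On each edge, `f_e ∈ H¹(0, len e)` with (weak) derivative `g_e ∈ L²(0, len e)`: that is, `f_e` is
absolutely continuous and is an indefinite integral of the square-integrable function `g_e`. -/
def HasL2Deriv (f g : Γ.Fun) : Prop :=
  ∀ e, MemLp (Γ.onLine g e) 2 (volume.restrict (Set.Ioc 0 (Γ.len e))) ∧
    ∀ x : Set.Icc (0 : ℝ) (Γ.len e),
      f e x = f e (Γ.left e) + ∫ t in (0 : ℝ)..x, Γ.onLine g e t

theorem onLine_add (f g : Γ.Fun) (e : E) (x : ℝ) :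
    Γ.onLine (f + g) e x = Γ.onLine f e x + Γ.onLine g e x := rfl

theorem onLine_smul (c : ℝ) (f : Γ.Fun) (e : E) (x : ℝ) :
    Γ.onLine (c • f) e x = c * Γ.onLine f e x := rfl

theorem endValue_add (f g : Γ.Fun) (p : E × Bool) :
    Γ.endValue (f + g) p = Γ.endValue f p + Γ.endValue g p := by
  unfold endValue; split_ifs <;> rfl

theorem endValue_smul (c : ℝ) (f : Γ.Fun) (p : E × Bool) :
    Γ.endValue (c • f) p = c * Γ.endValue f p := by
  unfold endValue; split_ifs <;> rfl

variable {Γ} in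
theorem MemC.add {f g : Γ.Fun} (hf : Γ.MemC f) (hg : Γ.MemC g) : Γ.MemC (f + g) :=
  ⟨fun e => (hf.1 e).add (hg.1 e), fun p q h => by
    rw [endValue_add, endValue_add, hf.2 p q h, hg.2 p q h]⟩

variable {Γ} in
theorem MemC.smul {f : Γ.Fun} (c : ℝ) (hf : Γ.MemC f) : Γ.MemC (c • f) :=
  ⟨fun e => (hf.1 e).const_smul c, fun p q h => by
    rw [endValue_smul, endValue_smul, hf.2 p q h]⟩

variable {Γ} in
theorem HasL2Deriv.intervalIntegrable {f g : Γ.Fun} (h : Γ.HasL2Deriv f g) (e : E)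
    (x : Set.Icc (0 : ℝ) (Γ.len e)) :
    IntervalIntegrable (Γ.onLine g e) volume 0 x := by
  rw [intervalIntegrable_iff_integrableOn_Ioc_of_le x.2.1]
  have h1 : IntegrableOn (Γ.onLine g e) (Set.Ioc 0 (Γ.len e)) :=
    (h e).1.integrable (by norm_num)
  exact h1.mono_set (Set.Ioc_subset_Ioc_right x.2.2)

variable {Γ} in
theorem HasL2Deriv.add {f f' g g' : Γ.Fun} (h : Γ.HasL2Deriv f g) (h' : Γ.HasL2Deriv f' g') :
    Γ.HasL2Deriv (f + f') (g + g') := fun e =>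
  ⟨(h e).1.add (h' e).1, fun x => by
    have := intervalIntegral.integral_add (h.intervalIntegrable e x) (h'.intervalIntegrable e x)
    simp only [onLine_add, this, Pi.add_apply, (h e).2 x, (h' e).2 x]
    ring⟩

variable {Γ} in
theorem HasL2Deriv.smul {f g : Γ.Fun} (c : ℝ) (h : Γ.HasL2Deriv f g) :
    Γ.HasL2Deriv (c • f) (c • g) := fun e =>
  ⟨(h e).1.const_smul c, fun x => by
    simp only [onLine_smul, intervalIntegral.integral_const_mul, Pi.smul_apply, smul_eq_mul,
      (h e).2 x]
    ring⟩

theorem hasL2Deriv_zero : Γ.HasL2Deriv 0 0 := fun e =>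
  ⟨MemLp.zero, fun x => by
    have : Γ.onLine 0 e = fun _ => 0 := rfl
    simp [this]⟩

variable [Fintype E]

open Classical in
/-- The sum at the vertex `v` of the derivatives, taken in the direction pointing towards `v`, on
all edges incident to `v` (a loop contributes twice), for a function with derivative `g`. -/
def normalDeriv (g : Γ.Fun) (v : V) : ℝ :=
  (∑ e with Γ.term e = v, g e (Γ.right e)) - ∑ e with Γ.orig e = v, g e (Γ.left e)

/-- `f` belongs to the domain of the Laplacian `-Δ` on `Γ` with standard (continuity-Kirchhoff)
vertex conditions and `-Δ f = u` in `L²(Γ)`. Here `g` is the continuous representative of `f'`,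
and `h` is `f''`. -/
def IsNegLaplacian (f u : Γ.Fun) : Prop :=
  Γ.MemC f ∧ ∃ g h : Γ.Fun, Γ.HasL2Deriv f g ∧ Γ.HasL2Deriv g h ∧
    (∀ v, Γ.normalDeriv g v = 0) ∧
    ∀ e, ∀ᵐ x ∂(volume.restrict (Set.Ioc 0 (Γ.len e))), Γ.onLine u e x = -Γ.onLine h e x

/-- The eigenspace `{f ∈ dom(-Δ) : -Δ f = μ f}` of the standard Laplacian. -/
def eigenspace (μ : ℝ) : Submodule ℝ Γ.Fun where
  carrier := {f | Γ.IsNegLaplacian f (μ • f)}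
  zero_mem' := ⟨⟨fun _ => continuous_const, fun p q _ => by simp [endValue]⟩, 0, 0,
    Γ.hasL2Deriv_zero, Γ.hasL2Deriv_zero, fun v => by simp [normalDeriv],
    fun e => ae_of_all _ fun x => by simp [onLine, Set.IccExtend]⟩
  add_mem' := by
    rintro a b ⟨ha, g, h, h1, h2, h3, h4⟩ ⟨hb, g', h', h1', h2', h3', h4'⟩
    refine ⟨ha.add hb, g + g', h + h', h1.add h1', h2.add h2', fun v => ?_, fun e => ?_⟩
    · have e1 := h3 v
      have e2 := h3' v
      simp only [normalDeriv, Pi.add_apply, Finset.sum_add_distrib] at e1 e2 ⊢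
      linarith
    · filter_upwards [h4 e, h4' e] with x hx hx'
      simp only [onLine_smul, onLine_add] at hx hx' ⊢
      linarith
  smul_mem' := by
    rintro c a ⟨ha, g, h, h1, h2, h3, h4⟩
    refine ⟨ha.smul c, c • g, c • h, h1.smul c, h2.smul c, fun v => ?_, fun e => ?_⟩
    · have e1 := h3 v
      simp only [normalDeriv, Pi.smul_apply, smul_eq_mul, ← Finset.mul_sum] at e1 ⊢
      rw [← mul_sub, e1, mul_zero]
    · filter_upwards [h4 e] with x hx
      simp only [onLine_smul] at hx ⊢
      rw [mul_left_comm, hx, mul_neg]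

/-- The `k`-th eigenvalue `μ_k(Γ)`, `k = 1, 2, …`, of the standard Laplacian, the eigenvalues being
counted with multiplicity in increasing order: the least `μ` such that the eigenspaces to
eigenvalues `≤ μ` together span a space of dimension at least `k`. -/
def eigenvalue (k : ℕ) : ℝ :=
  sInf {μ : ℝ | (k : Cardinal) ≤ Module.rank ℝ ↥(⨆ ν ∈ Set.Iic μ, Γ.eigenspace ν)}

/-- `μ_k(Γ)` is a simple eigenvalue. -/
def IsSimple (k : ℕ) : Prop := Module.finrank ℝ ↥(Γ.eigenspace (Γ.eigenvalue k)) = 1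

/-- `ψ` is an eigenfunction for `μ_k(Γ)` with `‖ψ‖ = 1` in `L²(Γ)`. -/
def IsNormalizedEigenfunction (k : ℕ) (ψ : Γ.Fun) : Prop :=
  ψ ∈ Γ.eigenspace (Γ.eigenvalue k) ∧ ∑ e, ∫ x in (0 : ℝ)..Γ.len e, Γ.onLine ψ e x ^ 2 = 1

/-- The `H¹` norm `(∑ₑ ∫ |f_e|² + |f_e'|²)^(1/2)` of an edgewise `H¹` function. The derivative is
unique up to null sets, so the infimum merely selects it; the norm is `∞` if there is none. -/
def h1Norm (f : Γ.Fun) : ℝ≥0∞ :=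
  ⨅ (g : Γ.Fun) (_ : Γ.HasL2Deriv f g),
    (∑ e, ∫⁻ x in Set.Ioc 0 (Γ.len e),
      (‖Γ.onLine f e x‖ₑ ^ 2 + ‖Γ.onLine g e x‖ₑ ^ 2)) ^ (1 / 2 : ℝ)

/-- The supremum of `|f|` over all points of all (closed) edges. -/
def supNorm (f : Γ.Fun) : ℝ≥0∞ := ⨆ (e : E) (x : Set.Icc (0 : ℝ) (Γ.len e)), ‖f e x‖ₑ

end MetricGraph

namespace DiscreteGraph

variable {V E : Type*} (G : DiscreteGraph V E)

/-- The metric graph `Γ(ℓ)` obtained by equipping `G` with positive edge lengths `ℓ`. -/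
def withLengths (ℓ : {ℓ : E → ℝ // ∀ e, 0 < ℓ e}) : MetricGraph V E where
  toDiscreteGraph := G
  len := ℓ.1
  len_pos := ℓ.2

/-- The vertices of the limit graph: the vertices of `G`, where the two ends of every edge of length
zero are glued together. -/
def LimitVertex (l : E → ℝ) : Type _ :=
  Quot fun a b : V => ∃ e, l e = 0 ∧ G.orig e = a ∧ G.term e = b

/-- The limit metric graph `Γ(l)` for nonnegative edge lengths `l`: its edges are the edges of `G`
of positive length, and every edge of length zero is collapsed to a vertex. -/
def limitGraph (l : E → ℝ) : MetricGraph (G.LimitVertex l) {e : E // 0 < l e} where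
  orig e := Quot.mk _ (G.orig e)
  term e := Quot.mk _ (G.term e)
  len e := l e
  len_pos e := e.2

/-- The rescaling operator `J_ℓ`, mapping functions on the limit graph `Γ(l)` to functions on `Γ(ℓ)`:
on an edge that keeps a positive length, `(J_ℓ f)(x) = √(ℓ e / l e) f((l e / ℓ e) x)`; on an edge
of length zero in the limit, `J_ℓ f` is the constant `f(v_e)`, where `v_e` is the vertex into which
the edge collapses. -/
def rescale (l : E → ℝ) (ℓ : {ℓ : E → ℝ // ∀ e, 0 < ℓ e}) (f : (G.limitGraph l).Fun) :
    (G.withLengths ℓ).Fun := fun e x =>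
  if h : 0 < l e then
    √(ℓ.1 e / l e) * (G.limitGraph l).onLine f ⟨e, h⟩ (l e / ℓ.1 e * x)
  else (G.limitGraph l).vertexValue f (Quot.mk _ (G.orig e))

end DiscreteGraph

/-- The filter `ℓ → l` of vectors `ℓ` of positive edge lengths tending to the vector `l`. -/
def lengthsNear {E : Type*} (l : E → ℝ) :
    Filter {ℓ : E → ℝ // ∀ e, 0 < ℓ e} :=
  comap Subtype.val (𝓝 l)

end

/-! Eigenfunctions are treated weakly: with A(f) = f and B(f) = f' on H¹(Γ), an eigenfunction to ν
satisfies ⟨B u, B v⟩ = ν⟨A u, A v⟩ for all v. Compactness of the energy space and minimisation of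
Rayleigh quotients give the variational principle (`EnergyCompact.hasEigenfamily`). By
`eigenvalue_eq` the k-th eigenvalue is the least Λ admitting k orthonormal weak eigenvectors with
eigenvalues at most Λ.

Upper bound: `pull` transplants functions of the limit graph to Γ(ℓ) by stretching the surviving
edges and taking constants on the collapsing ones. Rayleigh quotients grow at most by a factor
tending to 1, so limsup μ_k(Γ(ℓ)) ≤ μ_k(Γ) (`eventually_hasEigenfamily`).

Lower bound: on an edge of length L, a function of energy at most C oscillates by at most √(L C).
Hence functions on Γ(ℓ) with bounded norm and energy have uniform limits, and on a collapsing edge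
the two end values merge, so the limit is continuous on Γ. Derivatives converge weakly on the
surviving edges (`Connected.exists_limit`). Testing the eigenvalue equation with transplanted
functions passes it to the limit (`Connected.exists_limit_eigenvector`), and inner products converge
as well. Thus k orthonormal eigenfunctions on Γ(ℓ) produce k orthonormal ones on Γ, which gives
eigenvalue convergence. An orthonormal pair of eigenfunctions for μ_k(Γ(ℓ)) would likewise produce
such a pair for μ_k(Γ), so simplicity is stable.

Eigenfunctions: by simplicity a limit of normalised eigenfunctions is ±ψ_k. Convergence is uniform,
and the energies are the eigenvalues, which converge. Weak convergence of the derivatives together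
with convergence of the energies is strong convergence, and no energy is left on the collapsing
edges (`tendsto_h1Norm`).

Limits are taken along ultrafilters, so that bounded quantities converge without extracting
subsequences. -/

noncomputable section

/-! ### H¹ functions on an interval. -/

/-- `g` is square-integrable on `(0, L)`. -/
abbrev L2On (L : ℝ) (g : ℝ → ℝ) : Prop := MemLp g 2 (volume.restrict (Set.Ioc 0 L))

/-- On `[0, L]`, the function `f` is an indefinite integral of the square-integrable `g`. -/
def IsPrimitiveOn (L : ℝ) (f g : ℝ → ℝ) : Prop :=
  L2On L g ∧ ∀ x ∈ Set.Icc 0 L, f x = f 0 + ∫ t in (0 : ℝ)..x, g t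

theorem L2_inner_toLp {α : Type*} [MeasurableSpace α] {μ : Measure α} {f g : α → ℝ}
    (hf : MemLp f 2 μ) (hg : MemLp g 2 μ) :
    inner ℝ (hf.toLp f) (hg.toLp g) = ∫ x, f x * g x ∂μ := by
  rw [L2.inner_def]
  refine integral_congr_ae ?_
  filter_upwards [hf.coeFn_toLp, hg.coeFn_toLp] with x h1 h2
  simp [h1, h2, mul_comm]

theorem L2On.mono {L x : ℝ} {g : ℝ → ℝ} (hg : L2On L g) (hx : x ≤ L) : L2On x g :=
  hg.mono_measure (Measure.restrict_mono (Set.Ioc_subset_Ioc_right hx) le_rfl)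

theorem L2On.intervalIntegrable {L : ℝ} {g : ℝ → ℝ} (hg : L2On L g) (hL : 0 ≤ L) :
    IntervalIntegrable g volume 0 L := by
  rw [intervalIntegrable_iff_integrableOn_Ioc_of_le hL]
  exact hg.integrable (by norm_num)

theorem L2On.intervalIntegrable_sub {L x y : ℝ} {g : ℝ → ℝ} (hg : L2On L g) (hx : x ∈ Set.Icc 0 L)
    (hy : y ∈ Set.Icc 0 L) : IntervalIntegrable g volume x y :=
  ((hg.mono hx.2).intervalIntegrable hx.1).symm.trans ((hg.mono hy.2).intervalIntegrable hy.1)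

theorem L2On.integrable_mul {L : ℝ} {f g : ℝ → ℝ} (hf : L2On L f) (hg : L2On L g) (hL : 0 ≤ L) :
    IntervalIntegrable (fun x => f x * g x) volume 0 L := by
  rw [intervalIntegrable_iff_integrableOn_Ioc_of_le hL]
  exact MemLp.integrable_mul hf hg

theorem L2On.const (L c : ℝ) : L2On L (fun _ => c) := memLp_const c

theorem ContinuousOn.l2On {L : ℝ} {f : ℝ → ℝ} (hf : ContinuousOn f (Set.Icc 0 L)) : L2On L f := by
  refine (memLp_two_iff_integrable_sq ?_).2 ?_
  · exact (hf.mono Set.Ioc_subset_Icc_self).aestronglyMeasurable measurableSet_Ioc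
  · exact ((hf.pow 2).integrableOn_Icc).mono_set Set.Ioc_subset_Icc_self

theorem integral_mul_self_nonneg {L : ℝ} (hL : 0 ≤ L) (f : ℝ → ℝ) :
    0 ≤ ∫ x in (0 : ℝ)..L, f x * f x :=
  intervalIntegral.integral_nonneg hL fun _ _ => mul_self_nonneg _

/-- The Hölder estimate for indefinite integrals of square-integrable functions. -/
theorem L2On.integral_sq_le {L x y : ℝ} {g : ℝ → ℝ} (hg : L2On L g) (hx : x ∈ Set.Icc 0 L)
    (hy : y ∈ Set.Icc 0 L) :
    (∫ t in x..y, g t) ^ 2 ≤ |y - x| * ∫ t in (0 : ℝ)..L, g t * g t := by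
  wlog hxy : x ≤ y generalizing x y
  · rw [intervalIntegral.integral_symm, neg_sq, abs_sub_comm]
    exact this hy hx (le_of_not_ge hxy)
  have hs : volume.restrict (Set.Ioc x y) ≤ volume.restrict (Set.Ioc 0 L) :=
    Measure.restrict_mono (Set.Ioc_subset_Ioc hx.1 hy.2) le_rfl
  have hg' : MemLp g 2 (volume.restrict (Set.Ioc x y)) := hg.mono_measure hs
  have h1 : MemLp (fun _ => (1 : ℝ)) 2 (volume.restrict (Set.Ioc x y)) := memLp_const 1
  -- Cauchy–Schwarz for the constant 1 and `g` on `(x, y]`.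
  have key := real_inner_mul_inner_self_le (h1.toLp _) (hg'.toLp g)
  rw [L2_inner_toLp, L2_inner_toLp, L2_inner_toLp] at key
  simp only [one_mul, integral_const, smul_eq_mul, mul_one, Measure.real, Measure.restrict_apply,
    MeasurableSet.univ, Set.univ_inter, Real.volume_Ioc, ENNReal.toReal_ofReal (sub_nonneg.2 hxy)]
    at key
  rw [intervalIntegral.integral_of_le hxy, intervalIntegral.integral_of_le (hx.1.trans hx.2),
    abs_of_nonneg (sub_nonneg.2 hxy), sq]
  refine key.trans (mul_le_mul_of_nonneg_left ?_ (sub_nonneg.2 hxy))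
  exact integral_mono_measure hs (ae_of_all _ fun x => mul_self_nonneg _) (MemLp.integrable_mul hg hg)

namespace IsPrimitiveOn

variable {L : ℝ} {f g : ℝ → ℝ}

theorem sub_eq (h : IsPrimitiveOn L f g) {x y : ℝ} (hx : x ∈ Set.Icc 0 L) (hy : y ∈ Set.Icc 0 L) :
    f y - f x = ∫ t in x..y, g t := by
  have h0 : (0 : ℝ) ∈ Set.Icc 0 L := ⟨le_rfl, hx.1.trans hx.2⟩
  rw [h.2 x hx, h.2 y hy, ← intervalIntegral.integral_interval_sub_left
    (h.1.intervalIntegrable_sub h0 hy) (h.1.intervalIntegrable_sub h0 hx)]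
  ring

theorem abs_sub_le (h : IsPrimitiveOn L f g) {x y : ℝ} (hx : x ∈ Set.Icc 0 L)
    (hy : y ∈ Set.Icc 0 L) :
    |f y - f x| ≤ √(|y - x| * ∫ t in (0 : ℝ)..L, g t * g t) := by
  rw [h.sub_eq hx hy]
  exact Real.abs_le_sqrt (h.1.integral_sq_le hx hy)

theorem continuousOn (h : IsPrimitiveOn L f g) : ContinuousOn f (Set.Icc 0 L) := by
  intro x hx
  rw [ContinuousWithinAt, tendsto_iff_dist_tendsto_zero]
  refine squeeze_zero' (Eventually.of_forall fun _ => dist_nonneg)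
    (eventually_nhdsWithin_of_forall fun y hy => (h.abs_sub_le hx hy)) ?_
  have : Continuous fun y : ℝ => √(|y - x| * ∫ t in (0 : ℝ)..L, g t * g t) := by fun_prop
  simpa using (this.tendsto x).mono_left nhdsWithin_le_nhds

/-- Integrate f(0)² ≤ 2 f(x)² + 2 L ∫ g² over [0, L]. This controls an end value by norm and energy,
but uniformly only while L stays away from 0. -/
theorem sq_left_le (h : IsPrimitiveOn L f g) (hL : 0 < L) :
    L * f 0 ^ 2 ≤ 2 * (∫ x in (0 : ℝ)..L, f x * f x)
      + 2 * L ^ 2 * ∫ x in (0 : ℝ)..L, g x * g x := by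
  set I := ∫ x in (0 : ℝ)..L, g x * g x
  have hI : 0 ≤ I := integral_mul_self_nonneg hL.le g
  have h1 : ∀ x ∈ Set.Icc 0 L, f 0 ^ 2 ≤ 2 * (f x * f x) + 2 * (L * I) := by
    intro x hx
    have h0 : (0 : ℝ) ∈ Set.Icc 0 L := ⟨le_rfl, hL.le⟩
    have h2 := h.1.integral_sq_le h0 hx
    rw [← h.sub_eq h0 hx, sub_zero, abs_of_nonneg hx.1] at h2
    have h3 : x * I ≤ L * I := mul_le_mul_of_nonneg_right hx.2 hI
    nlinarith [sq_nonneg (f x + (f x - f 0))]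
  have hff := h.continuousOn.l2On.integrable_mul h.continuousOn.l2On hL.le
  have h2 := intervalIntegral.integral_mono_on (a := 0) (b := L) (μ := volume)
    (f := fun _ => f 0 ^ 2) (g := fun x => 2 * (f x * f x) + 2 * (L * I)) hL.le
    (by simp) ((hff.const_mul 2).add (by simp)) h1
  rw [intervalIntegral.integral_add (hff.const_mul 2) (by simp),
    intervalIntegral.integral_const_mul] at h2
  simp only [intervalIntegral.integral_const, sub_zero, smul_eq_mul] at h2
  nlinarith

/-- Integration by parts. -/
theorem integral_mul_eq (h : IsPrimitiveOn L f g) (hL : 0 ≤ L) {p q : ℝ → ℝ}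
    (h' : IsPrimitiveOn L p q) :
    ∫ x in (0 : ℝ)..L, f x * q x = f L * p L - f 0 * p 0 - ∫ x in (0 : ℝ)..L, g x * p x := by
  have hg := h.1.intervalIntegrable hL
  have hq := h'.1.intervalIntegrable hL
  have h0 : (0 : ℝ) ∈ Set.uIcc 0 L := Set.left_mem_uIcc
  -- The product rule is applied to the indefinite integrals of `g` and `q`; `e2` and `e3` then put
  -- back the constants `f 0` and `p 0`.
  have aF := hg.absolutelyContinuousOnInterval_intervalIntegral h0
  have aP := hq.absolutelyContinuousOnInterval_intervalIntegral h0
  have key := aF.integral_deriv_mul_eq_sub aP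
  have e1 : ∫ x in (0 : ℝ)..L, (g x * (∫ t in (0 : ℝ)..x, q t) + (∫ t in (0 : ℝ)..x, g t) * q x) =
      (∫ t in (0 : ℝ)..L, g t) * ∫ t in (0 : ℝ)..L, q t := by
    rw [intervalIntegral.integral_same, zero_mul, sub_zero] at key
    rw [← key]
    refine intervalIntegral.integral_congr_ae ?_
    filter_upwards [hg.ae_hasDerivAt_integral, hq.ae_hasDerivAt_integral] with x h1 h2 hx
    have hx := Set.uIoc_subset_uIcc hx
    rw [(h1 hx 0 h0).deriv, (h2 hx 0 h0).deriv]
  have i1 : IntervalIntegrable (fun x => g x * ∫ t in (0 : ℝ)..x, q t) volume 0 L :=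
    hg.mul_continuousOn aP.continuousOn
  have i2 : IntervalIntegrable (fun x => (∫ t in (0 : ℝ)..x, g t) * q x) volume 0 L :=
    hq.continuousOn_mul aF.continuousOn
  rw [intervalIntegral.integral_add i1 i2] at e1
  have e2 : ∫ x in (0 : ℝ)..L, f x * q x =
      f 0 * (∫ t in (0 : ℝ)..L, q t) + ∫ x in (0 : ℝ)..L, (∫ t in (0 : ℝ)..x, g t) * q x := by
    rw [← intervalIntegral.integral_const_mul, ← intervalIntegral.integral_add (hq.const_mul _) i2]
    refine intervalIntegral.integral_congr fun x hx => ?_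
    rw [Set.uIcc_of_le hL] at hx
    simp only [h.2 x hx]
    ring
  have e3 : ∫ x in (0 : ℝ)..L, g x * p x =
      (∫ t in (0 : ℝ)..L, g t) * p 0 + ∫ x in (0 : ℝ)..L, g x * ∫ t in (0 : ℝ)..x, q t := by
    rw [← intervalIntegral.integral_mul_const, ← intervalIntegral.integral_add (hg.mul_const _) i1]
    refine intervalIntegral.integral_congr fun x hx => ?_
    rw [Set.uIcc_of_le hL] at hx
    simp only [h'.2 x hx]
    ring
  rw [e2, e3, h.2 L ⟨hL, le_rfl⟩, h'.2 L ⟨hL, le_rfl⟩]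
  linear_combination e1

end IsPrimitiveOn

/-- The lemma of du Bois-Reymond. -/
theorem L2On.exists_ae_eq_const {L : ℝ} (hL : 0 < L) {g : ℝ → ℝ} (hg : L2On L g)
    (h : ∀ p, L2On L p → ∫ x in (0 : ℝ)..L, p x = 0 → ∫ x in (0 : ℝ)..L, g x * p x = 0) :
    ∃ c, ∀ᵐ x ∂(volume.restrict (Set.Ioc 0 L)), g x = c := by
  set c := (∫ x in (0 : ℝ)..L, g x) / L
  -- `g` minus its mean is itself an admissible test function, and testing with it shows that its
  -- norm vanishes.
  have hp : L2On L (fun x => g x - c) := hg.sub (L2On.const L c)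
  have ig := hg.intervalIntegrable hL.le
  have h0 : ∫ x in (0 : ℝ)..L, (g x - c) = 0 := by
    rw [intervalIntegral.integral_sub ig (by simp)]
    simp only [intervalIntegral.integral_const, sub_zero, smul_eq_mul, c]
    field_simp
    ring
  have h1 := h _ hp h0
  have h2 : ∫ x in (0 : ℝ)..L, (g x - c) * (g x - c) = 0 := by
    have : ∀ x, (g x - c) * (g x - c) = g x * (g x - c) - c * (g x - c) := fun x => by ring
    simp only [this]
    rw [intervalIntegral.integral_sub (hg.integrable_mul hp hL.le)
      ((hp.intervalIntegrable hL.le).const_mul c), h1, intervalIntegral.integral_const_mul, h0]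
    ring
  rw [intervalIntegral.integral_of_le hL.le, integral_eq_zero_iff_of_nonneg
    (fun x => mul_self_nonneg _) (MemLp.integrable_mul hp hp)] at h2
  refine ⟨c, ?_⟩
  filter_upwards [h2] with x hx
  simpa [sub_eq_zero] using hx

/-! ### Linear rescaling of an interval. -/

theorem L2On.comp_mul_left {l c : ℝ} (hc : 0 < c) {g : ℝ → ℝ} (hg : L2On l g) :
    L2On (l / c) (fun x => g (c * x)) := by
  have he : MeasurableEmbedding fun x : ℝ => c * x :=
    (Homeomorph.mulLeft₀ c hc.ne').measurableEmbedding
  have h1 : (volume.restrict (Set.Ioc 0 (l / c))).map (fun x => c * x) =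
      ENNReal.ofReal |c⁻¹| • volume.restrict (Set.Ioc 0 l) := by
    rw [← Measure.restrict_smul, ← Real.map_volume_mul_left hc.ne', he.restrict_map]
    congr 2
    ext x
    simp only [Set.mem_Ioc, Set.mem_preimage, le_div_iff₀ hc, mul_pos_iff_of_pos_left hc,
      mul_comm x c]
  have h2 : MemLp g 2 ((volume.restrict (Set.Ioc 0 (l / c))).map (fun x => c * x)) := by
    rw [h1]
    exact hg.smul_measure ENNReal.ofReal_ne_top
  exact (he.memLp_map_measure_iff).1 h2

theorem L2On.comp_div {l L : ℝ} (hl : 0 < l) (hL : 0 < L) {g : ℝ → ℝ} (hg : L2On l g) :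
    L2On L (fun x => g (l / L * x)) := by
  have := hg.comp_mul_left (div_pos hl hL)
  rwa [div_div_cancel₀ hl.ne'] at this

theorem integral_comp_div {l L : ℝ} (hl : 0 < l) (hL : 0 < L) (h : ℝ → ℝ) :
    ∫ x in (0 : ℝ)..L, h (l / L * x) = L / l * ∫ x in (0 : ℝ)..l, h x := by
  rw [intervalIntegral.integral_comp_mul_left _ (div_pos hl hL).ne']
  simp [div_mul_cancel₀ l hL.ne']

theorem IsPrimitiveOn.comp_div {l L : ℝ} (hl : 0 < l) (hL : 0 < L) {f g : ℝ → ℝ}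
    (h : IsPrimitiveOn l f g) :
    IsPrimitiveOn L (fun x => f (l / L * x)) (fun x => l / L * g (l / L * x)) := by
  refine ⟨(h.1.comp_div hl hL).const_mul _, fun x hx => ?_⟩
  have hx' : l / L * x ∈ Set.Icc 0 l := by
    refine ⟨mul_nonneg (div_pos hl hL).le hx.1, ?_⟩
    rw [div_mul_eq_mul_div, div_le_iff₀ hL]
    exact mul_le_mul_of_nonneg_left hx.2 hl.le
  rw [intervalIntegral.integral_const_mul,
    intervalIntegral.integral_comp_mul_left _ (div_pos hl hL).ne', smul_eq_mul,
    mul_inv_cancel_left₀ (div_pos hl hL).ne', mul_zero]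
  simpa using h.2 _ hx'

/-! ### Compactness along ultrafilters. -/

theorem Ultrafilter.exists_tendsto_of_abs_le {ι : Type*} (𝒰 : Ultrafilter ι) {a : ι → ℝ} {B : ℝ}
    (h : ∀ᶠ i in 𝒰, |a i| ≤ B) : ∃ x, Tendsto a 𝒰 (𝓝 x) := by
  obtain ⟨x, -, hx⟩ := (isCompact_Icc (a := -B) (b := B)).ultrafilter_le_nhds (𝒰.map a) (by
    rw [le_principal_iff]
    exact h.mono fun i hi => abs_le.1 hi)
  exact ⟨x, hx⟩

/-- Bounded families in a Hilbert space converge weakly along ultrafilters. -/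
theorem Ultrafilter.exists_tendsto_inner {ι H : Type*} [NormedAddCommGroup H]
    [InnerProductSpace ℝ H] [CompleteSpace H] (𝒰 : Ultrafilter ι) {a : ι → H} {B : ℝ}
    (h : ∀ᶠ i in 𝒰, ‖a i‖ ≤ B) :
    ∃ x : H, ∀ y, Tendsto (fun i => inner ℝ (a i) y) 𝒰 (𝓝 (inner ℝ x y)) := by
  let T : H → WeakDual ℝ H := fun x => StrongDual.toWeakDual (InnerProductSpace.toDual ℝ H x)
  -- Banach–Alaoglu in the dual, carried back to `H` by the Riesz representation.
  obtain ⟨φ, -, hφ⟩ := (WeakDual.isCompact_closedBall (𝕜 := ℝ) (E := H) 0 B).ultrafilter_le_nhds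
    (𝒰.map fun i => T (a i)) (by
      rw [le_principal_iff]
      refine h.mono fun i hi => ?_
      simpa [T] using hi)
  refine ⟨(InnerProductSpace.toDual ℝ H).symm (WeakDual.toStrongDual φ), fun y => ?_⟩
  have h1 : Tendsto (fun i => T (a i)) 𝒰 (𝓝 φ) := hφ
  have h2 := ((WeakDual.eval_continuous y).tendsto φ).comp h1
  rw [InnerProductSpace.toDual_symm_apply]
  exact h2

/-- An Arzelà–Ascoli argument. The derivatives have a weak limit `G`; testing with indicators of
`(0, t]` gives pointwise convergence of the primitives, and the uniform 1/2-Hölder bound makes it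
uniform. -/
theorem exists_isPrimitiveOn_one_limit {ι : Type*} (𝒰 : Ultrafilter ι) {f g : ι → ℝ → ℝ}
    (h : ∀ i, IsPrimitiveOn 1 (f i) (g i)) {B C : ℝ} (hB : ∀ᶠ i in 𝒰, |f i 0| ≤ B)
    (hC : ∀ᶠ i in 𝒰, ∫ x in (0 : ℝ)..1, g i x * g i x ≤ C) :
    ∃ F G, IsPrimitiveOn 1 F G ∧
      (∀ ε > 0, ∀ᶠ i in 𝒰, ∀ t ∈ Set.Icc (0 : ℝ) 1, |f i t - F t| < ε) ∧
      ∀ p, L2On 1 p → Tendsto (fun i => ∫ x in (0 : ℝ)..1, g i x * p x) 𝒰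
        (𝓝 (∫ x in (0 : ℝ)..1, G x * p x)) := by
  obtain ⟨a, ha⟩ := 𝒰.exists_tendsto_of_abs_le hB
  obtain ⟨G', hG'⟩ := 𝒰.exists_tendsto_inner (a := fun i => (h i).1.toLp (g i)) (B := √C) (by
    filter_upwards [hC] with i hi
    refine Real.le_sqrt_of_sq_le ?_
    rwa [← real_inner_self_eq_norm_sq, L2_inner_toLp, ← intervalIntegral.integral_of_le zero_le_one])
  have mG : L2On 1 G' := Lp.memLp G'
  have weak : ∀ p, L2On 1 p → Tendsto (fun i => ∫ x in (0 : ℝ)..1, g i x * p x) 𝒰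
        (𝓝 (∫ x in (0 : ℝ)..1, G' x * p x)) := by
    intro p hp
    have := hG' (hp.toLp p)
    simp only [L2_inner_toLp] at this
    rw [← Lp.toLp_coeFn G' mG, L2_inner_toLp] at this
    simpa only [intervalIntegral.integral_of_le zero_le_one] using this
  let F : ℝ → ℝ := fun x => a + ∫ t in (0 : ℝ)..x, G' t
  have hF : IsPrimitiveOn 1 F G' := ⟨mG, fun x _ => by simp [F]⟩
  have ptw : ∀ t ∈ Set.Icc (0 : ℝ) 1, Tendsto (fun i => f i t) 𝒰 (𝓝 (F t)) := by
    intro t ht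
    have hind : ∀ q : ℝ → ℝ, ∫ x in (0 : ℝ)..1, q x * (Set.Ioc 0 t).indicator (fun _ => (1 : ℝ)) x =
        ∫ x in (0 : ℝ)..t, q x := by
      intro q
      rw [intervalIntegral.integral_of_le zero_le_one, intervalIntegral.integral_of_le ht.1]
      have : ∀ x, q x * (Set.Ioc 0 t).indicator (fun _ => (1 : ℝ)) x =
        (Set.Ioc 0 t).indicator q x := fun x => by
          by_cases hx : x ∈ Set.Ioc 0 t <;> simp [hx]
      simp only [this]
      rw [setIntegral_indicator measurableSet_Ioc, Set.inter_eq_self_of_subset_right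
        (Set.Ioc_subset_Ioc_right ht.2)]
    have h1 := weak ((Set.Ioc 0 t).indicator fun _ => 1)
      ((memLp_const 1).indicator measurableSet_Ioc)
    simp only [hind] at h1
    exact (ha.add h1).congr fun i => ((h i).2 t ht).symm
  refine ⟨F, G', hF, fun ε hε => ?_, weak⟩
  by_contra hcon
  rw [← Ultrafilter.eventually_not] at hcon
  push Not at hcon
  have hch : ∀ i, ∃ t ∈ Set.Icc (0 : ℝ) 1,
      (∃ s ∈ Set.Icc (0 : ℝ) 1, ε ≤ |f i s - F s|) → ε ≤ |f i t - F t| := by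
    intro i
    by_cases hi : ∃ s ∈ Set.Icc (0 : ℝ) 1, ε ≤ |f i s - F s|
    · obtain ⟨s, hs, hs'⟩ := hi
      exact ⟨s, hs, fun _ => hs'⟩
    · exact ⟨0, by simp, fun h => absurd h hi⟩
  choose t ht ht' using hch
  -- The bad points tend to some `τ`. Equicontinuity of the `f i`, convergence at `τ` and continuity
  -- of `F` then make the deviation at `t i` small.
  obtain ⟨τ, hτ, hlim⟩ := (isCompact_Icc (a := (0 : ℝ)) (b := 1)).ultrafilter_le_nhds (𝒰.map t)
    (by rw [le_principal_iff]; exact (Eventually.of_forall ht : ∀ᶠ i in 𝒰, t i ∈ Set.Icc 0 1))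
  replace hlim : Tendsto t 𝒰 (𝓝 τ) := hlim
  have l1 : Tendsto (fun i => √(|t i - τ| * C)) 𝒰 (𝓝 0) := by
    have : Continuous fun y : ℝ => √(|y - τ| * C) := by fun_prop
    have h1 := (this.tendsto τ).comp hlim
    rw [sub_self, abs_zero, zero_mul, Real.sqrt_zero] at h1
    exact h1
  have l2 : Tendsto (fun i => |f i τ - F τ|) 𝒰 (𝓝 0) := by
    simpa using ((ptw τ hτ).sub_const (F τ)).abs
  have l3 : Tendsto (fun i => |F (t i) - F τ|) 𝒰 (𝓝 0) := by
    have h1 := (hF.continuousOn τ hτ).tendsto.comp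
      (tendsto_nhdsWithin_iff.2 ⟨hlim, Eventually.of_forall ht⟩)
    simpa using (h1.sub_const (F τ)).abs
  have l4 := (l1.add l2).add l3
  simp only [add_zero] at l4
  obtain ⟨i, hi1, hi2, hi3⟩ := ((l4.eventually (gt_mem_nhds hε)).and (hC.and hcon)).exists
  have b1 := (h i).abs_sub_le hτ (ht i)
  have b2 : √(|t i - τ| * ∫ x in (0 : ℝ)..1, g i x * g i x) ≤ √(|t i - τ| * C) :=
    Real.sqrt_le_sqrt (mul_le_mul_of_nonneg_left hi2 (abs_nonneg _))
  have b3 := ht' i hi3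
  have b4 : |f i (t i) - F (t i)| ≤ |f i (t i) - f i τ| + |f i τ - F τ| + |F (t i) - F τ| := by
    have := abs_add_three (f i (t i) - f i τ) (f i τ - F τ) (F τ - F (t i))
    rw [abs_sub_comm (F τ)] at this
    rwa [sub_add_sub_cancel, sub_add_sub_cancel] at this
  linarith

/-- Compactness on an edge: if the lengths `len i` converge to a positive limit `L`, then functions
with bounded energy on `[0, len i]` converge uniformly after rescaling, and their rescaled
derivatives converge weakly. -/
theorem exists_isPrimitiveOn_limit {ι : Type*} (𝒰 : Ultrafilter ι) {len : ι → ℝ} {L : ℝ}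
    (hL : 0 < L) (hlen : ∀ i, 0 < len i) (hlim : Tendsto len 𝒰 (𝓝 L)) {f g : ι → ℝ → ℝ}
    (h : ∀ i, IsPrimitiveOn (len i) (f i) (g i)) {B C : ℝ} (hB : ∀ᶠ i in 𝒰, |f i 0| ≤ B)
    (hC : ∀ᶠ i in 𝒰, ∫ x in (0 : ℝ)..len i, g i x * g i x ≤ C) :
    ∃ F G, IsPrimitiveOn L F G ∧
      (∀ ε > 0, ∀ᶠ i in 𝒰, ∀ x ∈ Set.Icc 0 (len i), |f i x - F (L / len i * x)| < ε) ∧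
      ∀ p, L2On L p → Tendsto (fun i => ∫ x in (0 : ℝ)..len i, g i x * p (L / len i * x)) 𝒰
        (𝓝 (∫ x in (0 : ℝ)..L, G x * p x)) := by
  -- Everything is moved to [0, 1]. The energy there is `len i` times the original one, hence
  -- eventually at most `(L + 1) * C`.
  have hone : ∀ i, IsPrimitiveOn 1 (fun t => f i (len i / 1 * t))
      (fun t => len i / 1 * g i (len i / 1 * t)) := fun i => (h i).comp_div (hlen i) one_pos
  obtain ⟨F, G, hFG, hu, hw⟩ := exists_isPrimitiveOn_one_limit 𝒰 hone (B := B) (C := (L + 1) * C)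
    (by simpa using hB) (by
      filter_upwards [hC, hlim.eventually (gt_mem_nhds (lt_add_one L))] with i hi hi'
      have e : ∀ x, len i / 1 * g i (len i / 1 * x) * (len i / 1 * g i (len i / 1 * x)) =
        (len i) ^ 2 * (g i (len i / 1 * x) * g i (len i / 1 * x)) := fun x => by ring
      simp only [e]
      rw [intervalIntegral.integral_const_mul,
        integral_comp_div (hlen i) one_pos (fun x => g i x * g i x)]
      have h0 := integral_mul_self_nonneg (hlen i).le (g i)
      have h1 := hlen i
      calc len i ^ 2 * (1 / len i * ∫ x in (0 : ℝ)..len i, g i x * g i x)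
          = len i * ∫ x in (0 : ℝ)..len i, g i x * g i x := by field_simp
        _ ≤ (L + 1) * C := mul_le_mul hi'.le hi h0 (by positivity))
  refine ⟨_, _, hFG.comp_div one_pos hL, fun ε hε => ?_, fun p hp => ?_⟩
  · filter_upwards [hu ε hε] with i hi x hx
    have h1 := hlen i
    have := hi (x / len i) ⟨div_nonneg hx.1 h1.le, div_le_one_of_le₀ hx.2 h1.le⟩
    convert this using 4
    · field_simp
    · field_simp
  · have hp' : L2On 1 (fun t => p (L / 1 * t)) := hp.comp_div hL one_pos
    have h1 := hw _ hp'
    have e2 : ∫ x in (0 : ℝ)..L, 1 / L * G (1 / L * x) * p x =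
        ∫ x in (0 : ℝ)..1, G x * p (L / 1 * x) := by
      have h2 := integral_comp_div one_pos hL (fun x => G x * p (L / 1 * x))
      have h3 : ∀ x, 1 / L * G (1 / L * x) * p x =
          1 / L * (G (1 / L * x) * p (L / 1 * (1 / L * x))) := fun x => by
        rw [div_one, ← mul_assoc L, mul_one_div_cancel hL.ne', one_mul, mul_assoc]
      simp only [h3]
      rw [intervalIntegral.integral_const_mul, h2, div_one, ← mul_assoc, one_div_mul_cancel hL.ne',
        one_mul]
    rw [e2]
    refine h1.congr fun i => ?_
    have hi := hlen i
    have h2 := integral_comp_div hi one_pos (fun x => g i x * p (L / len i * x))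
    have h3 : ∀ x, len i / 1 * g i (len i / 1 * x) * p (L / 1 * x) =
        len i * (g i (len i / 1 * x) * p (L / len i * (len i / 1 * x))) := fun x => by
      rw [div_one, div_one, ← mul_assoc (L / len i), div_mul_cancel₀ _ hi.ne', mul_assoc]
    simp only [h3]
    rw [intervalIntegral.integral_const_mul, h2, ← mul_assoc, mul_one_div_cancel hi.ne', one_mul]

end

/-! ### The abstract eigenvalue problem for a pair of linear maps and its variational principle. -/

noncomputable section

section WeakEigen

variable {X H : Type*} [AddCommGroup X] [Module ℝ X] [NormedAddCommGroup H]
  [InnerProductSpace ℝ H] (A B : X →ₗ[ℝ] H)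

/-- The eigenspace to the eigenvalue `ν` of the form `⟪B u, B v⟫` relative to `⟪A u, A v⟫`. -/
def weakEigenspace (ν : ℝ) : Submodule ℝ X where
  carrier := {u | ∀ v, inner ℝ (B u) (B v) = ν * inner ℝ (A u) (A v)}
  zero_mem' v := by simp
  add_mem' {a b} ha hb v := by
    simp only [map_add, inner_add_left, ha v, hb v]
    ring
  smul_mem' c a ha v := by
    simp only [map_smul, inner_smul_left, ha v]
    simp only [conj_trivial]
    ring

/-- There are `k` orthonormal eigenvectors with eigenvalues at most `Λ`. -/
def HasEigenfamily (Λ : ℝ) (k : ℕ) : Prop :=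
  ∃ (ν : Fin k → ℝ) (u : Fin k → X), (∀ i, ν i ≤ Λ ∧ u i ∈ weakEigenspace A B (ν i)) ∧
    Orthonormal ℝ fun i => A (u i)

/-- Families of bounded energy have limit points, strongly for `A` and weakly for `B`. -/
def EnergyCompact : Prop :=
  ∀ (𝒰 : Ultrafilter ℕ) (u : ℕ → X) (C : ℝ), (∀ n, ‖A (u n)‖ ≤ C) → (∀ n, ‖B (u n)‖ ≤ C) →
    ∃ v, Tendsto (fun n => A (u n)) 𝒰 (𝓝 (A v)) ∧
      ∀ w, Tendsto (fun n => inner ℝ (B (u n)) (B w)) 𝒰 (𝓝 (inner ℝ (B v) (B w)))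

/-- The least `Λ` such that there are `k` orthonormal eigenvectors with eigenvalues at most `Λ`. -/
def formEigenvalue (k : ℕ) : ℝ := sInf {Λ | HasEigenfamily A B Λ k}

variable {A B}

theorem norm_sq_of_mem_weakEigenspace {ν : ℝ} {u : X} (hu : u ∈ weakEigenspace A B ν) :
    ‖B u‖ ^ 2 = ν * ‖A u‖ ^ 2 := by
  rw [← real_inner_self_eq_norm_sq, ← real_inner_self_eq_norm_sq, hu u]

theorem nonneg_of_mem_weakEigenspace {ν : ℝ} {u : X} (hu : u ∈ weakEigenspace A B ν)
    (h1 : ‖A u‖ = 1) : 0 ≤ ν := by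
  have := norm_sq_of_mem_weakEigenspace hu
  rw [h1, one_pow, mul_one] at this
  exact this ▸ sq_nonneg _

theorem inner_eq_zero_of_mem_weakEigenspace {ν ν' : ℝ} {u u' : X} (hu : u ∈ weakEigenspace A B ν)
    (hu' : u' ∈ weakEigenspace A B ν') (h : ν ≠ ν') : inner ℝ (A u) (A u') = 0 := by
  have h1 := hu u'
  have h2 := hu' u
  rw [real_inner_comm, h1, real_inner_comm (A u)] at h2
  have h3 : (ν - ν') * inner ℝ (A u) (A u') = 0 := by rw [sub_mul, h2, sub_self]
  exact (mul_eq_zero.1 h3).resolve_left (sub_ne_zero.2 h)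

theorem HasEigenfamily.mono {Λ Λ' : ℝ} {k : ℕ} (h : HasEigenfamily A B Λ k) (hΛ : Λ ≤ Λ') :
    HasEigenfamily A B Λ' k := by
  obtain ⟨ν, u, h1, h2⟩ := h
  exact ⟨ν, u, fun i => ⟨(h1 i).1.trans hΛ, (h1 i).2⟩, h2⟩

theorem HasEigenfamily.zero (Λ : ℝ) : HasEigenfamily A B Λ 0 :=
  ⟨Fin.elim0, Fin.elim0, fun i => i.elim0, ⟨fun i => i.elim0, fun i => i.elim0⟩⟩

theorem HasEigenfamily.nonneg {Λ : ℝ} {k : ℕ} (h : HasEigenfamily A B Λ k) (hk : 1 ≤ k) :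
    0 ≤ Λ := by
  obtain ⟨ν, u, h1, h2⟩ := h
  exact (nonneg_of_mem_weakEigenspace (h1 ⟨0, hk⟩).2 (h2.1 _)).trans (h1 _).1

/-- The condition `1 ≤ k` makes the set of admissible Λ bounded below; for `k = 0` every real Λ is
admissible. -/
theorem HasEigenfamily.formEigenvalue_le {Λ : ℝ} {k : ℕ} (h : HasEigenfamily A B Λ k)
    (hk : 1 ≤ k) : formEigenvalue A B k ≤ Λ :=
  csInf_le ⟨0, fun _ h' => HasEigenfamily.nonneg h' hk⟩ h

theorem hasEigenfamily_succ {Λ ν' : ℝ} {j : ℕ} {ν : Fin j → ℝ} {u : Fin j → X} {w : X}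
    (h1 : ∀ i, ν i ≤ Λ ∧ u i ∈ weakEigenspace A B (ν i)) (h2 : Orthonormal ℝ fun i => A (u i))
    (hν' : ν' ≤ Λ) (hw : w ∈ weakEigenspace A B ν') (hw1 : ‖A w‖ = 1)
    (h : ∀ i, inner ℝ (A (u i)) (A w) = 0) : HasEigenfamily A B Λ (j + 1) := by
  refine ⟨Fin.cons ν' ν, Fin.cons w u, fun i => ?_, ?_, ?_⟩
  · induction i using Fin.cases with
    | zero => exact ⟨hν', hw⟩
    | succ i => exact h1 i
  · intro i
    induction i using Fin.cases with
    | zero => exact hw1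
    | succ i => exact h2.1 i
  · intro i i' hi
    induction i using Fin.cases with
    | zero =>
      induction i' using Fin.cases with
      | zero => exact absurd rfl hi
      | succ i' => rw [real_inner_comm]; exact h i'
    | succ i =>
      induction i' using Fin.cases with
      | zero => exact h i
      | succ i' => exact h2.2 fun h => hi (congrArg Fin.succ h)

theorem norm_map_smul_inv {u : X} (h : A u ≠ 0) : ‖A (‖A u‖⁻¹ • u)‖ = 1 := by
  rw [map_smul, norm_smul, norm_inv, norm_norm, inv_mul_cancel₀ (norm_ne_zero_iff.2 h)]

theorem rank_span_orthonormal {k : ℕ} {a : Fin k → H} (ha : Orthonormal ℝ a) :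
    Module.rank ℝ (Submodule.span ℝ (Set.range a)) = k := by
  have h1 := finrank_span_eq_card ha.linearIndependent
  have : FiniteDimensional ℝ (Submodule.span ℝ (Set.range a)) :=
    FiniteDimensional.span_of_finite ℝ (Set.finite_range a)
  rw [← Module.finrank_eq_rank, h1, Fintype.card_fin]

/-- Gram–Schmidt within the eigenspaces. This links the count of eigenvalues by dimension with
orthonormal families. -/
theorem le_rank_iSup_map_weakEigenspace_iff {Λ : ℝ} {k : ℕ} :
    (k : Cardinal) ≤ Module.rank ℝ ↥(⨆ ν ∈ Set.Iic Λ, (weakEigenspace A B ν).map A) ↔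
      HasEigenfamily A B Λ k := by
  constructor
  · intro hk
    suffices ∀ j ≤ k, HasEigenfamily A B Λ j from this k le_rfl
    intro j
    induction j with
    | zero => exact fun _ => HasEigenfamily.zero Λ
    | succ j ih =>
      intro hj
      obtain ⟨ν, u, h1, h2⟩ := ih (by omega)
      set S := Submodule.span ℝ (Set.range fun i => A (u i))
      obtain ⟨ν', hν', hS⟩ : ∃ ν' ≤ Λ, ¬ (weakEigenspace A B ν').map A ≤ S := by
        by_contra! hcon
        have : (⨆ ν ∈ Set.Iic Λ, (weakEigenspace A B ν).map A) ≤ S := iSup₂_le hcon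
        have := hk.trans (Submodule.rank_mono this)
        rw [rank_span_orthonormal h2] at this
        have := Nat.cast_le.1 this
        omega
      obtain ⟨_, ⟨g, hg, rfl⟩, hgS⟩ := SetLike.not_le_iff_exists.1 hS
      -- The projection does not leave the eigenspace to `ν'`: vectors `u i` to other eigenvalues
      -- are already orthogonal to `g`, so their coefficients vanish.
      set w := g - ∑ i, inner ℝ (A (u i)) (A g) • u i
      have hw : w ∈ weakEigenspace A B ν' := by
        refine Submodule.sub_mem _ hg (Submodule.sum_mem _ fun i _ => ?_)
        by_cases hi : ν i = ν'
        · exact Submodule.smul_mem _ _ (hi ▸ (h1 i).2)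
        · rw [inner_eq_zero_of_mem_weakEigenspace (h1 i).2 hg hi, zero_smul]
          exact Submodule.zero_mem _
      have hAw : A w = A g - ∑ i, inner ℝ (A (u i)) (A g) • A (u i) := by simp [w]
      have hw0 : A w ≠ 0 := by
        intro h0
        rw [hAw, sub_eq_zero] at h0
        refine hgS (h0 ▸ Submodule.sum_mem _ fun i _ => Submodule.smul_mem _ _ ?_)
        exact Submodule.subset_span ⟨i, rfl⟩
      have horth : ∀ i, inner ℝ (A (u i)) (A w) = 0 := fun i => by
        rw [hAw, inner_sub_right, h2.inner_right_fintype, sub_self]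
      refine hasEigenfamily_succ h1 h2 hν' (Submodule.smul_mem _ ‖A w‖⁻¹ hw)
        (norm_map_smul_inv hw0) fun i => ?_
      rw [map_smul, inner_smul_right, horth, mul_zero]
  · rintro ⟨ν, u, h1, h2⟩
    rw [← rank_span_orthonormal h2]
    refine Submodule.rank_mono (Submodule.span_le.2 ?_)
    rintro _ ⟨i, rfl⟩
    exact Submodule.mem_iSup_of_mem (ν i) (Submodule.mem_iSup_of_mem (h1 i).1 ⟨_, (h1 i).2, rfl⟩)

/-- On the span of the family both quadratic forms are diagonal: they are ∑ ν_i c_i² and ∑ c_i². -/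
theorem energy_le_of_eigenfamily {Λ : ℝ} {k : ℕ} {ν : Fin k → ℝ} {u : Fin k → X}
    (h1 : ∀ i, ν i ≤ Λ ∧ u i ∈ weakEigenspace A B (ν i)) (h2 : Orthonormal ℝ fun i => A (u i))
    (c : Fin k → ℝ) : ‖B (∑ i, c i • u i)‖ ^ 2 ≤ Λ * ‖A (∑ i, c i • u i)‖ ^ 2 := by
  set w := ∑ i, c i • u i
  have hi : ∀ i, inner ℝ (A (u i)) (A w) = c i := fun i => by
    simp only [w, map_sum, map_smul]
    exact h2.inner_right_fintype c i
  have e1 : ‖B w‖ ^ 2 = ∑ i, ν i * c i ^ 2 := by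
    rw [← real_inner_self_eq_norm_sq]
    conv_lhs => enter [2]; rw [show w = ∑ i, c i • u i from rfl]
    simp only [map_sum, map_smul, sum_inner, inner_smul_left, (h1 _).2 w, hi]
    refine Finset.sum_congr rfl fun i _ => ?_
    simp only [conj_trivial]
    ring
  have e2 : ‖A w‖ ^ 2 = ∑ i, c i ^ 2 := by
    rw [← real_inner_self_eq_norm_sq]
    conv_lhs => enter [2]; rw [show w = ∑ i, c i • u i from rfl]
    simp only [map_sum, map_smul, sum_inner, inner_smul_left, hi]
    refine Finset.sum_congr rfl fun i _ => ?_
    simp only [conj_trivial]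
    ring
  rw [e1, e2, Finset.mul_sum]
  exact Finset.sum_le_sum fun i _ => mul_le_mul_of_nonneg_right (h1 i).1 (sq_nonneg _)

/-- Minimisation of the Rayleigh quotient under finitely many orthogonality constraints. -/
theorem EnergyCompact.exists_minimizer (hc : EnergyCompact A B) {Λ : ℝ} {ι : Type*} {f : ι → H}
    {w : X} (hw : ∀ i, inner ℝ (f i) (A w) = 0) (hw1 : ‖A w‖ = 1) (hwΛ : ‖B w‖ ^ 2 ≤ Λ) :
    ∃ u, (∀ i, inner ℝ (f i) (A u) = 0) ∧ ‖A u‖ = 1 ∧ ∃ m ≤ Λ, ∀ v,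
      (∀ i, inner ℝ (f i) (A v) = 0) → inner ℝ (B u) (B v) = m * inner ℝ (A u) (A v) := by
  set S : Set ℝ := {q | ∃ v, (∀ i, inner ℝ (f i) (A v) = 0) ∧ ‖A v‖ = 1 ∧ ‖B v‖ ^ 2 = q}
  have hne : S.Nonempty := ⟨_, w, hw, hw1, rfl⟩
  have hbd : BddBelow S := ⟨0, by rintro _ ⟨v, -, -, rfl⟩; positivity⟩
  set m := sInf S
  obtain ⟨q, -, hq, hqS⟩ := exists_seq_tendsto_sInf hne hbd
  choose v hv0 hv1 hvq using hqS
  obtain ⟨C, hC⟩ := hq.bddAbove_range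
  have hBv : ∀ n, ‖B (v n)‖ ≤ max 1 (√C) := fun n =>
    (Real.le_sqrt_of_sq_le (by rw [hvq]; exact hC ⟨n, rfl⟩)).trans (le_max_right _ _)
  set 𝒰 : Ultrafilter ℕ := Filter.hyperfilter ℕ
  have h𝒰 : (𝒰 : Filter ℕ) ≤ atTop := Nat.hyperfilter_le_atTop
  obtain ⟨u, hAu, hBu⟩ := hc 𝒰 v (max 1 √C) (fun n => (hv1 n).le.trans (le_max_left _ _)) hBv
  have hu0 : ∀ i, inner ℝ (f i) (A u) = 0 := fun i => by
    refine tendsto_nhds_unique ((tendsto_const_nhds (x := f i)).inner hAu) ?_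
    simp [hv0]
  have hu1 : ‖A u‖ = 1 := by
    refine tendsto_nhds_unique hAu.norm ?_
    simp [hv1]
  -- Weak lower semicontinuity, from ⟨B v_n, B u⟩ ≤ (‖B v_n‖² + ‖B u‖²)/2.
  have hum : ‖B u‖ ^ 2 ≤ m := by
    have h1 := hBu u
    rw [real_inner_self_eq_norm_sq] at h1
    have h2 : ‖B u‖ ^ 2 ≤ (m + ‖B u‖ ^ 2) / 2 := by
      refine le_of_tendsto_of_tendsto' h1 (((hq.mono_left h𝒰).add_const (‖B u‖ ^ 2)).div_const 2)
        fun n => ?_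
      have := real_inner_le_norm (B (v n)) (B u)
      rw [← hvq]
      nlinarith [sq_nonneg (‖B (v n)‖ - ‖B u‖)]
    linarith
  refine ⟨u, hu0, hu1, m, (csInf_le hbd ⟨w, hw, hw1, rfl⟩).trans hwΛ, fun p hp => ?_⟩
  have hmin : ∀ p, (∀ i, inner ℝ (f i) (A p) = 0) → m * ‖A p‖ ^ 2 ≤ ‖B p‖ ^ 2 := by
    intro p hp
    by_cases h0 : A p = 0
    · rw [h0, norm_zero]
      nlinarith [sq_nonneg ‖B p‖]
    · have hn := norm_ne_zero_iff.2 h0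
      have := csInf_le hbd (⟨‖A p‖⁻¹ • p, fun i => by rw [map_smul, inner_smul_right, hp, mul_zero],
        norm_map_smul_inv h0, rfl⟩ : ‖B (‖A p‖⁻¹ • p)‖ ^ 2 ∈ S)
      rw [map_smul, norm_smul, norm_inv, norm_norm, mul_pow, inv_pow] at this
      have h2 : 0 < ‖A p‖ ^ 2 := by positivity
      calc m * ‖A p‖ ^ 2 ≤ ((‖A p‖ ^ 2)⁻¹ * ‖B p‖ ^ 2) * ‖A p‖ ^ 2 :=
            mul_le_mul_of_nonneg_right this h2.le
        _ = ‖B p‖ ^ 2 := by field_simp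
  set b := inner ℝ (B u) (B p) - m * inner ℝ (A u) (A p)
  set c := ‖B p‖ ^ 2 - m * ‖A p‖ ^ 2
  have hc0 : 0 ≤ c := sub_nonneg.2 (hmin p hp)
  -- First variation: perturb the minimiser to `u + t • p`. A nonnegative quadratic in `t` without
  -- constant term has zero linear coefficient.
  have hquad : ∀ t : ℝ, 0 ≤ 2 * t * b + t ^ 2 * c := by
    intro t
    have h1 := hmin (u + t • p) fun i => by
      rw [map_add, map_smul, inner_add_right, inner_smul_right, hu0, hp, mul_zero, add_zero]
    simp only [map_add, map_smul, norm_add_sq_real, inner_smul_right, norm_smul, mul_pow, hu1,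
      Real.norm_eq_abs, sq_abs] at h1
    simp only [b, c]
    nlinarith
  have hb : b = 0 := by
    -- The `+ 1` covers the case `c = 0`.
    have h1 := hquad (-b / (c + 1))
    have h2 : 0 < c + 1 := by linarith
    have h3 : 2 * (-b / (c + 1)) * b + (-b / (c + 1)) ^ 2 * c = -(b ^ 2 * (c + 2)) / (c + 1) ^ 2 := by
      field_simp
      ring
    rw [h3, le_div_iff₀ (by positivity)] at h1
    have h4 : b ^ 2 = 0 := by nlinarith [sq_nonneg b]
    exact pow_eq_zero_iff two_ne_zero |>.1 h4
  exact sub_eq_zero.1 hb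

/-- The variational principle. -/
theorem EnergyCompact.hasEigenfamily (hc : EnergyCompact A B) {Λ : ℝ} {k : ℕ} {w : Fin k → X}
    (hw : LinearIndependent ℝ fun i => A (w i))
    (hΛ : ∀ c : Fin k → ℝ, ‖B (∑ i, c i • w i)‖ ^ 2 ≤ Λ * ‖A (∑ i, c i • w i)‖ ^ 2) :
    HasEigenfamily A B Λ k := by
  suffices ∀ j ≤ k, HasEigenfamily A B Λ j from this k le_rfl
  intro j
  induction j with
  | zero => exact fun _ => HasEigenfamily.zero Λ
  | succ j ih =>
    intro hj
    obtain ⟨ν, f, h1, h2⟩ := ih (by omega)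
    -- There are `j < k` orthogonality constraints on `k` coefficients, so a nonzero combination of
    -- the `w i` satisfies all of them and bounds the constrained minimum by `Λ`.
    let T : (Fin k → ℝ) →ₗ[ℝ] (Fin j → ℝ) := LinearMap.pi fun i =>
      ((innerₗ H (A (f i))).comp A).comp (Fintype.linearCombination ℝ w)
    obtain ⟨c, hcT, hc0⟩ := Submodule.exists_mem_ne_zero_of_ne_bot
      (LinearMap.ker_ne_bot_of_finrank_lt (f := T) (by simpa using hj))
    set p := ∑ i, c i • w i
    have hp : ∀ i, inner ℝ (A (f i)) (A p) = 0 := fun i => congrFun (LinearMap.mem_ker.1 hcT) i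
    have hp0 : A p ≠ 0 := by
      intro h0
      simp only [p, map_sum, map_smul] at h0
      exact hc0 (funext (Fintype.linearIndependent_iff.1 hw c h0))
    obtain ⟨u, hu0, hu1, m, hm, hum⟩ := hc.exists_minimizer (Λ := Λ) (f := fun i => A (f i))
      (w := ‖A p‖⁻¹ • p) (fun i => by rw [map_smul, inner_smul_right, hp, mul_zero])
      (norm_map_smul_inv hp0) (by
        rw [map_smul, norm_smul, norm_inv, norm_norm, mul_pow, inv_pow,
          inv_mul_le_iff₀ (by positivity), mul_comm]
        exact hΛ c)
    refine hasEigenfamily_succ h1 h2 hm (fun v => ?_) hu1 hu0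
    -- The minimiser satisfies the equation only for constrained test vectors. An arbitrary `v` is
    -- projected; the discarded components contribute to neither side because the `f i` are
    -- eigenvectors orthogonal to `u`.
    have h3 := hum (v - ∑ i, inner ℝ (A (f i)) (A v) • f i) fun i => by
      rw [map_sub, map_sum]
      simp only [map_smul]
      rw [inner_sub_right, h2.inner_right_fintype, sub_self]
    have h4 : ∀ i, inner ℝ (A u) (A (f i)) = 0 := fun i => by rw [real_inner_comm, hu0]
    have h5 : ∀ i, inner ℝ (B u) (B (f i)) = 0 := fun i => by
      rw [real_inner_comm, (h1 i).2 u, hu0, mul_zero]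
    simpa [inner_sub_right, inner_sum, inner_smul_right, h4, h5] using h3

/-- The variational principle, with some bound on the Rayleigh quotient. -/
theorem EnergyCompact.exists_hasEigenfamily (hc : EnergyCompact A B) {k : ℕ} {w : Fin k → X}
    (hw : LinearIndependent ℝ fun i => A (w i)) : ∃ Λ, HasEigenfamily A B Λ k := by
  let S : (Fin k → ℝ) →ₗ[ℝ] X := Fintype.linearCombination ℝ w
  have hker : (A ∘ₗ S).ker = ⊥ := by
    refine LinearMap.ker_eq_bot'.2 fun c h0 => ?_
    simp only [S, LinearMap.comp_apply, Fintype.linearCombination_apply, map_sum, map_smul] at h0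
    exact funext (Fintype.linearIndependent_iff.1 hw c h0)
  -- On a finite-dimensional space the injective map `A ∘ₗ S` is bounded below and `B ∘ₗ S` is
  -- bounded, so the Rayleigh quotient is bounded.
  obtain ⟨K, -, hK⟩ := LinearMap.exists_antilipschitzWith _ hker
  let T := LinearMap.toContinuousLinearMap (B ∘ₗ S)
  refine ⟨(‖T‖ * K) ^ 2, hc.hasEigenfamily hw fun c => ?_⟩
  have h1 : ‖B (S c)‖ ≤ ‖T‖ * ‖c‖ := T.le_opNorm c
  have h2 : ‖c‖ ≤ K * ‖A (S c)‖ := by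
    simpa using hK.le_mul_dist c 0
  change ‖B (S c)‖ ^ 2 ≤ _ * ‖A (S c)‖ ^ 2
  rw [← mul_pow]
  refine pow_le_pow_left₀ (norm_nonneg _) (h1.trans ?_) 2
  rw [mul_assoc]
  exact mul_le_mul_of_nonneg_left h2 (norm_nonneg _)

/-- The infimum is attained: eigenfamilies for a minimising sequence have limits along an
ultrafilter. Strong convergence under `A` keeps orthonormality, and weak convergence under `B`
suffices for the eigenvalue equation. -/
theorem EnergyCompact.hasEigenfamily_formEigenvalue (hc : EnergyCompact A B) {k : ℕ} (hk : 1 ≤ k)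
    (hne : ∃ Λ, HasEigenfamily A B Λ k) : HasEigenfamily A B (formEigenvalue A B k) k := by
  obtain ⟨q, -, hq, hqS⟩ := exists_seq_tendsto_sInf (S := {Λ | HasEigenfamily A B Λ k}) hne
    ⟨0, fun _ h' => HasEigenfamily.nonneg h' hk⟩
  choose ν u h1 h2 using hqS
  obtain ⟨C, hC⟩ := hq.bddAbove_range
  replace hC : ∀ n, q n ≤ C := fun n => hC ⟨n, rfl⟩
  set 𝒰 : Ultrafilter ℕ := Filter.hyperfilter ℕ
  have h𝒰 : (𝒰 : Filter ℕ) ≤ atTop := Nat.hyperfilter_le_atTop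
  have hν0 : ∀ n i, 0 ≤ ν n i := fun n i => nonneg_of_mem_weakEigenspace (h1 n i).2 ((h2 n).1 i)
  have hν : ∀ i, ∃ x, Tendsto (fun n => ν n i) 𝒰 (𝓝 x) := fun i =>
    𝒰.exists_tendsto_of_abs_le (B := C) (Eventually.of_forall fun n => by
      rw [abs_of_nonneg (hν0 n i)]
      exact (h1 n i).1.trans (hC n))
  have hu : ∀ i, ∃ v, Tendsto (fun n => A (u n i)) 𝒰 (𝓝 (A v)) ∧
      ∀ w, Tendsto (fun n => inner ℝ (B (u n i)) (B w)) 𝒰 (𝓝 (inner ℝ (B v) (B w))) := fun i => by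
    refine hc 𝒰 (fun n => u n i) (max 1 √C) (fun n => ((h2 n).1 i).le.trans (le_max_left _ _))
      fun n => le_trans (Real.le_sqrt_of_sq_le ?_) (le_max_right _ _)
    rw [norm_sq_of_mem_weakEigenspace (h1 n i).2, (h2 n).1 i, one_pow, mul_one]
    exact (h1 n i).1.trans (hC n)
  choose ν' hν' using hν
  choose v hvA hvB using hu
  refine ⟨ν', v, fun i => ⟨?_, fun w => ?_⟩, ?_⟩
  · exact le_of_tendsto_of_tendsto' (hν' i) (hq.mono_left h𝒰) fun n => (h1 n i).1
  · refine tendsto_nhds_unique (hvB i w) ?_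
    simp only [(h1 _ i).2 w]
    exact (hν' i).mul ((hvA i).inner tendsto_const_nhds)
  · rw [orthonormal_iff_ite]
    intro i j
    refine tendsto_nhds_unique ((hvA i).inner (hvA j)) ?_
    simp only [orthonormal_iff_ite.1 (h2 _) i j]
    exact tendsto_const_nhds

/-- If all eigenvalues of an optimal family lay strictly below the infimum, their maximum would be a
smaller admissible bound. -/
theorem EnergyCompact.exists_mem_weakEigenspace_formEigenvalue (hc : EnergyCompact A B) {k : ℕ}
    (hk : 1 ≤ k) (hne : ∃ Λ, HasEigenfamily A B Λ k) :
    ∃ u ∈ weakEigenspace A B (formEigenvalue A B k), ‖A u‖ = 1 := by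
  obtain ⟨ν, u, h1, h2⟩ := hc.hasEigenfamily_formEigenvalue hk hne
  by_contra! hcon
  have hlt : ∀ i, ν i < formEigenvalue A B k := fun i =>
    (h1 i).1.lt_of_ne fun h => hcon (u i) (h ▸ (h1 i).2) (h2.1 i)
  have : Nonempty (Fin k) := ⟨⟨0, hk⟩⟩
  obtain ⟨i, hi⟩ := Finite.exists_max ν
  exact (hlt i).not_ge (HasEigenfamily.formEigenvalue_le ⟨ν, u, fun j => ⟨hi j, (h1 j).2⟩, h2⟩ hk)

/-- Some eigenvector is not a multiple of `u` under `A`; orthogonalise it. Infinite dimension, where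
`finrank` is 0, is covered too. -/
theorem exists_orthonormal_of_finrank_ne_one {ν : ℝ} {u : X} (hu : u ∈ weakEigenspace A B ν)
    (hu1 : ‖A u‖ = 1) (h : Module.finrank ℝ ((weakEigenspace A B ν).map A) ≠ 1) :
    ∃ v ∈ weakEigenspace A B ν, ‖A v‖ = 1 ∧ inner ℝ (A u) (A v) = 0 := by
  have hne : (⟨A u, u, hu, rfl⟩ : (weakEigenspace A B ν).map A) ≠ 0 := by
    intro h0
    have : A u = 0 := congrArg Subtype.val h0
    rw [this, norm_zero] at hu1
    exact zero_ne_one hu1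
  rw [Ne, finrank_eq_one_iff_of_nonzero' _ hne] at h
  push Not at h
  obtain ⟨⟨_, g, hg, rfl⟩, hgc⟩ := h
  set w := g - inner ℝ (A u) (A g) • u
  have hw : w ∈ weakEigenspace A B ν := Submodule.sub_mem _ hg (Submodule.smul_mem _ _ hu)
  have hw0 : A w ≠ 0 := by
    intro h0
    rw [map_sub, map_smul, sub_eq_zero] at h0
    exact hgc (inner ℝ (A u) (A g)) (Subtype.ext h0.symm)
  refine ⟨‖A w‖⁻¹ • w, Submodule.smul_mem _ _ hw, norm_map_smul_inv hw0, ?_⟩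
  rw [map_smul, inner_smul_right, map_sub, map_smul, inner_sub_right, inner_smul_right,
    real_inner_self_eq_norm_sq, hu1]
  ring

theorem eq_or_eq_neg_of_finrank_eq_one {ν : ℝ} {u v : X} (hu : u ∈ weakEigenspace A B ν)
    (hu1 : ‖A u‖ = 1) (hv : v ∈ weakEigenspace A B ν) (hv1 : ‖A v‖ = 1)
    (h : Module.finrank ℝ ((weakEigenspace A B ν).map A) = 1) : A v = A u ∨ A v = -A u := by
  have hne : (⟨A u, u, hu, rfl⟩ : (weakEigenspace A B ν).map A) ≠ 0 := by
    intro h0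
    have : A u = 0 := congrArg Subtype.val h0
    rw [this, norm_zero] at hu1
    exact zero_ne_one hu1
  obtain ⟨c, hc⟩ := (finrank_eq_one_iff_of_nonzero' _ hne).1 h ⟨A v, v, hv, rfl⟩
  replace hc : c • A u = A v := congrArg Subtype.val hc
  have h1 : |c| = 1 := by
    rw [← hc, norm_smul, hu1, mul_one] at hv1
    exact hv1
  rcases eq_or_eq_neg_of_abs_eq h1 with rfl | rfl
  · left; rw [← hc, one_smul]
  · right; rw [← hc, neg_one_smul]

end WeakEigen

/-- Both images are quotients of `F` by the same kernel. This transfers dimensions between spaces of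
functions and their classes in L². -/
theorem rank_range_eq_of_ker_eq {X : Type*} {M N : Type*} [AddCommGroup X] [Module ℝ X]
    [AddCommGroup M] [Module ℝ M] [AddCommGroup N] [Module ℝ N] (f : X →ₗ[ℝ] M) (g : X →ₗ[ℝ] N)
    (h : f.ker = g.ker) (F : Submodule ℝ X) : Nonempty (F.map f ≃ₗ[ℝ] F.map g) := by
  have hk : (f.domRestrict F).ker = (g.domRestrict F).ker := by
    ext x
    have := SetLike.ext_iff.1 h (x : X)
    simpa using this
  have e := ((f.domRestrict F).quotKerEquivRange.symm.trans (Submodule.quotEquivOfEq _ _ hk)).trans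
    (g.domRestrict F).quotKerEquivRange
  rw [LinearMap.range_domRestrict, LinearMap.range_domRestrict] at e
  exact ⟨e⟩

end

/-! ### The space H¹(Γ) of a metric graph and its compactness. -/

noncomputable section

theorem IsPrimitiveOn.congr {L : ℝ} {f g f' g' : ℝ → ℝ} (h : IsPrimitiveOn L f g)
    (hf : ∀ x ∈ Set.Icc 0 L, f' x = f x)
    (hg : ∀ᵐ x ∂(volume.restrict (Set.Ioc 0 L)), g' x = g x) : IsPrimitiveOn L f' g' := by
  refine ⟨h.1.ae_eq (hg.mono fun x hx => hx.symm), fun x hx => ?_⟩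
  rw [hf x hx, hf 0 ⟨le_rfl, hx.1.trans hx.2⟩, h.2 x hx]
  congr 1
  rw [intervalIntegral.integral_of_le hx.1, intervalIntegral.integral_of_le hx.1]
  refine integral_congr_ae ?_
  filter_upwards [ae_mono (Measure.restrict_mono (Set.Ioc_subset_Ioc_right hx.2) le_rfl) hg]
    with y hy using hy.symm

theorem IsPrimitiveOn.congr_Icc {L : ℝ} {f g f' g' : ℝ → ℝ} (h : IsPrimitiveOn L f g)
    (hf : ∀ x ∈ Set.Icc 0 L, f' x = f x) (hg : ∀ x ∈ Set.Icc 0 L, g' x = g x) :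
    IsPrimitiveOn L f' g' :=
  h.congr hf ((ae_restrict_iff' measurableSet_Ioc).2
    (ae_of_all _ fun x hx => hg x (Set.Ioc_subset_Icc_self hx)))

theorem eqOn_zero_of_integral_mul_self {L : ℝ} (hL : 0 < L) {f : ℝ → ℝ}
    (hf : ContinuousOn f (Set.Icc 0 L)) (h : ∫ x in (0 : ℝ)..L, f x * f x = 0) :
    ∀ x ∈ Set.Icc 0 L, f x = 0 := by
  rw [intervalIntegral.integral_of_le hL.le, integral_eq_zero_iff_of_nonneg
    (fun x => mul_self_nonneg _) (MemLp.integrable_mul hf.l2On hf.l2On)] at h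
  rw [restrict_Ioc_eq_restrict_Icc] at h
  have := Measure.eqOn_Icc_of_ae_eq volume hL.ne h (hf.mul hf) continuousOn_const
  intro x hx
  simpa using this hx

theorem integral_mul_self_le_of_abs_le {L δ : ℝ} (hL : 0 ≤ L) {f : ℝ → ℝ}
    (hf : ContinuousOn f (Set.Icc 0 L)) (h : ∀ x ∈ Set.Icc 0 L, |f x| ≤ δ) :
    ∫ x in (0 : ℝ)..L, f x * f x ≤ L * δ ^ 2 := by
  have h3 : ∫ x in (0 : ℝ)..L, f x * f x ≤ ∫ x in (0 : ℝ)..L, δ ^ 2 := by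
    refine intervalIntegral.integral_mono_on hL (hf.l2On.integrable_mul hf.l2On hL)
      (by simp) fun x hx => ?_
    rw [← sq, ← sq_abs]
    exact pow_le_pow_left₀ (abs_nonneg _) (h x hx) 2
  simpa using h3

theorem tendsto_integral_mul_self_zero {ι : Type*} {l : Filter ι} {len : ι → ℝ}
    (hlen : ∀ i, 0 < len i) {B : ℝ} (hB : ∀ᶠ i in l, len i ≤ B) {f : ι → ℝ → ℝ}
    (hf : ∀ i, ContinuousOn (f i) (Set.Icc 0 (len i)))
    (h : ∀ ε > 0, ∀ᶠ i in l, ∀ x ∈ Set.Icc 0 (len i), |f i x| < ε) :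
    Tendsto (fun i => ∫ x in (0 : ℝ)..len i, f i x * f i x) l (𝓝 0) := by
  rw [Metric.tendsto_nhds]
  intro ε hε
  have hB' : 0 < 2 * (|B| + 1) := by positivity
  filter_upwards [hB, h (√(ε / (2 * (|B| + 1)))) (by positivity)] with i hi hn
  rw [Real.dist_eq, sub_zero, abs_of_nonneg (integral_mul_self_nonneg (hlen i).le _)]
  refine (integral_mul_self_le_of_abs_le (hlen i).le (hf i) fun x hx => (hn x hx).le).trans_lt ?_
  rw [Real.sq_sqrt (by positivity), mul_div_assoc', div_lt_iff₀ hB']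
  nlinarith [le_abs_self B]

namespace MetricGraph

variable {V E : Type*} (Γ : MetricGraph V E)

/-- The function given on each edge by the restriction of a function of a real variable. -/
def ofLine (F : E → ℝ → ℝ) : Γ.Fun := fun e x => F e x

theorem onLine_eq (f : Γ.Fun) (e : E) {x : ℝ} (hx : x ∈ Set.Icc 0 (Γ.len e)) :
    Γ.onLine f e x = f e ⟨x, hx⟩ := Set.IccExtend_of_mem _ _ hx

theorem onLine_coe (f : Γ.Fun) (e : E) (x : Set.Icc 0 (Γ.len e)) :
    Γ.onLine f e x = f e x := Γ.onLine_eq f e x.2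

theorem onLine_ofLine (F : E → ℝ → ℝ) (e : E) {x : ℝ} (hx : x ∈ Set.Icc 0 (Γ.len e)) :
    Γ.onLine (Γ.ofLine F) e x = F e x := Γ.onLine_eq _ e hx

theorem integral_onLine_congr {F G : ℝ → ℝ} {e : E} (h : ∀ x ∈ Set.Icc 0 (Γ.len e), F x = G x) :
    ∫ x in (0 : ℝ)..Γ.len e, F x = ∫ x in (0 : ℝ)..Γ.len e, G x :=
  intervalIntegral.integral_congr fun x hx => h x (by rwa [Set.uIcc_of_le (Γ.len_pos e).le] at hx)

theorem hasL2Deriv_iff {f g : Γ.Fun} : Γ.HasL2Deriv f g ↔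
    ∀ e, IsPrimitiveOn (Γ.len e) (Γ.onLine f e) (Γ.onLine g e) := by
  refine forall_congr' fun e => and_congr_right fun _ => ⟨fun h x hx => ?_, fun h x => ?_⟩
  · rw [Γ.onLine_eq f e hx, h ⟨x, hx⟩, ← Γ.onLine_coe f e (Γ.left e)]
    rfl
  · have := h x x.2
    rw [Γ.onLine_coe] at this
    rw [this, ← Γ.onLine_coe f e (Γ.left e)]
    rfl

theorem hasL2Deriv_ofLine {F G : E → ℝ → ℝ} (h : ∀ e, IsPrimitiveOn (Γ.len e) (F e) (G e)) :
    Γ.HasL2Deriv (Γ.ofLine F) (Γ.ofLine G) :=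
  Γ.hasL2Deriv_iff.2 fun e => (h e).congr_Icc (fun _ hx => Γ.onLine_ofLine F e hx)
    fun _ hx => Γ.onLine_ofLine G e hx

theorem onLine_zero_eq (f : Γ.Fun) (e : E) : Γ.onLine f e 0 = Γ.endValue f (e, false) :=
  Γ.onLine_coe f e (Γ.left e)

theorem onLine_len_eq (f : Γ.Fun) (e : E) : Γ.onLine f e (Γ.len e) = Γ.endValue f (e, true) :=
  Γ.onLine_coe f e (Γ.right e)

variable {Γ} in
theorem HasL2Deriv.continuous {f g : Γ.Fun} (h : Γ.HasL2Deriv f g) (e : E) : Continuous (f e) := by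
  have := continuousOn_iff_continuous_domRestrict.1 (Γ.hasL2Deriv_iff.1 h e).continuousOn
  exact this.congr fun x => Γ.onLine_coe f e x

variable {Γ} in
theorem MemC.continuousOn {f : Γ.Fun} (h : Γ.MemC f) (e : E) :
    ContinuousOn (Γ.onLine f e) (Set.Icc 0 (Γ.len e)) :=
  ((h.1 e).Icc_extend' (h := (Γ.len_pos e).le)).continuousOn

variable {Γ} in
theorem MemC.vertexValue_endVertex {f : Γ.Fun} (h : Γ.MemC f) (p : E × Bool) :
    Γ.vertexValue f (Γ.endVertex p) = Γ.endValue f p := by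
  have hp : ∃ q : E × Bool, Γ.endVertex q = Γ.endVertex p := ⟨p, rfl⟩
  rw [vertexValue, dif_pos hp]
  exact h.2 _ _ hp.choose_spec

theorem vertexValue_add (f g : Γ.Fun) (v : V) :
    Γ.vertexValue (f + g) v = Γ.vertexValue f v + Γ.vertexValue g v := by
  unfold vertexValue
  split_ifs
  · exact Γ.endValue_add _ _ _
  · simp

theorem vertexValue_smul (c : ℝ) (f : Γ.Fun) (v : V) :
    Γ.vertexValue (c • f) v = c * Γ.vertexValue f v := by
  unfold vertexValue
  split_ifs
  · exact Γ.endValue_smul _ _ _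
  · simp

/-- The edgewise square-integrable functions. -/
def l2Space : Submodule ℝ Γ.Fun where
  carrier := {f | ∀ e, L2On (Γ.len e) (Γ.onLine f e)}
  zero_mem' _ := MemLp.zero
  add_mem' ha hb e := (ha e).add (hb e)
  smul_mem' c _ ha e := (ha e).const_smul c

/-- The pairs `(f, f')` with `f ∈ H¹(Γ)`. -/
def energySpace : Submodule ℝ (Γ.Fun × Γ.Fun) where
  carrier := {u | Γ.MemC u.1 ∧ Γ.HasL2Deriv u.1 u.2}
  zero_mem' := ⟨⟨fun _ => continuous_const, fun p q _ => by simp [endValue]⟩, Γ.hasL2Deriv_zero⟩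
  add_mem' ha hb := ⟨ha.1.add hb.1, ha.2.add hb.2⟩
  smul_mem' c _ ha := ⟨ha.1.smul c, ha.2.smul c⟩

theorem isPrimitiveOn_of_mem (u : Γ.energySpace) (e : E) :
    IsPrimitiveOn (Γ.len e) (Γ.onLine u.1.1 e) (Γ.onLine u.1.2 e) := Γ.hasL2Deriv_iff.1 u.2.2 e

variable [Fintype E]

/-- The Hilbert space `L²(Γ)`. -/
abbrev Hilb : Type _ := PiLp 2 fun e : E => Lp ℝ 2 (volume.restrict (Set.Ioc 0 (Γ.len e)))

/-- The class in `L²(Γ)` of a square-integrable function. -/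
def toHilb : Γ.l2Space →ₗ[ℝ] Γ.Hilb where
  toFun f := WithLp.toLp 2 fun e => (f.2 e).toLp (Γ.onLine f.1 e)
  map_add' _ _ := rfl
  map_smul' _ _ := rfl

theorem inner_toHilb (f g : Γ.l2Space) : inner ℝ (Γ.toHilb f) (Γ.toHilb g) =
    ∑ e, ∫ x in (0 : ℝ)..Γ.len e, Γ.onLine f.1 e x * Γ.onLine g.1 e x := by
  rw [PiLp.inner_apply]
  refine Finset.sum_congr rfl fun e _ => ?_
  rw [intervalIntegral.integral_of_le (Γ.len_pos e).le]
  exact L2_inner_toLp (f.2 e) (g.2 e)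

/-- `(f, f') ↦ f` as a map into `L²(Γ)`. -/
def valMap : Γ.energySpace →ₗ[ℝ] Γ.Hilb :=
  Γ.toHilb ∘ₗ ((LinearMap.fst ℝ Γ.Fun Γ.Fun ∘ₗ Γ.energySpace.subtype).codRestrict Γ.l2Space
    fun u e => (Γ.isPrimitiveOn_of_mem u e).continuousOn.l2On)

/-- `(f, f') ↦ f'` as a map into `L²(Γ)`. -/
def derivMap : Γ.energySpace →ₗ[ℝ] Γ.Hilb :=
  Γ.toHilb ∘ₗ ((LinearMap.snd ℝ Γ.Fun Γ.Fun ∘ₗ Γ.energySpace.subtype).codRestrict Γ.l2Space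
    fun u e => (Γ.isPrimitiveOn_of_mem u e).1)

theorem inner_valMap (u v : Γ.energySpace) : inner ℝ (Γ.valMap u) (Γ.valMap v) =
    ∑ e, ∫ x in (0 : ℝ)..Γ.len e, Γ.onLine u.1.1 e x * Γ.onLine v.1.1 e x := Γ.inner_toHilb _ _

theorem inner_derivMap (u v : Γ.energySpace) : inner ℝ (Γ.derivMap u) (Γ.derivMap v) =
    ∑ e, ∫ x in (0 : ℝ)..Γ.len e, Γ.onLine u.1.2 e x * Γ.onLine v.1.2 e x := Γ.inner_toHilb _ _

theorem norm_sq_valMap (u : Γ.energySpace) : ‖Γ.valMap u‖ ^ 2 =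
    ∑ e, ∫ x in (0 : ℝ)..Γ.len e, Γ.onLine u.1.1 e x * Γ.onLine u.1.1 e x := by
  rw [← real_inner_self_eq_norm_sq, inner_valMap]

theorem norm_sq_derivMap (u : Γ.energySpace) : ‖Γ.derivMap u‖ ^ 2 =
    ∑ e, ∫ x in (0 : ℝ)..Γ.len e, Γ.onLine u.1.2 e x * Γ.onLine u.1.2 e x := by
  rw [← real_inner_self_eq_norm_sq, inner_derivMap]

theorem integral_val_le (u : Γ.energySpace) (e : E) :
    ∫ x in (0 : ℝ)..Γ.len e, Γ.onLine u.1.1 e x * Γ.onLine u.1.1 e x ≤ ‖Γ.valMap u‖ ^ 2 := by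
  rw [norm_sq_valMap]
  exact Finset.single_le_sum (f := fun e => ∫ x in (0 : ℝ)..Γ.len e, Γ.onLine u.1.1 e x *
    Γ.onLine u.1.1 e x) (fun e _ => integral_mul_self_nonneg (Γ.len_pos e).le _) (Finset.mem_univ e)

theorem integral_deriv_le (u : Γ.energySpace) (e : E) :
    ∫ x in (0 : ℝ)..Γ.len e, Γ.onLine u.1.2 e x * Γ.onLine u.1.2 e x ≤ ‖Γ.derivMap u‖ ^ 2 := by
  rw [norm_sq_derivMap]
  exact Finset.single_le_sum (f := fun e => ∫ x in (0 : ℝ)..Γ.len e, Γ.onLine u.1.2 e x *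
    Γ.onLine u.1.2 e x) (fun e _ => integral_mul_self_nonneg (Γ.len_pos e).le _) (Finset.mem_univ e)

/-- A continuous function vanishing almost everywhere vanishes. The conclusion is not `u = 0`, since
the second component is determined only up to null sets. -/
theorem valMap_eq_zero_iff (u : Γ.energySpace) : Γ.valMap u = 0 ↔ u.1.1 = 0 := by
  constructor
  · intro h
    have h1 := Γ.norm_sq_valMap u
    rw [h, norm_zero, zero_pow two_ne_zero, eq_comm, Finset.sum_eq_zero_iff_of_nonneg
      fun e _ => integral_mul_self_nonneg (Γ.len_pos e).le _] at h1
    funext e x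
    rw [← Γ.onLine_coe u.1.1 e x]
    exact eqOn_zero_of_integral_mul_self (Γ.len_pos e) (u.2.1.continuousOn e)
      (h1 e (Finset.mem_univ e)) x x.2
  · intro h
    have h1 := Γ.norm_sq_valMap u
    have : ∀ e x, Γ.onLine 0 e x = 0 := fun _ _ => rfl
    simpa [h, this] using h1

/-- Edgewise compactness with fixed lengths, the end values being bounded by
`IsPrimitiveOn.sq_left_le`. Uniform convergence preserves continuity at the vertices and implies
convergence in L². -/
theorem energyCompact : EnergyCompact Γ.valMap Γ.derivMap := by
  intro 𝒰 u C hA hB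
  have hA2 : ∀ n, ‖Γ.valMap (u n)‖ ^ 2 ≤ C ^ 2 := fun n => pow_le_pow_left₀ (norm_nonneg _) (hA n) 2
  have hB2 : ∀ n, ‖Γ.derivMap (u n)‖ ^ 2 ≤ C ^ 2 :=
    fun n => pow_le_pow_left₀ (norm_nonneg _) (hB n) 2
  have hedge : ∀ e, ∃ F G, IsPrimitiveOn (Γ.len e) F G ∧
      (∀ ε > 0, ∀ᶠ n in 𝒰, ∀ x ∈ Set.Icc 0 (Γ.len e), |Γ.onLine (u n).1.1 e x - F x| < ε) ∧
      ∀ p, L2On (Γ.len e) p → Tendsto (fun n => ∫ x in (0 : ℝ)..Γ.len e, Γ.onLine (u n).1.2 e x * p x)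
        𝒰 (𝓝 (∫ x in (0 : ℝ)..Γ.len e, G x * p x)) := by
    intro e
    have hL := Γ.len_pos e
    obtain ⟨F, G, h1, h2, h3⟩ := exists_isPrimitiveOn_limit 𝒰 hL (fun _ => hL) tendsto_const_nhds
      (fun n => Γ.isPrimitiveOn_of_mem (u n) e)
      (B := √((2 * C ^ 2 + 2 * Γ.len e ^ 2 * C ^ 2) / Γ.len e)) (C := C ^ 2)
      (Eventually.of_forall fun n => Real.abs_le_sqrt (by
        rw [le_div_iff₀ hL, mul_comm]
        refine ((Γ.isPrimitiveOn_of_mem (u n) e).sq_left_le hL).trans ?_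
        gcongr
        · exact (Γ.integral_val_le _ e).trans (hA2 n)
        · exact (Γ.integral_deriv_le _ e).trans (hB2 n)))
      (Eventually.of_forall fun n => (Γ.integral_deriv_le _ e).trans (hB2 n))
    simp only [div_self hL.ne', one_mul] at h2 h3
    exact ⟨F, G, h1, h2, h3⟩
  choose F G hFG hu hw using hedge
  have hpt : ∀ p : E × Bool, Tendsto (fun n => Γ.endValue (u n).1.1 p) 𝒰
      (𝓝 (Γ.endValue (Γ.ofLine F) p)) := by
    intro p
    rw [Metric.tendsto_nhds]
    intro ε hε
    filter_upwards [hu p.1 ε hε] with n hn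
    rw [Real.dist_eq]
    unfold endValue
    split_ifs
    · have := hn _ (Γ.right p.1).2
      rwa [Γ.onLine_coe] at this
    · have := hn _ (Γ.left p.1).2
      rwa [Γ.onLine_coe] at this
  have hd := Γ.hasL2Deriv_ofLine hFG
  let v : Γ.energySpace := ⟨(Γ.ofLine F, Γ.ofLine G), ⟨hd.continuous, fun p q hpq =>
    tendsto_nhds_unique (hpt p) ((hpt q).congr fun n => ((u n).2.1.2 p q hpq).symm)⟩, hd⟩
  refine ⟨v, ?_, fun w => ?_⟩
  · rw [tendsto_iff_norm_sub_tendsto_zero]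
    have h2 : Tendsto (fun n => ‖Γ.valMap (u n) - Γ.valMap v‖ ^ 2) 𝒰 (𝓝 0) := by
      simp only [← map_sub, norm_sq_valMap]
      have key : ∀ e ∈ Finset.univ, Tendsto (fun n => ∫ x in (0 : ℝ)..Γ.len e,
          Γ.onLine (u n - v).1.1 e x * Γ.onLine (u n - v).1.1 e x) 𝒰 (𝓝 0) := by
        intro e _
        refine tendsto_integral_mul_self_zero (fun _ => Γ.len_pos e) (B := Γ.len e)
          (Eventually.of_forall fun _ => le_rfl)
          (fun n => (u n - v).2.1.continuousOn e) fun ε hε => ?_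
        filter_upwards [hu e ε hε] with n hn x hx
        have h4 : Γ.onLine (u n - v).1.1 e x = Γ.onLine (u n).1.1 e x - F e x := by
          rw [← Γ.onLine_ofLine F e hx]
          rfl
        rw [h4]
        exact hn x hx
      have := tendsto_finsetSum _ key
      rwa [Finset.sum_const_zero] at this
    have := h2.sqrt
    simpa using this
  · simp only [inner_derivMap]
    refine tendsto_finsetSum _ fun e _ => ?_
    have h1 := hw e _ (Γ.isPrimitiveOn_of_mem w e).1
    rwa [Γ.integral_onLine_congr (G := fun x => Γ.onLine v.1.2 e x * Γ.onLine w.1.2 e x)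
      fun x hx => by rw [← Γ.onLine_ofLine G e hx]] at h1

end MetricGraph
end

/-! ### Weak eigenfunctions are exactly the eigenfunctions of the standard Laplacian. -/

noncomputable section

theorem isPrimitiveOn_integral {L : ℝ} {g : ℝ → ℝ} (hg : L2On L g) (c : ℝ) :
    IsPrimitiveOn L (fun x => c + ∫ t in (0 : ℝ)..x, g t) g := ⟨hg, fun x _ => by simp⟩

namespace MetricGraph

variable {V E : Type*} (Γ : MetricGraph V E)

open Classical in
/-- The function equal to `F` on the edge `e` and to zero on all other edges. -/
def edgeFun (e : E) (F : ℝ → ℝ) : Γ.Fun := Γ.ofLine fun e' => if e' = e then F else 0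

theorem onLine_edgeFun_self (e : E) (F : ℝ → ℝ) {x : ℝ} (hx : x ∈ Set.Icc 0 (Γ.len e)) :
    Γ.onLine (Γ.edgeFun e F) e x = F x := by
  rw [edgeFun, Γ.onLine_ofLine _ _ hx, if_pos rfl]

theorem onLine_edgeFun_of_ne {e e' : E} (h : e' ≠ e) (F : ℝ → ℝ) (x : ℝ) :
    Γ.onLine (Γ.edgeFun e F) e' x = 0 := by
  simp [edgeFun, ofLine, onLine, Set.IccExtend, if_neg h]

/-- A function in `H¹₀(0, len e)`, extended by zero. -/
def edgeTest (e : E) {F G : ℝ → ℝ} (h : IsPrimitiveOn (Γ.len e) F G) (h0 : F 0 = 0)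
    (h1 : F (Γ.len e) = 0) : Γ.energySpace :=
  ⟨(Γ.edgeFun e F, Γ.edgeFun e G), by
    have hd : Γ.HasL2Deriv (Γ.edgeFun e F) (Γ.edgeFun e G) := by
      refine Γ.hasL2Deriv_ofLine fun e' => ?_
      split_ifs with he
      · exact he ▸ h
      · exact ⟨MemLp.zero, by simp⟩
    have hz : ∀ p, Γ.endValue (Γ.edgeFun e F) p = 0 := by
      rintro ⟨e', b⟩
      by_cases he : e' = e
      · subst he
        cases b
        · rw [← Γ.onLine_zero_eq, Γ.onLine_edgeFun_self _ _ ⟨le_rfl, (Γ.len_pos _).le⟩, h0]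
        · rw [← Γ.onLine_len_eq, Γ.onLine_edgeFun_self _ _ ⟨(Γ.len_pos _).le, le_rfl⟩, h1]
      · cases b
        · rw [← Γ.onLine_zero_eq, Γ.onLine_edgeFun_of_ne he]
        · rw [← Γ.onLine_len_eq, Γ.onLine_edgeFun_of_ne he]
    exact ⟨⟨hd.continuous, fun p q _ => by rw [hz, hz]⟩, hd⟩⟩

variable [Fintype E]

theorem sum_integral_edgeFun (f : Γ.Fun) (e : E) (F : ℝ → ℝ) :
    ∑ e', ∫ x in (0 : ℝ)..Γ.len e', Γ.onLine f e' x * Γ.onLine (Γ.edgeFun e F) e' x =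
      ∫ x in (0 : ℝ)..Γ.len e, Γ.onLine f e x * F x := by
  rw [Finset.sum_eq_single e]
  · exact Γ.integral_onLine_congr fun x hx => by rw [Γ.onLine_edgeFun_self e F hx]
  · intro e' _ he
    simp [Γ.onLine_edgeFun_of_ne he]
  · exact fun h => absurd (Finset.mem_univ e) h

/-- Regularity of weak eigenfunctions inside an edge. -/
theorem exists_deriv_of_mem_weakEigenspace {ν : ℝ} {u : Γ.energySpace}
    (hu : u ∈ weakEigenspace Γ.valMap Γ.derivMap ν) (e : E) :
    ∃ G, IsPrimitiveOn (Γ.len e) (Γ.onLine u.1.1 e) G ∧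
      IsPrimitiveOn (Γ.len e) G (fun x => -ν * Γ.onLine u.1.1 e x) ∧
      ∀ᵐ x ∂(volume.restrict (Set.Ioc 0 (Γ.len e))), G x = Γ.onLine u.1.2 e x := by
  have hL := Γ.len_pos e
  have hpr := Γ.isPrimitiveOn_of_mem u e
  set f := Γ.onLine u.1.1 e
  set g := Γ.onLine u.1.2 e
  have hf : L2On (Γ.len e) f := hpr.continuousOn.l2On
  have hI := isPrimitiveOn_integral hf 0
  simp only [zero_add] at hI
  set I : ℝ → ℝ := fun x => ∫ t in (0 : ℝ)..x, f t
  have hI2 : L2On (Γ.len e) I := hI.continuousOn.l2On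
  -- Test with the primitive of a mean-zero `p`, which lies in H¹₀ of the edge. Integration by parts
  -- shows that `g + ν I` is orthogonal to every such `p`, hence constant; `c - ν I` is then the
  -- continuous representative of the derivative.
  obtain ⟨c, hc⟩ := L2On.exists_ae_eq_const hL (hpr.1.add (hI2.const_mul ν)) (by
    intro p hp hp0
    have hP := isPrimitiveOn_integral hp 0
    simp only [zero_add] at hP
    have hw := hu (Γ.edgeTest e hP (by simp) hp0)
    rw [inner_valMap, inner_derivMap] at hw
    simp only [edgeTest, sum_integral_edgeFun] at hw
    have hparts := hI.integral_mul_eq hL.le hP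
    simp only [hp0, mul_zero, I, intervalIntegral.integral_same, sub_zero, zero_sub] at hparts
    simp only [Pi.add_apply, add_mul, mul_assoc]
    rw [intervalIntegral.integral_add (hpr.1.integrable_mul hp hL.le)
      ((hI2.integrable_mul hp hL.le).const_mul ν), intervalIntegral.integral_const_mul, hparts]
    rw [hw]
    ring)
  refine ⟨fun x => c + -ν * I x, ?_, ?_, ?_⟩
  · refine hpr.congr (fun _ _ => rfl) ?_
    filter_upwards [hc] with x hx
    rw [← hx]
    simp
  · refine ⟨hf.const_mul (-ν), fun x _ => ?_⟩
    simp [I]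
  · filter_upwards [hc] with x hx
    rw [← hx]
    simp [g]

open Classical in
/-- The edgewise linear function equal to `1` at the vertex `v` and to `0` at all other vertices. -/
def hatTest (v : V) : Γ.energySpace :=
  ⟨(Γ.ofLine fun e x => (if Γ.orig e = v then 1 else 0) +
      ((if Γ.term e = v then 1 else 0) - (if Γ.orig e = v then 1 else 0)) / Γ.len e * x,
    Γ.ofLine fun e _ => ((if Γ.term e = v then 1 else 0) -
      (if Γ.orig e = v then 1 else 0)) / Γ.len e), by
    set F : Γ.Fun := Γ.ofLine fun e x => (if Γ.orig e = v then 1 else 0) +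
      ((if Γ.term e = v then 1 else 0) - (if Γ.orig e = v then 1 else 0)) / Γ.len e * x
    have hd := Γ.hasL2Deriv_ofLine (F := fun e x => (if Γ.orig e = v then 1 else 0) +
      ((if Γ.term e = v then 1 else 0) - (if Γ.orig e = v then 1 else 0)) / Γ.len e * x)
      (G := fun e _ => ((if Γ.term e = v then 1 else 0) -
      (if Γ.orig e = v then 1 else 0)) / Γ.len e) fun e => ⟨L2On.const _ _, fun x _ => by
        simp only [mul_zero, add_zero, intervalIntegral.integral_const, sub_zero, smul_eq_mul]
        ring⟩
    have hv : ∀ p, Γ.endValue F p = if Γ.endVertex p = v then 1 else 0 := by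
      rintro ⟨e, b⟩
      have hL := (Γ.len_pos e).ne'
      cases b
      · simp [endValue, endVertex, F, ofLine, left]
      · simp [endValue, endVertex, F, ofLine, right, div_mul_cancel₀ _ hL]
    exact ⟨⟨hd.continuous, fun p q hpq => by rw [hv, hv, hpq]⟩, hd⟩⟩

/-- With regularity inside the edges known, testing with the hat function of a vertex and
integrating by parts leaves exactly the Kirchhoff sum there. -/
theorem mem_eigenspace_of_mem_weakEigenspace {ν : ℝ} {u : Γ.energySpace}
    (hu : u ∈ weakEigenspace Γ.valMap Γ.derivMap ν) : u.1.1 ∈ Γ.eigenspace ν := by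
  classical
  choose G hG1 hG2 hGae using Γ.exists_deriv_of_mem_weakEigenspace hu
  have hfG : Γ.HasL2Deriv u.1.1 (Γ.ofLine G) := Γ.hasL2Deriv_iff.2 fun e =>
    (hG1 e).congr_Icc (fun _ _ => rfl) fun x hx => Γ.onLine_ofLine G e hx
  have hGh : Γ.HasL2Deriv (Γ.ofLine G) (-ν • u.1.1) := Γ.hasL2Deriv_iff.2 fun e =>
    (hG2 e).congr_Icc (fun x hx => Γ.onLine_ofLine G e hx) fun _ _ => rfl
  refine ⟨u.2.1, Γ.ofLine G, -ν • u.1.1, hfG, hGh, fun v => ?_, fun e => ae_of_all _ fun x => ?_⟩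
  · have hw := hu (Γ.hatTest v)
    rw [inner_valMap, inner_derivMap, Finset.mul_sum, ← sub_eq_zero, ← Finset.sum_sub_distrib] at hw
    rw [normalDeriv, Finset.sum_filter, Finset.sum_filter, ← Finset.sum_sub_distrib]
    refine Eq.trans (Finset.sum_congr rfl fun e _ => ?_) hw
    have hL := (Γ.len_pos e)
    have hparts := (hG2 e).integral_mul_eq hL.le (Γ.isPrimitiveOn_of_mem (Γ.hatTest v) e)
    have e1 : ∫ x in (0 : ℝ)..Γ.len e, Γ.onLine u.1.2 e x * Γ.onLine (Γ.hatTest v).1.2 e x =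
        ∫ x in (0 : ℝ)..Γ.len e, G e x * Γ.onLine (Γ.hatTest v).1.2 e x := by
      rw [intervalIntegral.integral_of_le hL.le, intervalIntegral.integral_of_le hL.le]
      refine integral_congr_ae ?_
      filter_upwards [hGae e] with x hx
      rw [hx]
    have e2 : Γ.onLine (Γ.hatTest v).1.1 e 0 = if Γ.orig e = v then 1 else 0 := by
      rw [hatTest, Γ.onLine_ofLine _ _ ⟨le_rfl, hL.le⟩]
      simp
    have e3 : Γ.onLine (Γ.hatTest v).1.1 e (Γ.len e) = if Γ.term e = v then 1 else 0 := by
      rw [hatTest, Γ.onLine_ofLine _ _ ⟨hL.le, le_rfl⟩]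
      simp [div_mul_cancel₀ _ hL.ne']
    simp only [mul_assoc, intervalIntegral.integral_const_mul] at hparts
    rw [e1, hparts, e2, e3]
    have e4 : Γ.ofLine G e (Γ.right e) = G e (Γ.len e) := rfl
    have e5 : Γ.ofLine G e (Γ.left e) = G e 0 := rfl
    rw [e4, e5]
    split_ifs <;> ring
  · rw [onLine_smul, onLine_smul]
    ring

/-- Integration by parts on every edge leaves boundary terms. Grouped by vertex, the value of the
test function factors out and the Kirchhoff condition annihilates the rest. -/
theorem exists_mem_weakEigenspace_of_mem_eigenspace [Finite V] {ν : ℝ} {f : Γ.Fun}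
    (hf : f ∈ Γ.eigenspace ν) :
    ∃ u ∈ weakEigenspace Γ.valMap Γ.derivMap ν, u.1.1 = f := by
  classical
  have := Fintype.ofFinite V
  obtain ⟨hC, g, h, hfg, hgh, hK, hae⟩ := hf
  refine ⟨⟨(f, g), hC, hfg⟩, fun v => ?_, rfl⟩
  rw [inner_valMap, inner_derivMap, Finset.mul_sum, ← sub_eq_zero, ← Finset.sum_sub_distrib]
  have hedge : ∀ e, (∫ x in (0 : ℝ)..Γ.len e, Γ.onLine g e x * Γ.onLine v.1.2 e x) -
      ν * (∫ x in (0 : ℝ)..Γ.len e, Γ.onLine f e x * Γ.onLine v.1.1 e x) =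
      g e (Γ.right e) * Γ.vertexValue v.1.1 (Γ.term e) -
        g e (Γ.left e) * Γ.vertexValue v.1.1 (Γ.orig e) := by
    intro e
    have hL := Γ.len_pos e
    rw [(Γ.hasL2Deriv_iff.1 hgh e).integral_mul_eq hL.le (Γ.isPrimitiveOn_of_mem v e)]
    have e1 : ∫ x in (0 : ℝ)..Γ.len e, Γ.onLine h e x * Γ.onLine v.1.1 e x =
        ∫ x in (0 : ℝ)..Γ.len e, -ν * (Γ.onLine f e x * Γ.onLine v.1.1 e x) := by
      rw [intervalIntegral.integral_of_le hL.le, intervalIntegral.integral_of_le hL.le]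
      refine integral_congr_ae ?_
      filter_upwards [hae e] with x hx
      rw [onLine_smul] at hx
      rw [← mul_assoc, neg_mul, hx, neg_neg]
    rw [e1, intervalIntegral.integral_const_mul]
    have e2 : Γ.vertexValue v.1.1 (Γ.term e) = Γ.onLine v.1.1 e (Γ.len e) := by
      rw [onLine_len_eq, ← v.2.1.vertexValue_endVertex]
      rfl
    have e3 : Γ.vertexValue v.1.1 (Γ.orig e) = Γ.onLine v.1.1 e 0 := by
      rw [onLine_zero_eq, ← v.2.1.vertexValue_endVertex]
      rfl
    have e4 : g e (Γ.right e) = Γ.onLine g e (Γ.len e) := (Γ.onLine_coe g e (Γ.right e)).symm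
    have e5 : g e (Γ.left e) = Γ.onLine g e 0 := (Γ.onLine_coe g e (Γ.left e)).symm
    rw [e2, e3, e4, e5]
    ring
  simp only [hedge]
  rw [Finset.sum_sub_distrib, ← Finset.sum_fiberwise Finset.univ Γ.term,
    ← Finset.sum_fiberwise Finset.univ Γ.orig (fun e => g e (Γ.left e) * _),
    ← Finset.sum_sub_distrib]
  refine Finset.sum_eq_zero fun a _ => ?_
  have h1 := hK a
  rw [normalDeriv] at h1
  have h2 : ∑ e with Γ.term e = a, g e (Γ.right e) * Γ.vertexValue v.1.1 (Γ.term e) =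
      (∑ e with Γ.term e = a, g e (Γ.right e)) * Γ.vertexValue v.1.1 a := by
    rw [Finset.sum_mul]
    exact Finset.sum_congr rfl fun e he => by rw [(Finset.mem_filter.1 he).2]
  have h3 : ∑ e with Γ.orig e = a, g e (Γ.left e) * Γ.vertexValue v.1.1 (Γ.orig e) =
      (∑ e with Γ.orig e = a, g e (Γ.left e)) * Γ.vertexValue v.1.1 a := by
    rw [Finset.sum_mul]
    exact Finset.sum_congr rfl fun e he => by rw [(Finset.mem_filter.1 he).2]
  rw [h2, h3, ← sub_mul]
  convert zero_mul _

/-- `(f, f') ↦ f`. -/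
def fstMap : Γ.energySpace →ₗ[ℝ] Γ.Fun := LinearMap.fst ℝ Γ.Fun Γ.Fun ∘ₗ Γ.energySpace.subtype

theorem eigenspace_eq_map [Finite V] (ν : ℝ) :
    Γ.eigenspace ν = (weakEigenspace Γ.valMap Γ.derivMap ν).map Γ.fstMap := by
  ext f
  constructor
  · intro hf
    obtain ⟨u, hu, rfl⟩ := Γ.exists_mem_weakEigenspace_of_mem_eigenspace hf
    exact ⟨u, hu, rfl⟩
  · rintro ⟨u, hu, rfl⟩
    exact Γ.mem_eigenspace_of_mem_weakEigenspace hu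

theorem ker_fstMap : Γ.fstMap.ker = Γ.valMap.ker := by
  ext u
  rw [LinearMap.mem_ker, LinearMap.mem_ker, valMap_eq_zero_iff]
  rfl

/-- Both infima are over the same set: the span of the eigenspaces up to Λ has the same dimension as
a space of functions and as a subspace of L². -/
theorem eigenvalue_eq [Finite V] (k : ℕ) :
    Γ.eigenvalue k = formEigenvalue Γ.valMap Γ.derivMap k := by
  unfold eigenvalue formEigenvalue
  congr 1
  ext Λ
  rw [Set.mem_ofPred_eq, Set.mem_ofPred_eq, ← le_rank_iSup_map_weakEigenspace_iff]
  have h1 : (⨆ ν ∈ Set.Iic Λ, Γ.eigenspace ν) =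
      (⨆ ν ∈ Set.Iic Λ, weakEigenspace Γ.valMap Γ.derivMap ν).map Γ.fstMap := by
    simp only [eigenspace_eq_map, ← Submodule.map_iSup]
  have h2 : (⨆ ν ∈ Set.Iic Λ, (weakEigenspace Γ.valMap Γ.derivMap ν).map Γ.valMap) =
      (⨆ ν ∈ Set.Iic Λ, weakEigenspace Γ.valMap Γ.derivMap ν).map Γ.valMap := by
    simp only [← Submodule.map_iSup]
  rw [h1, h2]
  obtain ⟨i⟩ := rank_range_eq_of_ker_eq _ _ Γ.ker_fstMap
    (⨆ ν ∈ Set.Iic Λ, weakEigenspace Γ.valMap Γ.derivMap ν)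
  rw [i.rank_eq]

theorem finrank_eigenspace [Finite V] (ν : ℝ) : Module.finrank ℝ (Γ.eigenspace ν) =
    Module.finrank ℝ ((weakEigenspace Γ.valMap Γ.derivMap ν).map Γ.valMap) := by
  rw [eigenspace_eq_map]
  obtain ⟨i⟩ := rank_range_eq_of_ker_eq _ _ Γ.ker_fstMap
    (weakEigenspace Γ.valMap Γ.derivMap ν)
  exact i.finrank_eq

theorem IsNormalizedEigenfunction.exists_weak [Finite V] {k : ℕ} {ψ : Γ.Fun}
    (h : Γ.IsNormalizedEigenfunction k ψ) :
    ∃ u ∈ weakEigenspace Γ.valMap Γ.derivMap (Γ.eigenvalue k), ‖Γ.valMap u‖ = 1 ∧ u.1.1 = ψ := by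
  obtain ⟨u, hu, rfl⟩ := Γ.exists_mem_weakEigenspace_of_mem_eigenspace h.1
  refine ⟨u, hu, ?_, rfl⟩
  have h1 : ‖Γ.valMap u‖ ^ 2 = 1 := by
    rw [norm_sq_valMap]
    simpa only [sq] using h.2
  exact (pow_eq_one_iff_of_nonneg (norm_nonneg _) two_ne_zero).1 h1

-- The infimum defining the k-th eigenvalue is over a nonempty set. The functions x (L − x) xⁱ on a
-- single edge, extended by zero, are k independent elements of H¹(Γ) for any k.
open Polynomial in
theorem exists_hasEigenfamily [Nonempty E] (k : ℕ) :
    ∃ Λ, HasEigenfamily Γ.valMap Γ.derivMap Λ k := by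
  obtain ⟨e⟩ := ‹Nonempty E›
  have hL := Γ.len_pos e
  let q : ℕ → ℝ[X] := fun i => X * (C (Γ.len e) - X) * X ^ i
  have hq : ∀ i, IsPrimitiveOn (Γ.len e) (fun x => (q i).eval x)
      (fun x => (derivative (q i)).eval x) := fun i =>
    ⟨(derivative (q i)).continuous.continuousOn.l2On, fun x _ => by
      rw [intervalIntegral.integral_eq_sub_of_hasDerivAt (fun y _ => (q i).hasDerivAt y)
        ((derivative (q i)).continuous.intervalIntegrable _ _)]
      ring⟩
  refine Γ.energyCompact.exists_hasEigenfamily (w := fun i : Fin k =>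
    Γ.edgeTest e (hq i) (by simp [q]) (by simp [q])) (Fintype.linearIndependent_iff.2 fun c hc => ?_)
  simp only [← map_smul, ← map_sum] at hc
  rw [valMap_eq_zero_iff] at hc
  have hzero : ∑ i : Fin k, Polynomial.C (c i) * X ^ (i : ℕ) = 0 := by
    refine Polynomial.eq_zero_of_infinite_isRoot _ ((Set.Ioo_infinite hL).mono fun x hx => ?_)
    have hx' := Set.Ioo_subset_Icc_self hx
    have h1 := congrArg (fun f : Γ.Fun => f e ⟨x, hx'⟩) hc
    simp only [AddSubmonoidClass.coe_finsetSum, Prod.fst_sum, Finset.sum_apply] at h1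
    have h2 : ∀ i : Fin k, (c i • Γ.edgeTest e (hq i) (by simp [q]) (by simp [q])).1.1 e ⟨x, hx'⟩ =
        c i * (x * (Γ.len e - x) * x ^ (i : ℕ)) := fun i => by
      have := Γ.onLine_edgeFun_self e (fun x => (q i).eval x) hx'
      rw [Γ.onLine_eq _ e hx'] at this
      change c i * Γ.edgeFun e (fun x => (q i).eval x) e ⟨x, hx'⟩ = _
      rw [this]
      simp only [eval_mul, eval_X, eval_sub, eval_C, eval_pow, q]
    simp only [h2] at h1
    have h3 : ∑ i : Fin k, c i * (x * (Γ.len e - x) * x ^ (i : ℕ)) =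
        x * (Γ.len e - x) * ∑ i : Fin k, c i * x ^ (i : ℕ) := by
      rw [Finset.mul_sum]
      exact Finset.sum_congr rfl fun i _ => by ring
    rw [h3] at h1
    have h4 := (mul_eq_zero.1 h1).resolve_left
      (mul_pos hx.1 (sub_pos.2 hx.2)).ne'
    simpa [Polynomial.eval_finsetSum] using h4
  intro i
  have := congrArg (fun p => p.coeff (i : ℕ)) hzero
  simpa [Polynomial.coeff_X_pow, Fin.val_inj, Polynomial.finsetSum_coeff, Finset.sum_ite_eq] using this

end MetricGraph
end

/-! ### Transplantation from the limit graph and the upper bound for eigenvalues. -/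

noncomputable section

namespace DiscreteGraph

variable {V E : Type*} (G : DiscreteGraph V E)

theorem withLengths_len (ℓ : {ℓ : E → ℝ // ∀ e, 0 < ℓ e}) (e : E) :
    (G.withLengths ℓ).len e = ℓ.1 e := rfl

variable {G} in
theorem Connected.forall_of_step (hG : G.Connected) {P : V → Prop}
    (hstep : ∀ e, P (G.orig e) ↔ P (G.term e)) {a : V} (ha : P a) (v : V) : P v := by
  have key : ∀ x y, Relation.EqvGen (fun a b => ∃ e, G.orig e = a ∧ G.term e = b) x y →
      (P x ↔ P y) := by
    intro x y h
    induction h with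
    | rel x y h =>
      obtain ⟨e, rfl, rfl⟩ := h
      exact hstep e
    | refl x => exact Iff.rfl
    | symm x y _ ih => exact ih.symm
    | trans x y z _ _ ih1 ih2 => exact ih1.trans ih2
  exact (key a v (hG.2 a v)).1 ha

variable {l : E → ℝ}

theorem mk_orig_eq_mk_term {e : E} (he : l e = 0) :
    (Quot.mk _ (G.orig e) : G.LimitVertex l) = Quot.mk _ (G.term e) :=
  Quot.sound ⟨e, he, rfl, rfl⟩

variable {G} in
/-- Every vertex of the limit graph is incident to an edge, if there is an edge at all. -/
theorem Connected.exists_endVertex_eq (hG : G.Connected) (hl : ∀ e, 0 ≤ l e) (hpos : ∃ e, 0 < l e)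
    (v : V) : ∃ p, (G.limitGraph l).endVertex p = Quot.mk _ v := by
  obtain ⟨e₀, he₀⟩ := hpos
  refine hG.forall_of_step (P := fun v => ∃ p, (G.limitGraph l).endVertex p = Quot.mk _ v)
    (fun e => ?_) (a := G.orig e₀) ⟨(⟨e₀, he₀⟩, false), rfl⟩ v
  rcases (hl e).eq_or_lt with he | he
  · rw [G.mk_orig_eq_mk_term he.symm]
  · exact iff_of_true ⟨(⟨e, he⟩, false), rfl⟩ ⟨(⟨e, he⟩, true), rfl⟩

instance [Finite V] : Finite (G.LimitVertex l) := inferInstanceAs (Finite (Quot _))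

theorem div_mul_mem_Icc {a b x : ℝ} (ha : 0 ≤ a) (hb : 0 < b) (hx : x ∈ Set.Icc 0 b) :
    a / b * x ∈ Set.Icc 0 a := by
  refine ⟨mul_nonneg (div_nonneg ha hb.le) hx.1, ?_⟩
  rw [div_mul_eq_mul_div, div_le_iff₀ hb]
  exact mul_le_mul_of_nonneg_left hx.2 ha

variable (ℓ : {ℓ : E → ℝ // ∀ e, 0 < ℓ e})

/-- The function `f` on the limit graph, transplanted to the graph with lengths `ℓ` by linear
rescaling of the edges. -/
def pullFun (f : (G.limitGraph l).Fun) (e : E) (x : ℝ) : ℝ :=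
  if h : 0 < l e then (G.limitGraph l).onLine f ⟨e, h⟩ (l e / ℓ.1 e * x)
  else (G.limitGraph l).vertexValue f (Quot.mk _ (G.orig e))

/-- The derivative of the transplanted function. -/
def pullDeriv (g : (G.limitGraph l).Fun) (e : E) (x : ℝ) : ℝ :=
  if h : 0 < l e then l e / ℓ.1 e * (G.limitGraph l).onLine g ⟨e, h⟩ (l e / ℓ.1 e * x) else 0

variable {G ℓ}

theorem pullFun_of_pos {e : E} (h : 0 < l e) (f : (G.limitGraph l).Fun) (x : ℝ) :
    G.pullFun ℓ f e x = (G.limitGraph l).onLine f ⟨e, h⟩ (l e / ℓ.1 e * x) := dif_pos h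

theorem pullFun_of_not_pos {e : E} (h : ¬ 0 < l e) (f : (G.limitGraph l).Fun) (x : ℝ) :
    G.pullFun ℓ f e x = (G.limitGraph l).vertexValue f (Quot.mk _ (G.orig e)) := dif_neg h

theorem pullDeriv_of_pos {e : E} (h : 0 < l e) (g : (G.limitGraph l).Fun) (x : ℝ) :
    G.pullDeriv ℓ g e x = l e / ℓ.1 e * (G.limitGraph l).onLine g ⟨e, h⟩ (l e / ℓ.1 e * x) :=
  dif_pos h

theorem pullDeriv_of_not_pos {e : E} (h : ¬ 0 < l e) (g : (G.limitGraph l).Fun) (x : ℝ) :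
    G.pullDeriv ℓ g e x = 0 := dif_neg h

theorem isPrimitiveOn_pull {f g : (G.limitGraph l).Fun} (h : (G.limitGraph l).HasL2Deriv f g)
    (e : E) : IsPrimitiveOn (ℓ.1 e) (G.pullFun ℓ f e) (G.pullDeriv ℓ g e) := by
  by_cases he : 0 < l e
  · have := ((G.limitGraph l).hasL2Deriv_iff.1 h ⟨e, he⟩).comp_div he (ℓ.2 e)
    exact this.congr_Icc (fun x _ => pullFun_of_pos he f x) fun x _ => pullDeriv_of_pos he g x
  · refine IsPrimitiveOn.congr_Icc (f := fun _ => (G.limitGraph l).vertexValue f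
      (Quot.mk _ (G.orig e))) (g := fun _ => 0) ⟨MemLp.zero, by simp⟩
      (fun x _ => pullFun_of_not_pos he f x) fun x _ => pullDeriv_of_not_pos he g x

/-- This is why the transplanted function is continuous: both ends of a collapsing edge are the same
vertex of the limit graph, so the constant on that edge fits at either end. -/
theorem endValue_pull (hl : ∀ e, 0 ≤ l e) {f : (G.limitGraph l).Fun}
    (hf : (G.limitGraph l).MemC f) (p : E × Bool) :
    (G.withLengths ℓ).endValue ((G.withLengths ℓ).ofLine (G.pullFun ℓ f)) p =
      (G.limitGraph l).vertexValue f (Quot.mk _ ((G.withLengths ℓ).endVertex p)) := by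
  obtain ⟨e, b⟩ := p
  by_cases he : 0 < l e
  · have := hf.vertexValue_endVertex (⟨e, he⟩, b)
    cases b
    · change G.pullFun ℓ f e 0 = _
      rw [pullFun_of_pos he, mul_zero]
      exact ((G.limitGraph l).onLine_zero_eq f ⟨e, he⟩).trans this.symm
    · change G.pullFun ℓ f e (ℓ.1 e) = _
      rw [pullFun_of_pos he, div_mul_cancel₀ _ (ℓ.2 e).ne']
      exact ((G.limitGraph l).onLine_len_eq f ⟨e, he⟩).trans this.symm
  · have h0 : l e = 0 := le_antisymm (not_lt.1 he) (hl e)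
    cases b
    · exact pullFun_of_not_pos he f _
    · refine (pullFun_of_not_pos he f _).trans ?_
      rw [G.mk_orig_eq_mk_term h0]
      rfl

variable (G ℓ)

/-- Transplantation of `H¹` functions from the limit graph. -/
def pull (hl : ∀ e, 0 ≤ l e) : (G.limitGraph l).energySpace →ₗ[ℝ] (G.withLengths ℓ).energySpace where
  toFun u := ⟨((G.withLengths ℓ).ofLine (G.pullFun ℓ u.1.1),
    (G.withLengths ℓ).ofLine (G.pullDeriv ℓ u.1.2)), by
      have hd := (G.withLengths ℓ).hasL2Deriv_ofLine fun e => isPrimitiveOn_pull (ℓ := ℓ) u.2.2 e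
      refine ⟨⟨hd.continuous, fun p q hpq => ?_⟩, hd⟩
      rw [endValue_pull hl u.2.1, endValue_pull hl u.2.1, hpq]⟩
  map_add' u v := by
    refine Subtype.ext (Prod.ext ?_ ?_)
    · funext e x
      change G.pullFun ℓ (u.1.1 + v.1.1) e x = G.pullFun ℓ u.1.1 e x + G.pullFun ℓ v.1.1 e x
      unfold pullFun
      split_ifs
      · rfl
      · exact (G.limitGraph l).vertexValue_add _ _ _
    · funext e x
      change G.pullDeriv ℓ (u.1.2 + v.1.2) e x = G.pullDeriv ℓ u.1.2 e x + G.pullDeriv ℓ v.1.2 e x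
      unfold pullDeriv
      split_ifs
      · rw [MetricGraph.onLine_add, mul_add]
      · simp
  map_smul' c u := by
    refine Subtype.ext (Prod.ext ?_ ?_)
    · funext e x
      change G.pullFun ℓ (c • u.1.1) e x = c * G.pullFun ℓ u.1.1 e x
      unfold pullFun
      split_ifs
      · rfl
      · exact (G.limitGraph l).vertexValue_smul _ _ _
    · funext e x
      change G.pullDeriv ℓ (c • u.1.2) e x = c * G.pullDeriv ℓ u.1.2 e x
      unfold pullDeriv
      split_ifs
      · rw [MetricGraph.onLine_smul]
        ring
      · simp

variable {G ℓ}

theorem onLine_pull_fst (hl : ∀ e, 0 ≤ l e) (u : (G.limitGraph l).energySpace) (e : E) {x : ℝ}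
    (hx : x ∈ Set.Icc 0 (ℓ.1 e)) :
    (G.withLengths ℓ).onLine (G.pull ℓ hl u).1.1 e x = G.pullFun ℓ u.1.1 e x :=
  (G.withLengths ℓ).onLine_ofLine (G.pullFun ℓ u.1.1) e hx

theorem onLine_pull_snd (hl : ∀ e, 0 ≤ l e) (u : (G.limitGraph l).energySpace) (e : E) {x : ℝ}
    (hx : x ∈ Set.Icc 0 (ℓ.1 e)) :
    (G.withLengths ℓ).onLine (G.pull ℓ hl u).1.2 e x = G.pullDeriv ℓ u.1.2 e x :=
  (G.withLengths ℓ).onLine_ofLine (G.pullDeriv ℓ u.1.2) e hx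

theorem tendsto_length (l : E → ℝ) (e : E) :
    Tendsto (fun ℓ : {ℓ : E → ℝ // ∀ e, 0 < ℓ e} => ℓ.1 e) (lengthsNear l) (𝓝 (l e)) :=
  ((continuous_apply e).tendsto l).comp tendsto_comap

theorem tendsto_div_length {e : E} (he : 0 < l e) :
    Tendsto (fun ℓ : {ℓ : E → ℝ // ∀ e, 0 < ℓ e} => l e / ℓ.1 e) (lengthsNear l) (𝓝 1) := by
  have := (tendsto_const_nhds (x := l e)).div (tendsto_length l e) he.ne'
  rw [div_self he.ne'] at this
  exact this

theorem tendsto_length_div {e : E} (he : 0 < l e) :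
    Tendsto (fun ℓ : {ℓ : E → ℝ // ∀ e, 0 < ℓ e} => ℓ.1 e / l e) (lengthsNear l) (𝓝 1) := by
  simpa [he.ne'] using (tendsto_length l e).div_const (l e)

variable [Fintype E]

theorem sum_eq_sum_pos_add (F : E → ℝ) :
    ∑ e, F e = ∑ e : {e : E // 0 < l e}, F e + ∑ e : {e : E // ¬ 0 < l e}, F e :=
  (Fintype.sum_subtype_add_sum_subtype (fun e => 0 < l e) F).symm

/-- Change of variables on the surviving edges; a collapsing edge contributes its length times a
squared vertex value, which tends to 0. -/
theorem norm_sq_valMap_pull (hl : ∀ e, 0 ≤ l e) (u : (G.limitGraph l).energySpace) :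
    ‖(G.withLengths ℓ).valMap (G.pull ℓ hl u)‖ ^ 2 =
      ∑ e : {e : E // 0 < l e}, ℓ.1 e / l e * (∫ x in (0 : ℝ)..l e,
        (G.limitGraph l).onLine u.1.1 e x * (G.limitGraph l).onLine u.1.1 e x) +
      ∑ e : {e : E // ¬ 0 < l e},
        ℓ.1 e * (G.limitGraph l).vertexValue u.1.1 (Quot.mk _ (G.orig e)) ^ 2 := by
  rw [MetricGraph.norm_sq_valMap, sum_eq_sum_pos_add (l := l)]
  congr 1
  · refine Finset.sum_congr rfl fun e _ => ?_
    rw [← integral_comp_div e.2 (ℓ.2 e) (fun x => (G.limitGraph l).onLine u.1.1 e x *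
      (G.limitGraph l).onLine u.1.1 e x)]
    refine (G.withLengths ℓ).integral_onLine_congr fun x hx => ?_
    rw [onLine_pull_fst hl u e hx, pullFun_of_pos e.2]
  · refine Finset.sum_congr rfl fun e _ => ?_
    have : ∫ x in (0 : ℝ)..ℓ.1 e, (G.limitGraph l).vertexValue u.1.1 (Quot.mk _ (G.orig e)) ^ 2 =
        ℓ.1 e * (G.limitGraph l).vertexValue u.1.1 (Quot.mk _ (G.orig e)) ^ 2 := by simp
    rw [← this]
    refine (G.withLengths ℓ).integral_onLine_congr fun x hx => ?_
    rw [onLine_pull_fst hl u e hx, pullFun_of_not_pos e.2, sq]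

/-- The chain rule gives (l/ℓ)² and the change of variables ℓ/l. Collapsing edges carry constants
and no energy. -/
theorem norm_sq_derivMap_pull (hl : ∀ e, 0 ≤ l e) (u : (G.limitGraph l).energySpace) :
    ‖(G.withLengths ℓ).derivMap (G.pull ℓ hl u)‖ ^ 2 =
      ∑ e : {e : E // 0 < l e}, l e / ℓ.1 e * (∫ x in (0 : ℝ)..l e,
        (G.limitGraph l).onLine u.1.2 e x * (G.limitGraph l).onLine u.1.2 e x) := by
  rw [MetricGraph.norm_sq_derivMap, sum_eq_sum_pos_add (l := l)]
  rw [add_eq_left.2]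
  · refine Finset.sum_congr rfl fun e _ => ?_
    have h1 := integral_comp_div e.2 (ℓ.2 e) (fun x => (G.limitGraph l).onLine u.1.2 e x *
      (G.limitGraph l).onLine u.1.2 e x)
    have h2 : l e / ℓ.1 e * (∫ x in (0 : ℝ)..l e,
        (G.limitGraph l).onLine u.1.2 e x * (G.limitGraph l).onLine u.1.2 e x) =
        (l e / ℓ.1 e) ^ 2 * (ℓ.1 e / l e * (∫ x in (0 : ℝ)..l e,
        (G.limitGraph l).onLine u.1.2 e x * (G.limitGraph l).onLine u.1.2 e x)) := by
      have := e.2.ne'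
      have := (ℓ.2 e).ne'
      field_simp
    rw [h2, ← h1, ← intervalIntegral.integral_const_mul]
    refine (G.withLengths ℓ).integral_onLine_congr fun x hx => ?_
    rw [onLine_pull_snd hl u e hx, pullDeriv_of_pos e.2]
    ring
  · refine Finset.sum_eq_zero fun e _ => ?_
    rw [(G.withLengths ℓ).integral_onLine_congr (G := fun _ => 0) fun x hx => ?_]
    · simp
    · rw [onLine_pull_snd hl u e hx, pullDeriv_of_not_pos e.2, zero_mul]

theorem le_norm_sq_valMap_pull (hl : ∀ e, 0 ≤ l e) {D : ℝ} (hD : 0 < D)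
    (h : ∀ e, 0 < l e → l e / ℓ.1 e ≤ D) (u : (G.limitGraph l).energySpace) :
    ‖(G.limitGraph l).valMap u‖ ^ 2 ≤ D * ‖(G.withLengths ℓ).valMap (G.pull ℓ hl u)‖ ^ 2 := by
  rw [norm_sq_valMap_pull, MetricGraph.norm_sq_valMap, mul_add, Finset.mul_sum]
  refine le_add_of_le_of_nonneg (Finset.sum_le_sum fun e _ => ?_) ?_
  · have h0 := integral_mul_self_nonneg e.2.le ((G.limitGraph l).onLine u.1.1 e)
    have h1 := h e e.2
    have h2 : 1 ≤ D * (ℓ.1 e / l e) := by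
      rw [div_le_iff₀ (ℓ.2 e)] at h1
      rw [mul_div_assoc', le_div_iff₀ e.2, one_mul]
      exact h1
    rw [← mul_assoc]
    exact le_mul_of_one_le_left h0 h2
  · exact mul_nonneg hD.le (Finset.sum_nonneg fun e _ => mul_nonneg (ℓ.2 e).le (sq_nonneg _))

theorem norm_sq_derivMap_pull_le (hl : ∀ e, 0 ≤ l e) {D : ℝ}
    (h : ∀ e, 0 < l e → l e / ℓ.1 e ≤ D) (u : (G.limitGraph l).energySpace) :
    ‖(G.withLengths ℓ).derivMap (G.pull ℓ hl u)‖ ^ 2 ≤ D * ‖(G.limitGraph l).derivMap u‖ ^ 2 := by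
  rw [norm_sq_derivMap_pull, MetricGraph.norm_sq_derivMap, Finset.mul_sum]
  exact Finset.sum_le_sum fun e _ => mul_le_mul_of_nonneg_right (h e e.2)
    (integral_mul_self_nonneg e.2.le _)

/-- The transplanted eigenfunctions serve as trial functions; one factor `D` is lost in the energy
and one in the norm. -/
theorem hasEigenfamily_withLengths (hl : ∀ e, 0 ≤ l e) {D : ℝ} (hD : 0 < D)
    (h : ∀ e, 0 < l e → l e / ℓ.1 e ≤ D) {μ : ℝ} (hμ : 0 ≤ μ) {k : ℕ}
    (hk : HasEigenfamily (G.limitGraph l).valMap (G.limitGraph l).derivMap μ k) :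
    HasEigenfamily (G.withLengths ℓ).valMap (G.withLengths ℓ).derivMap (D ^ 2 * μ) k := by
  obtain ⟨ν, u, h1, h2⟩ := hk
  refine (G.withLengths ℓ).energyCompact.hasEigenfamily (w := fun i => G.pull ℓ hl (u i)) ?_
    fun c => ?_
  · refine Fintype.linearIndependent_iff.2 fun c hc => ?_
    simp only [← map_smul, ← map_sum] at hc
    have h3 := le_norm_sq_valMap_pull (ℓ := ℓ) hl hD h (∑ i, c i • u i)
    rw [hc, norm_zero, zero_pow two_ne_zero, mul_zero] at h3
    have h4 : (G.limitGraph l).valMap (∑ i, c i • u i) = 0 := by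
      rw [← norm_eq_zero]
      exact pow_eq_zero_iff two_ne_zero |>.1 (le_antisymm h3 (sq_nonneg _))
    simp only [map_sum, map_smul] at h4
    exact Fintype.linearIndependent_iff.1 h2.linearIndependent c h4
  · have e : ∑ i, c i • G.pull ℓ hl (u i) = G.pull ℓ hl (∑ i, c i • u i) := by simp
    rw [e]
    calc _ ≤ D * ‖(G.limitGraph l).derivMap (∑ i, c i • u i)‖ ^ 2 :=
          norm_sq_derivMap_pull_le hl h _
      _ ≤ D * (μ * ‖(G.limitGraph l).valMap (∑ i, c i • u i)‖ ^ 2) :=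
          mul_le_mul_of_nonneg_left (energy_le_of_eigenfamily h1 h2 c) hD.le
      _ ≤ D * (μ * (D * ‖(G.withLengths ℓ).valMap (G.pull ℓ hl (∑ i, c i • u i))‖ ^ 2)) :=
          mul_le_mul_of_nonneg_left (mul_le_mul_of_nonneg_left
            (le_norm_sq_valMap_pull hl hD h _) hμ) hD.le
      _ = _ := by ring

theorem eventually_hasEigenfamily (hl : ∀ e, 0 ≤ l e) {μ η : ℝ} (hμ : 0 ≤ μ) (hη : μ < η) {k : ℕ}
    (hk : HasEigenfamily (G.limitGraph l).valMap (G.limitGraph l).derivMap μ k) :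
    ∀ᶠ ℓ in lengthsNear l,
      HasEigenfamily (G.withLengths ℓ).valMap (G.withLengths ℓ).derivMap η k := by
  obtain ⟨D, hDη, hD⟩ : ∃ D : ℝ, D ^ 2 * μ < η ∧ 1 < D := by
    have hc : Continuous fun D : ℝ => D ^ 2 * μ := by fun_prop
    have h1 : ∀ᶠ D in 𝓝[>] (1 : ℝ), D ^ 2 * μ < η :=
      ((hc.tendsto 1).mono_left nhdsWithin_le_nhds).eventually (gt_mem_nhds (by simpa using hη))
    exact (h1.and self_mem_nhdsWithin).exists
  have h2 : ∀ᶠ ℓ : {ℓ : E → ℝ // ∀ e, 0 < ℓ e} in lengthsNear l,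
      ∀ e, 0 < l e → l e / ℓ.1 e ≤ D := by
    rw [eventually_all]
    intro e
    by_cases he : 0 < l e
    · exact ((tendsto_div_length he).eventually (gt_mem_nhds hD)).mono fun ℓ h _ => h.le
    · exact Eventually.of_forall fun ℓ h => absurd h he
  filter_upwards [h2] with ℓ hℓ
  exact (hasEigenfamily_withLengths hl (by linarith) hℓ hμ hk).mono hDη.le

end DiscreteGraph
end

/-! ### Compactness as the lengths converge, possibly to zero. -/

noncomputable section

namespace DiscreteGraph

variable {V E : Type*} {G : DiscreteGraph V E} {l : E → ℝ}

/-- Uniform convergence of functions on the graphs with lengths `ℓ` to a function on the limit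
graph. -/
def UniformlyConverges (L : Filter {ℓ : E → ℝ // ∀ e, 0 < ℓ e})
    (u : ∀ ℓ, (G.withLengths ℓ).energySpace) (v : (G.limitGraph l).energySpace) : Prop :=
  ∀ ε > 0, ∀ᶠ ℓ in L, ∀ e, ∀ x ∈ Set.Icc 0 (ℓ.1 e),
    |(G.withLengths ℓ).onLine (u ℓ).1.1 e x - G.pullFun ℓ v.1.1 e x| < ε

/-- Weak convergence of the derivatives on the edges that keep a positive length. -/
def DerivWeaklyConverges (L : Filter {ℓ : E → ℝ // ∀ e, 0 < ℓ e})
    (u : ∀ ℓ, (G.withLengths ℓ).energySpace) (v : (G.limitGraph l).energySpace) : Prop :=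
  ∀ (e : {e : E // 0 < l e}) (p : ℝ → ℝ), L2On (l e) p →
    Tendsto (fun ℓ => ∫ x in (0 : ℝ)..ℓ.1 e,
      (G.withLengths ℓ).onLine (u ℓ).1.2 e x * p (l e / ℓ.1 e * x)) L
      (𝓝 (∫ x in (0 : ℝ)..l e, (G.limitGraph l).onLine v.1.2 e x * p x))

section Algebra

variable {L : Filter {ℓ : E → ℝ // ∀ e, 0 < ℓ e}} {u u' : ∀ ℓ, (G.withLengths ℓ).energySpace}
  {v v' : (G.limitGraph l).energySpace}

theorem UniformlyConverges.add (hl : ∀ e, 0 ≤ l e) (h : UniformlyConverges L u v)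
    (h' : UniformlyConverges L u' v') :
    UniformlyConverges L (fun ℓ => u ℓ + u' ℓ) (v + v') := by
  intro ε hε
  filter_upwards [h _ (half_pos hε), h' _ (half_pos hε)] with ℓ h1 h2 e x hx
  have e1 : G.pullFun ℓ (v + v').1.1 e x = G.pullFun ℓ v.1.1 e x + G.pullFun ℓ v'.1.1 e x := by
    rw [← onLine_pull_fst hl _ e hx, ← onLine_pull_fst hl _ e hx, ← onLine_pull_fst hl _ e hx,
      map_add]
    rfl
  have e2 : (G.withLengths ℓ).onLine (u ℓ + u' ℓ).1.1 e x =
      (G.withLengths ℓ).onLine (u ℓ).1.1 e x + (G.withLengths ℓ).onLine (u' ℓ).1.1 e x := rfl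
  rw [e1, e2, add_sub_add_comm]
  have := abs_add_le ((G.withLengths ℓ).onLine (u ℓ).1.1 e x - G.pullFun ℓ v.1.1 e x)
    ((G.withLengths ℓ).onLine (u' ℓ).1.1 e x - G.pullFun ℓ v'.1.1 e x)
  linarith [h1 e x hx, h2 e x hx]

theorem uniformlyConverges_pull (hl : ∀ e, 0 ≤ l e) (v : (G.limitGraph l).energySpace) :
    UniformlyConverges L (fun ℓ => G.pull ℓ hl v) v := by
  intro ε hε
  refine Eventually.of_forall fun ℓ e x hx => ?_
  rw [onLine_pull_fst hl v e hx, sub_self, abs_zero]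
  exact hε

theorem eventually_length_le (hL : L ≤ lengthsNear l) (e : E) : ∀ᶠ ℓ in L, ℓ.1 e ≤ l e + 1 :=
  (((tendsto_length l e).mono_left hL).eventually (gt_mem_nhds (lt_add_one _))).mono
    fun _ h => h.le

end Algebra

variable [Fintype E]

/-- The Hölder bound on one edge: bounded energy forces the oscillation to vanish on a collapsing
edge. -/
theorem abs_sub_left_le (ℓ : {ℓ : E → ℝ // ∀ e, 0 < ℓ e}) (u : (G.withLengths ℓ).energySpace)
    {C : ℝ} (hC : ‖(G.withLengths ℓ).derivMap u‖ ^ 2 ≤ C) {e : E} {x : ℝ}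
    (hx : x ∈ Set.Icc 0 (ℓ.1 e)) :
    |(G.withLengths ℓ).onLine u.1.1 e x - (G.withLengths ℓ).onLine u.1.1 e 0| ≤ √(ℓ.1 e * C) := by
  refine (((G.withLengths ℓ).isPrimitiveOn_of_mem u e).abs_sub_le ⟨le_rfl, hx.1.trans hx.2⟩
    hx).trans (Real.sqrt_le_sqrt ?_)
  rw [sub_zero, abs_of_nonneg hx.1]
  exact mul_le_mul hx.2 (((G.withLengths ℓ).integral_deriv_le u e).trans hC)
    (integral_mul_self_nonneg (ℓ.2 e).le _) (ℓ.2 e).le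

/-- Compactness as `ℓ → l`. -/
theorem Connected.exists_limit (hG : G.Connected) (hl : ∀ e, 0 ≤ l e) (hpos : ∃ e, 0 < l e)
    (𝒰 : Ultrafilter {ℓ : E → ℝ // ∀ e, 0 < ℓ e}) (h𝒰 : (𝒰 : Filter _) ≤ lengthsNear l)
    (u : ∀ ℓ, (G.withLengths ℓ).energySpace) {C : ℝ}
    (hA : ∀ᶠ ℓ in 𝒰, ‖(G.withLengths ℓ).valMap (u ℓ)‖ ^ 2 ≤ C)
    (hB : ∀ᶠ ℓ in 𝒰, ‖(G.withLengths ℓ).derivMap (u ℓ)‖ ^ 2 ≤ C) :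
    ∃ v : (G.limitGraph l).energySpace,
      UniformlyConverges 𝒰 u v ∧ DerivWeaklyConverges 𝒰 u v := by
  have hlim : ∀ e, Tendsto (fun ℓ : {ℓ : E → ℝ // ∀ e, 0 < ℓ e} => ℓ.1 e) 𝒰 (𝓝 (l e)) :=
    fun e => (tendsto_length l e).mono_left h𝒰
  have hsmall : ∀ e, Tendsto (fun ℓ : {ℓ : E → ℝ // ∀ e, 0 < ℓ e} => √(ℓ.1 e * C)) 𝒰
      (𝓝 √(l e * C)) := fun e => ((hlim e).mul_const C).sqrt
  set c : {ℓ : E → ℝ // ∀ e, 0 < ℓ e} → V → ℝ := fun ℓ =>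
    (G.withLengths ℓ).vertexValue (u ℓ).1.1
  have horig : ∀ ℓ e, (G.withLengths ℓ).onLine (u ℓ).1.1 e 0 = c ℓ (G.orig e) := fun ℓ e =>
    ((G.withLengths ℓ).onLine_zero_eq _ e).trans
      ((u ℓ).2.1.vertexValue_endVertex (e, false)).symm
  have hterm : ∀ ℓ e, (G.withLengths ℓ).onLine (u ℓ).1.1 e (ℓ.1 e) = c ℓ (G.term e) := fun ℓ e =>
    ((G.withLengths ℓ).onLine_len_eq _ e).trans
      ((u ℓ).2.1.vertexValue_endVertex (e, true)).symm
  have hdiff : ∀ e, ∀ᶠ ℓ in 𝒰, |c ℓ (G.term e) - c ℓ (G.orig e)| ≤ √(ℓ.1 e * C) := fun e => by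
    filter_upwards [hB] with ℓ hℓ
    rw [← horig, ← hterm]
    exact abs_sub_left_le ℓ (u ℓ) hℓ ⟨(ℓ.2 e).le, le_rfl⟩
  -- Norm and energy control the values at an end of one surviving edge, whose length stays away
  -- from 0. Connectedness and the oscillation bound carry this to all vertices.
  have hbdd : ∀ v, ∃ B, ∀ᶠ ℓ in 𝒰, |c ℓ v| ≤ B := by
    obtain ⟨e₀, he₀⟩ := hpos
    refine hG.forall_of_step (P := fun v => ∃ B, ∀ᶠ ℓ in 𝒰, |c ℓ v| ≤ B) (fun e => ?_)
      (a := G.orig e₀) ?_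
    · have hδ : ∀ᶠ ℓ in 𝒰, |c ℓ (G.term e) - c ℓ (G.orig e)| ≤ √(l e * C) + 1 := by
        filter_upwards [hdiff e, (hsmall e).eventually (gt_mem_nhds (lt_add_one _))] with ℓ h1 h2
        exact h1.trans h2.le
      constructor
      · rintro ⟨B, hB⟩
        refine ⟨B + (√(l e * C) + 1), ?_⟩
        filter_upwards [hB, hδ] with ℓ h1 h2
        have := abs_add_le (c ℓ (G.orig e)) (c ℓ (G.term e) - c ℓ (G.orig e))
        rw [add_sub_cancel] at this
        linarith
      · rintro ⟨B, hB⟩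
        refine ⟨B + (√(l e * C) + 1), ?_⟩
        filter_upwards [hB, hδ] with ℓ h1 h2
        have := abs_sub (c ℓ (G.term e)) (c ℓ (G.term e) - c ℓ (G.orig e))
        rw [sub_sub_cancel] at this
        linarith
    -- This is the bound of `IsPrimitiveOn.sq_left_le` for lengths eventually between `l e₀ / 2` and
    -- `2 * l e₀`.
    · refine ⟨√((2 * C + 2 * (2 * l e₀) ^ 2 * C) / (l e₀ / 2)), ?_⟩
      filter_upwards [hA, hB, (hlim e₀).eventually (lt_mem_nhds (half_lt_self he₀)),
        (hlim e₀).eventually (gt_mem_nhds (by linarith : l e₀ < 2 * l e₀))] with ℓ h1 h2 h3 h4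
      refine Real.abs_le_sqrt ?_
      rw [← horig, le_div_iff₀ (by linarith), mul_comm]
      have hL := ℓ.2 e₀
      have h5 := ((G.withLengths ℓ).isPrimitiveOn_of_mem (u ℓ) e₀).sq_left_le hL
      have h6 := ((G.withLengths ℓ).integral_val_le (u ℓ) e₀).trans h1
      have h7 := ((G.withLengths ℓ).integral_deriv_le (u ℓ) e₀).trans h2
      have h8 : 0 ≤ C := (sq_nonneg _).trans h1
      rw [withLengths_len] at h5 h6 h7
      calc _ ≤ ℓ.1 e₀ * (G.withLengths ℓ).onLine (u ℓ).1.1 e₀ 0 ^ 2 :=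
            mul_le_mul_of_nonneg_right h3.le (sq_nonneg _)
        _ ≤ _ := h5
        _ ≤ 2 * C + 2 * ℓ.1 e₀ ^ 2 * C := by gcongr
        _ ≤ 2 * C + 2 * (2 * l e₀) ^ 2 * C := by gcongr
  have hc : ∀ v, ∃ x, Tendsto (fun ℓ => c ℓ v) 𝒰 (𝓝 x) := fun v =>
    (hbdd v).elim fun B hB => 𝒰.exists_tendsto_of_abs_le hB
  choose d hd using hc
  -- The limiting vertex values agree across collapsed edges, so they descend to the vertices of the
  -- limit graph.
  have hdd : ∀ e, l e = 0 → d (G.orig e) = d (G.term e) := by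
    intro e he
    have h1 : Tendsto (fun ℓ => |c ℓ (G.term e) - c ℓ (G.orig e)|) 𝒰 (𝓝 0) := by
      refine squeeze_zero' (Eventually.of_forall fun _ => abs_nonneg _) (hdiff e) ?_
      simpa [he] using hsmall e
    have h2 := tendsto_nhds_unique ((hd (G.term e)).sub (hd (G.orig e))).abs h1
    exact (sub_eq_zero.1 (abs_eq_zero.1 h2)).symm
  let d' : G.LimitVertex l → ℝ := Quot.lift d (by
    rintro _ _ ⟨e, he, rfl, rfl⟩
    exact hdd e he)
  have hedge : ∀ e : {e : E // 0 < l e}, ∃ F G', IsPrimitiveOn (l e) F G' ∧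
      (∀ ε > 0, ∀ᶠ ℓ in 𝒰, ∀ x ∈ Set.Icc 0 (ℓ.1 e),
        |(G.withLengths ℓ).onLine (u ℓ).1.1 e x - F (l e / ℓ.1 e * x)| < ε) ∧
      ∀ p, L2On (l e) p → Tendsto (fun ℓ => ∫ x in (0 : ℝ)..ℓ.1 e,
        (G.withLengths ℓ).onLine (u ℓ).1.2 e x * p (l e / ℓ.1 e * x)) 𝒰
        (𝓝 (∫ x in (0 : ℝ)..l e, G' x * p x)) := by
    intro e
    obtain ⟨B, hB'⟩ := hbdd (G.orig e)
    refine exists_isPrimitiveOn_limit 𝒰 e.2 (fun ℓ => ℓ.2 e) (hlim e)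
      (fun ℓ => (G.withLengths ℓ).isPrimitiveOn_of_mem (u ℓ) e) (B := B) (C := C) ?_ ?_
    · filter_upwards [hB'] with ℓ hℓ
      rwa [horig]
    · filter_upwards [hB] with ℓ hℓ
      exact ((G.withLengths ℓ).integral_deriv_le (u ℓ) e).trans hℓ
  choose F G' hFG hu hw using hedge
  have hF0 : ∀ e, F e 0 = d (G.orig e) := by
    intro e
    refine tendsto_nhds_unique (f := fun ℓ => c ℓ (G.orig e)) (l := (𝒰 : Filter _)) ?_ (hd _)
    rw [Metric.tendsto_nhds]
    intro ε hε
    filter_upwards [hu e ε hε] with ℓ hℓ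
    have := hℓ 0 ⟨le_rfl, (ℓ.2 e).le⟩
    rwa [mul_zero, horig] at this
  have hF1 : ∀ e, F e (l e) = d (G.term e) := by
    intro e
    refine tendsto_nhds_unique (f := fun ℓ => c ℓ (G.term e)) (l := (𝒰 : Filter _)) ?_ (hd _)
    rw [Metric.tendsto_nhds]
    intro ε hε
    filter_upwards [hu e ε hε] with ℓ hℓ
    have := hℓ (ℓ.1 e) ⟨(ℓ.2 e).le, le_rfl⟩
    rwa [div_mul_cancel₀ _ (ℓ.2 e).ne', hterm] at this
  have hder := (G.limitGraph l).hasL2Deriv_ofLine (F := F) (G := G') hFG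
  have hend : ∀ p, (G.limitGraph l).endValue ((G.limitGraph l).ofLine F) p =
      d' ((G.limitGraph l).endVertex p) := by
    rintro ⟨e, b⟩
    cases b
    · exact hF0 e
    · exact hF1 e
  have hmem : (G.limitGraph l).MemC ((G.limitGraph l).ofLine F) :=
    ⟨hder.continuous, fun p q hpq => by rw [hend, hend, hpq]⟩
  -- `vertexValue` defaults to 0 at a vertex without edges; connectedness and the existence of a
  -- surviving edge exclude such vertices.
  have hvv : ∀ v, (G.limitGraph l).vertexValue ((G.limitGraph l).ofLine F) (Quot.mk _ v) = d v := by
    intro v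
    obtain ⟨p, hp⟩ := hG.exists_endVertex_eq hl hpos v
    rw [← hp, hmem.vertexValue_endVertex, hend, hp]
  refine ⟨⟨((G.limitGraph l).ofLine F, (G.limitGraph l).ofLine G'), hmem, hder⟩,
    fun ε hε => ?_, fun e p hp => ?_⟩
  · rw [eventually_all]
    intro e
    by_cases he : 0 < l e
    · filter_upwards [hu ⟨e, he⟩ ε hε] with ℓ hℓ x hx
      have e1 := (G.limitGraph l).onLine_ofLine F ⟨e, he⟩ (x := l e / ℓ.1 e * x)
        (div_mul_mem_Icc he.le (ℓ.2 e) hx)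
      rw [pullFun_of_pos he, e1]
      exact hℓ x hx
    · have h0 : l e = 0 := le_antisymm (not_lt.1 he) (hl e)
      have h1 := hsmall e
      rw [h0, zero_mul, Real.sqrt_zero] at h1
      have h2 := (hd (G.orig e))
      rw [Metric.tendsto_nhds] at h2
      filter_upwards [hB, h1.eventually (gt_mem_nhds (half_pos hε)), h2 _ (half_pos hε)]
        with ℓ h3 h4 h5 x hx
      rw [pullFun_of_not_pos he, hvv]
      have h6 := abs_sub_left_le ℓ (u ℓ) h3 hx
      rw [horig] at h6
      rw [Real.dist_eq] at h5
      have h7 := abs_sub_le ((G.withLengths ℓ).onLine (u ℓ).1.1 e x) (c ℓ (G.orig e)) (d (G.orig e))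
      linarith
  · have h1 := hw e p hp
    have e1 : ∫ x in (0 : ℝ)..l e, G' e x * p x = ∫ x in (0 : ℝ)..l e,
        (G.limitGraph l).onLine ((G.limitGraph l).ofLine G') e x * p x :=
      (G.limitGraph l).integral_onLine_congr (e := e) fun x hx => by
        rw [(G.limitGraph l).onLine_ofLine G' e hx]
    rw [e1] at h1
    exact h1

section Limits

variable {L : Filter {ℓ : E → ℝ // ∀ e, 0 < ℓ e}} {u u' : ∀ ℓ, (G.withLengths ℓ).energySpace}
  {v v' : (G.limitGraph l).energySpace}

/-- The difference from the transplanted limit is uniformly small on edges of bounded length, and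
the norm of the transplanted function converges. The L² space varies with ℓ, so only scalar
quantities can be compared. -/
theorem UniformlyConverges.tendsto_norm_valMap (hl : ∀ e, 0 ≤ l e) (hL : L ≤ lengthsNear l)
    (h : UniformlyConverges L u v) :
    Tendsto (fun ℓ => ‖(G.withLengths ℓ).valMap (u ℓ)‖) L (𝓝 ‖(G.limitGraph l).valMap v‖) := by
  have h1 : Tendsto (fun ℓ => ‖(G.withLengths ℓ).valMap (u ℓ - G.pull ℓ hl v)‖ ^ 2) L (𝓝 0) := by
    have key : ∀ e ∈ Finset.univ, Tendsto (fun ℓ : {ℓ : E → ℝ // ∀ e, 0 < ℓ e} =>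
        ∫ x in (0 : ℝ)..ℓ.1 e, (G.withLengths ℓ).onLine (u ℓ - G.pull ℓ hl v).1.1 e x *
          (G.withLengths ℓ).onLine (u ℓ - G.pull ℓ hl v).1.1 e x) L (𝓝 0) := by
      intro e _
      refine tendsto_integral_mul_self_zero (fun ℓ => ℓ.2 e) (eventually_length_le hL e)
        (fun ℓ => (u ℓ - G.pull ℓ hl v).2.1.continuousOn e) fun ε hε => ?_
      filter_upwards [h ε hε] with ℓ hℓ x hx
      have e2 : (G.withLengths ℓ).onLine (u ℓ - G.pull ℓ hl v).1.1 e x =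
        (G.withLengths ℓ).onLine (u ℓ).1.1 e x -
          (G.withLengths ℓ).onLine (G.pull ℓ hl v).1.1 e x := rfl
      rw [e2, onLine_pull_fst hl v e hx]
      exact hℓ e x hx
    have := tendsto_finsetSum _ key
    rw [Finset.sum_const_zero] at this
    refine this.congr fun ℓ => ?_
    rw [MetricGraph.norm_sq_valMap]
    rfl
  have h2 : Tendsto (fun ℓ => ‖(G.withLengths ℓ).valMap (G.pull ℓ hl v)‖ ^ 2) L
      (𝓝 (‖(G.limitGraph l).valMap v‖ ^ 2)) := by
    simp only [norm_sq_valMap_pull]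
    rw [MetricGraph.norm_sq_valMap]
    have a1 : Tendsto (fun ℓ : {ℓ : E → ℝ // ∀ e, 0 < ℓ e} =>
        ∑ e : {e : E // 0 < l e}, ℓ.1 e / l e * (∫ x in (0 : ℝ)..l e,
        (G.limitGraph l).onLine v.1.1 e x * (G.limitGraph l).onLine v.1.1 e x)) L
        (𝓝 (∑ e : {e : E // 0 < l e}, 1 * (∫ x in (0 : ℝ)..l e,
        (G.limitGraph l).onLine v.1.1 e x * (G.limitGraph l).onLine v.1.1 e x))) :=
      tendsto_finsetSum _ fun e _ => ((tendsto_length_div e.2).mono_left hL).mul_const _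
    have a2 : Tendsto (fun ℓ : {ℓ : E → ℝ // ∀ e, 0 < ℓ e} => ∑ e : {e : E // ¬ 0 < l e},
        ℓ.1 e * (G.limitGraph l).vertexValue v.1.1 (Quot.mk _ (G.orig e)) ^ 2) L
        (𝓝 (∑ e : {e : E // ¬ 0 < l e},
        l e * (G.limitGraph l).vertexValue v.1.1 (Quot.mk _ (G.orig e)) ^ 2)) :=
      tendsto_finsetSum _ fun e _ => ((tendsto_length l e).mono_left hL).mul_const _
    have a3 : ∑ e : {e : E // ¬ 0 < l e},
        l e * (G.limitGraph l).vertexValue v.1.1 (Quot.mk _ (G.orig e)) ^ 2 = 0 :=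
      Finset.sum_eq_zero fun e _ => by
        rw [le_antisymm (not_lt.1 e.2) (hl e), zero_mul]
    have a4 := a1.add a2
    rw [a3, add_zero] at a4
    simp only [one_mul] at a4
    exact a4
  have h3 := h1.sqrt
  have h4 := h2.sqrt
  simp only [Real.sqrt_sq (norm_nonneg _), Real.sqrt_zero] at h3 h4
  rw [tendsto_iff_dist_tendsto_zero] at h4 ⊢
  have h5 := h3.add h4
  rw [add_zero] at h5
  refine squeeze_zero (fun _ => dist_nonneg) (fun ℓ => ?_) h5
  have h6 := dist_triangle ‖(G.withLengths ℓ).valMap (u ℓ)‖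
    ‖(G.withLengths ℓ).valMap (G.pull ℓ hl v)‖ ‖(G.limitGraph l).valMap v‖
  refine h6.trans (add_le_add_left ?_ _)
  rw [map_sub, Real.dist_eq]
  exact abs_norm_sub_norm_le _ _

/-- Polarisation of the convergence of norms. -/
theorem UniformlyConverges.tendsto_inner_valMap (hl : ∀ e, 0 ≤ l e) (hL : L ≤ lengthsNear l)
    (h : UniformlyConverges L u v) (h' : UniformlyConverges L u' v') :
    Tendsto (fun ℓ => inner ℝ ((G.withLengths ℓ).valMap (u ℓ)) ((G.withLengths ℓ).valMap (u' ℓ))) L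
      (𝓝 (inner ℝ ((G.limitGraph l).valMap v) ((G.limitGraph l).valMap v'))) := by
  simp only [real_inner_eq_norm_add_mul_self_sub_norm_mul_self_sub_norm_mul_self_div_two]
  have h1 := h.tendsto_norm_valMap hl hL
  have h2 := h'.tendsto_norm_valMap hl hL
  have h3 := (h.add hl h').tendsto_norm_valMap hl hL
  simp only [map_add] at h3
  exact (((h3.mul h3).sub (h1.mul h1)).sub (h2.mul h2)).div_const 2

/-- Transplanted functions have zero derivative on collapsing edges, so weak convergence on the
surviving edges is enough. -/
theorem DerivWeaklyConverges.tendsto_inner_derivMap (hl : ∀ e, 0 ≤ l e) (hL : L ≤ lengthsNear l)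
    (h : DerivWeaklyConverges L u v) (w : (G.limitGraph l).energySpace) :
    Tendsto (fun ℓ => inner ℝ ((G.withLengths ℓ).derivMap (u ℓ))
      ((G.withLengths ℓ).derivMap (G.pull ℓ hl w))) L
      (𝓝 (inner ℝ ((G.limitGraph l).derivMap v) ((G.limitGraph l).derivMap w))) := by
  have h1 : Tendsto (fun ℓ : {ℓ : E → ℝ // ∀ e, 0 < ℓ e} => ∑ e : {e : E // 0 < l e},
      l e / ℓ.1 e * ∫ x in (0 : ℝ)..ℓ.1 e, (G.withLengths ℓ).onLine (u ℓ).1.2 e x *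
        (G.limitGraph l).onLine w.1.2 e (l e / ℓ.1 e * x)) L
      (𝓝 (∑ e : {e : E // 0 < l e}, 1 * ∫ x in (0 : ℝ)..l e,
        (G.limitGraph l).onLine v.1.2 e x * (G.limitGraph l).onLine w.1.2 e x)) :=
    tendsto_finsetSum _ fun e _ => ((tendsto_div_length e.2).mono_left hL).mul
      (h e _ ((G.limitGraph l).isPrimitiveOn_of_mem w e).1)
  rw [MetricGraph.inner_derivMap]
  simp only [one_mul] at h1
  refine h1.congr fun ℓ => ?_
  rw [MetricGraph.inner_derivMap, sum_eq_sum_pos_add (l := l), eq_comm, add_eq_left.2]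
  · refine Finset.sum_congr rfl fun e _ => ?_
    rw [← intervalIntegral.integral_const_mul]
    refine (G.withLengths ℓ).integral_onLine_congr fun x hx => ?_
    rw [onLine_pull_snd hl w e hx, pullDeriv_of_pos e.2]
    ring
  · refine Finset.sum_eq_zero fun e _ => ?_
    rw [(G.withLengths ℓ).integral_onLine_congr (G := fun _ => 0) fun x hx => ?_]
    · simp
    · rw [onLine_pull_snd hl w e hx, pullDeriv_of_not_pos e.2, mul_zero]

end Limits

/-- Normalised eigenfunctions to bounded eigenvalues converge to eigenfunctions of the limit
graph. -/
theorem Connected.exists_limit_eigenvector (hG : G.Connected) (hl : ∀ e, 0 ≤ l e)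
    (hpos : ∃ e, 0 < l e) (𝒰 : Ultrafilter {ℓ : E → ℝ // ∀ e, 0 < ℓ e})
    (h𝒰 : (𝒰 : Filter _) ≤ lengthsNear l) (u : ∀ ℓ, (G.withLengths ℓ).energySpace)
    (ν : {ℓ : E → ℝ // ∀ e, 0 < ℓ e} → ℝ) {Λ : ℝ}
    (hu : ∀ᶠ ℓ in 𝒰, u ℓ ∈ weakEigenspace (G.withLengths ℓ).valMap (G.withLengths ℓ).derivMap (ν ℓ))
    (hu1 : ∀ᶠ ℓ in 𝒰, ‖(G.withLengths ℓ).valMap (u ℓ)‖ = 1) (hν : ∀ᶠ ℓ in 𝒰, ν ℓ ≤ Λ) :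
    ∃ (m : ℝ) (v : (G.limitGraph l).energySpace), Tendsto ν 𝒰 (𝓝 m) ∧
      v ∈ weakEigenspace (G.limitGraph l).valMap (G.limitGraph l).derivMap m ∧
      UniformlyConverges 𝒰 u v ∧ DerivWeaklyConverges 𝒰 u v := by
  obtain ⟨m, hm⟩ := 𝒰.exists_tendsto_of_abs_le (a := ν) (B := Λ) (by
    filter_upwards [hu, hu1, hν] with ℓ h1 h2 h3
    rwa [abs_of_nonneg (nonneg_of_mem_weakEigenspace h1 h2)])
  obtain ⟨v, hv1, hv2⟩ := hG.exists_limit hl hpos 𝒰 h𝒰 u (C := max 1 Λ)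
    (by
      filter_upwards [hu1] with ℓ h1
      rw [h1, one_pow]
      exact le_max_left _ _)
    (by
      filter_upwards [hu, hu1, hν] with ℓ h1 h2 h3
      rw [norm_sq_of_mem_weakEigenspace h1, h2, one_pow, mul_one]
      exact h3.trans (le_max_right _ _))
  refine ⟨m, v, hm, fun w => ?_, hv1, hv2⟩
  -- Both sides of the equation on Γ(ℓ), tested with the transplanted `w`, converge to the
  -- corresponding sides on the limit graph.
  refine tendsto_nhds_unique (hv2.tendsto_inner_derivMap hl h𝒰 w) ?_
  refine (hm.mul (hv1.tendsto_inner_valMap hl h𝒰 (uniformlyConverges_pull hl w))).congr' ?_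
  filter_upwards [hu] with ℓ h1
  exact (h1 _).symm

end DiscreteGraph
end

/-! ### Convergence in the H¹ and supremum norms. -/

noncomputable section

namespace MetricGraph

theorem h1Norm_le {V E : Type*} [Fintype E] (Γ : MetricGraph V E) {f g : Γ.Fun}
    (h : Γ.HasL2Deriv f g) :
    Γ.h1Norm f ≤ ENNReal.ofReal (∑ e, ((∫ x in (0 : ℝ)..Γ.len e, Γ.onLine f e x * Γ.onLine f e x) +
      ∫ x in (0 : ℝ)..Γ.len e, Γ.onLine g e x * Γ.onLine g e x)) ^ (1 / 2 : ℝ) := by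
  refine (iInf₂_le g h).trans (ENNReal.rpow_le_rpow (le_of_eq ?_) (by norm_num))
  rw [ENNReal.ofReal_sum_of_nonneg fun e _ => add_nonneg
    (integral_mul_self_nonneg (Γ.len_pos e).le _) (integral_mul_self_nonneg (Γ.len_pos e).le _)]
  refine Finset.sum_congr rfl fun e _ => ?_
  have hL := (Γ.len_pos e).le
  have hp := Γ.hasL2Deriv_iff.1 h e
  have hf : L2On (Γ.len e) (Γ.onLine f e) := hp.continuousOn.l2On
  rw [← intervalIntegral.integral_add (hf.integrable_mul hf hL) (hp.1.integrable_mul hp.1 hL),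
    intervalIntegral.integral_of_le hL, ofReal_integral_eq_lintegral_ofReal
      (f := fun x => Γ.onLine f e x * Γ.onLine f e x + Γ.onLine g e x * Γ.onLine g e x) ((MemLp.integrable_mul hf hf).add (MemLp.integrable_mul hp.1 hp.1))
      (ae_of_all _ fun x => add_nonneg (mul_self_nonneg _) (mul_self_nonneg _))]
  refine lintegral_congr fun x => ?_
  rw [ENNReal.ofReal_add (mul_self_nonneg _) (mul_self_nonneg _), ← sq, ← sq, ← sq_abs,
    ← sq_abs (Γ.onLine g e x), ENNReal.ofReal_pow (abs_nonneg _), ENNReal.ofReal_pow (abs_nonneg _),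
    ← Real.enorm_eq_ofReal_abs, ← Real.enorm_eq_ofReal_abs]

theorem supNorm_le {V E : Type*} (Γ : MetricGraph V E) {f : Γ.Fun} {ε : ℝ}
    (h : ∀ e, ∀ x ∈ Set.Icc 0 (Γ.len e), |Γ.onLine f e x| ≤ ε) :
    Γ.supNorm f ≤ ENNReal.ofReal ε := by
  refine iSup₂_le fun e x => ?_
  rw [Real.enorm_eq_ofReal_abs, ← Γ.onLine_coe f e x]
  exact ENNReal.ofReal_le_ofReal (h e x x.2)

end MetricGraph

namespace DiscreteGraph

variable {V E : Type*} {G : DiscreteGraph V E} {l : E → ℝ}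

/-- The factor by which `rescale` multiplies the transplanted function on the edge `e`. -/
def rescaleFactor (l : E → ℝ) (ℓ : {ℓ : E → ℝ // ∀ e, 0 < ℓ e}) (e : E) : ℝ :=
  if 0 < l e then √(ℓ.1 e / l e) else 1

theorem rescaleFactor_of_not_pos {ℓ : {ℓ : E → ℝ // ∀ e, 0 < ℓ e}} {e : E} (h : ¬ 0 < l e) :
    rescaleFactor l ℓ e = 1 := if_neg h

theorem tendsto_rescaleFactor (l : E → ℝ) (e : E) :
    Tendsto (fun ℓ => rescaleFactor l ℓ e) (lengthsNear l) (𝓝 1) := by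
  unfold rescaleFactor
  split_ifs with h
  · simpa using (tendsto_length_div h).sqrt
  · exact tendsto_const_nhds

/-- The rescaling operator differs from `pullFun` by a factor depending on the edge. That factor
generally destroys continuity at the vertices, which is why trial functions come from `pull`; as it
tends to 1, it is harmless in the limit. -/
theorem rescale_eq (ℓ : {ℓ : E → ℝ // ∀ e, 0 < ℓ e}) (f : (G.limitGraph l).Fun) :
    G.rescale l ℓ f =
      (G.withLengths ℓ).ofLine fun e x => rescaleFactor l ℓ e * G.pullFun ℓ f e x := by
  funext e x
  change (if h : 0 < l e then _ else _) = rescaleFactor l ℓ e * G.pullFun ℓ f e x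
  by_cases he : 0 < l e
  · rw [dif_pos he, pullFun_of_pos he, rescaleFactor, if_pos he]
  · rw [dif_neg he, pullFun_of_not_pos he, rescaleFactor_of_not_pos he, one_mul]

theorem hasL2Deriv_rescale (ℓ : {ℓ : E → ℝ // ∀ e, 0 < ℓ e}) {f g : (G.limitGraph l).Fun}
    (h : (G.limitGraph l).HasL2Deriv f g) :
    (G.withLengths ℓ).HasL2Deriv (G.rescale l ℓ f)
      ((G.withLengths ℓ).ofLine fun e x => rescaleFactor l ℓ e * G.pullDeriv ℓ g e x) := by
  rw [rescale_eq]
  refine (G.withLengths ℓ).hasL2Deriv_ofLine fun e => ?_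
  have hp := isPrimitiveOn_pull (ℓ := ℓ) h e
  refine ⟨hp.1.const_mul _, fun x hx => ?_⟩
  have h1 := hp.2 x hx
  simp only [intervalIntegral.integral_const_mul, h1]
  ring

section

variable {L : Filter {ℓ : E → ℝ // ∀ e, 0 < ℓ e}} {u : ∀ ℓ, (G.withLengths ℓ).energySpace}
  {w : (G.limitGraph l).energySpace}

theorem onLine_sub_rescale {ℓ : {ℓ : E → ℝ // ∀ e, 0 < ℓ e}} (f : (G.withLengths ℓ).Fun)
    (h : (G.limitGraph l).Fun) (e : E) {x : ℝ} (hx : x ∈ Set.Icc 0 (ℓ.1 e)) :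
    (G.withLengths ℓ).onLine (f - G.rescale l ℓ h) e x =
      (G.withLengths ℓ).onLine f e x - rescaleFactor l ℓ e * G.pullFun ℓ h e x := by
  rw [rescale_eq, ← (G.withLengths ℓ).onLine_ofLine
    (fun e x => rescaleFactor l ℓ e * G.pullFun ℓ h e x) e hx]
  rfl

theorem UniformlyConverges.sub_rescale [Finite E] (hL : L ≤ lengthsNear l)
    (h : UniformlyConverges L u w) :
    ∀ ε > 0, ∀ᶠ ℓ in L, ∀ e, ∀ x ∈ Set.Icc 0 (ℓ.1 e),
      |(G.withLengths ℓ).onLine ((u ℓ).1.1 - G.rescale l ℓ w.1.1) e x| < ε := by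
  intro ε hε
  rw [eventually_all]
  intro e
  have h1 : ∀ᶠ ℓ in L, ∀ x ∈ Set.Icc 0 (ℓ.1 e),
      |G.pullFun ℓ w.1.1 e x - rescaleFactor l ℓ e * G.pullFun ℓ w.1.1 e x| < ε / 2 := by
    by_cases he : 0 < l e
    · obtain ⟨M, hM⟩ := isCompact_Icc.exists_bound_of_continuousOn
        (w.2.1.continuousOn (⟨e, he⟩ : {e : E // 0 < l e}))
      have h2 : Tendsto (fun ℓ => |1 - rescaleFactor l ℓ e| * M) L (𝓝 0) := by
        simpa using ((((tendsto_rescaleFactor l e).mono_left hL).const_sub 1).abs).mul_const M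
      filter_upwards [h2.eventually (gt_mem_nhds (half_pos hε))] with ℓ hℓ x hx
      rw [← one_sub_mul, abs_mul]
      refine (mul_le_mul_of_nonneg_left ?_ (abs_nonneg _)).trans_lt hℓ
      rw [pullFun_of_pos he]
      exact hM _ (div_mul_mem_Icc he.le (ℓ.2 e) hx)
    · refine Eventually.of_forall fun ℓ x _ => ?_
      rw [rescaleFactor_of_not_pos he, one_mul, sub_self, abs_zero]
      exact half_pos hε
  filter_upwards [h _ (half_pos hε), h1] with ℓ h2 h3 x hx
  rw [onLine_sub_rescale _ _ _ hx]
  have := abs_sub_le ((G.withLengths ℓ).onLine (u ℓ).1.1 e x) (G.pullFun ℓ w.1.1 e x)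
    (rescaleFactor l ℓ e * G.pullFun ℓ w.1.1 e x)
  linarith [h2 e x hx, h3 x hx]

theorem UniformlyConverges.tendsto_supNorm [Finite E] (hL : L ≤ lengthsNear l)
    (h : UniformlyConverges L u w) :
    Tendsto (fun ℓ => (G.withLengths ℓ).supNorm ((u ℓ).1.1 - G.rescale l ℓ w.1.1)) L (𝓝 0) := by
  rw [ENNReal.tendsto_nhds_zero]
  intro ε hε
  obtain ⟨δ, hδ0, hδ⟩ := ENNReal.lt_iff_exists_nnreal_btwn.1 hε
  filter_upwards [h.sub_rescale hL δ (by exact_mod_cast hδ0)] with ℓ hℓ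
  refine ((G.withLengths ℓ).supNorm_le fun e x hx => (hℓ e x hx).le).trans ?_
  rw [ENNReal.ofReal_coe_nnreal]
  exact hδ.le

/-- Expanding the square isolates the cross term, the only one requiring weak convergence. -/
theorem integral_deriv_sub_rescale_of_pos {ℓ : {ℓ : E → ℝ // ∀ e, 0 < ℓ e}}
    (u : (G.withLengths ℓ).energySpace) (w : (G.limitGraph l).energySpace)
    (e : {e : E // 0 < l e}) :
    ∫ x in (0 : ℝ)..ℓ.1 e, ((G.withLengths ℓ).onLine u.1.2 e x -
        rescaleFactor l ℓ e * G.pullDeriv ℓ w.1.2 e x) *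
        ((G.withLengths ℓ).onLine u.1.2 e x - rescaleFactor l ℓ e * G.pullDeriv ℓ w.1.2 e x) =
      (∫ x in (0 : ℝ)..ℓ.1 e, (G.withLengths ℓ).onLine u.1.2 e x *
        (G.withLengths ℓ).onLine u.1.2 e x) -
      (2 * (rescaleFactor l ℓ e * (l e / ℓ.1 e)) * (∫ x in (0 : ℝ)..ℓ.1 e,
        (G.withLengths ℓ).onLine u.1.2 e x * (G.limitGraph l).onLine w.1.2 e (l e / ℓ.1 e * x)) -
      (rescaleFactor l ℓ e * (l e / ℓ.1 e)) ^ 2 * (ℓ.1 e / l e * ∫ x in (0 : ℝ)..l e,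
        (G.limitGraph l).onLine w.1.2 e x * (G.limitGraph l).onLine w.1.2 e x)) := by
  have hg : L2On (ℓ.1 e) ((G.withLengths ℓ).onLine u.1.2 e) :=
    ((G.withLengths ℓ).isPrimitiveOn_of_mem u e).1
  have hp : L2On (ℓ.1 e) (fun x => (G.limitGraph l).onLine w.1.2 e (l e / ℓ.1 e * x)) :=
    ((G.limitGraph l).isPrimitiveOn_of_mem w e).1.comp_div e.2 (ℓ.2 e)
  set a := rescaleFactor l ℓ e * (l e / ℓ.1 e)
  rw [← integral_comp_div e.2 (ℓ.2 e) (fun x =>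
    (G.limitGraph l).onLine w.1.2 e x * (G.limitGraph l).onLine w.1.2 e x)]
  have h1 := hg.integrable_mul hg (ℓ.2 e).le
  have h2 := (hg.integrable_mul hp (ℓ.2 e).le).const_mul (2 * a)
  have h3 := (hp.integrable_mul hp (ℓ.2 e).le).const_mul (a ^ 2)
  rw [← intervalIntegral.integral_const_mul, ← intervalIntegral.integral_const_mul,
    ← intervalIntegral.integral_sub h2 h3, ← intervalIntegral.integral_sub h1 (h2.sub h3)]
  refine intervalIntegral.integral_congr fun x _ => ?_
  simp only [pullDeriv_of_pos e.2, a]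
  ring

variable [Fintype E]

/-- Weak convergence and convergence of the energies imply strong convergence of the derivatives.
Since `hE` concerns the total energy while the limit lives on the surviving edges, the energy on the
collapsing edges is also forced to 0. -/
theorem tendsto_h1Norm (hL : L ≤ lengthsNear l)
    (h : UniformlyConverges L u w) (h' : DerivWeaklyConverges L u w)
    (hE : Tendsto (fun ℓ => ‖(G.withLengths ℓ).derivMap (u ℓ)‖ ^ 2) L
      (𝓝 (‖(G.limitGraph l).derivMap w‖ ^ 2))) :
    Tendsto (fun ℓ => (G.withLengths ℓ).h1Norm ((u ℓ).1.1 - G.rescale l ℓ w.1.1)) L (𝓝 0) := by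
  set D : ∀ ℓ, (G.withLengths ℓ).Fun := fun ℓ => (u ℓ).1.1 - G.rescale l ℓ w.1.1
  set D' : ∀ ℓ, (G.withLengths ℓ).Fun := fun ℓ => (u ℓ).1.2 -
    (G.withLengths ℓ).ofLine fun e x => rescaleFactor l ℓ e * G.pullDeriv ℓ w.1.2 e x
  have hD : ∀ ℓ, (G.withLengths ℓ).HasL2Deriv (D ℓ) (D' ℓ) := fun ℓ => by
    have := (u ℓ).2.2.add ((hasL2Deriv_rescale ℓ w.2.2).smul (-1))
    rwa [neg_one_smul, neg_one_smul, ← sub_eq_add_neg, ← sub_eq_add_neg] at this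
  have hval : Tendsto (fun ℓ => ∑ e, ∫ x in (0 : ℝ)..(G.withLengths ℓ).len e,
      (G.withLengths ℓ).onLine (D ℓ) e x * (G.withLengths ℓ).onLine (D ℓ) e x) L (𝓝 0) := by
    have key : ∀ e ∈ Finset.univ, Tendsto (fun ℓ : {ℓ : E → ℝ // ∀ e, 0 < ℓ e} =>
        ∫ x in (0 : ℝ)..ℓ.1 e, (G.withLengths ℓ).onLine (D ℓ) e x *
          (G.withLengths ℓ).onLine (D ℓ) e x) L (𝓝 0) := fun e _ =>
      tendsto_integral_mul_self_zero (fun ℓ => ℓ.2 e) (eventually_length_le hL e)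
        (fun ℓ => ((G.withLengths ℓ).hasL2Deriv_iff.1 (hD ℓ) e).continuousOn) fun ε hε => by
          filter_upwards [h.sub_rescale hL ε hε] with ℓ hℓ x hx using hℓ e x hx
    have := tendsto_finsetSum _ key
    rwa [Finset.sum_const_zero] at this
  have hder : Tendsto (fun ℓ => ∑ e, ∫ x in (0 : ℝ)..(G.withLengths ℓ).len e,
      (G.withLengths ℓ).onLine (D' ℓ) e x * (G.withLengths ℓ).onLine (D' ℓ) e x) L (𝓝 0) := by
    have hcross : Tendsto (fun ℓ : {ℓ : E → ℝ // ∀ e, 0 < ℓ e} => ∑ e : {e : E // 0 < l e},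
        (2 * (rescaleFactor l ℓ e * (l e / ℓ.1 e)) * (∫ x in (0 : ℝ)..ℓ.1 e,
        (G.withLengths ℓ).onLine (u ℓ).1.2 e x *
          (G.limitGraph l).onLine w.1.2 e (l e / ℓ.1 e * x)) -
        (rescaleFactor l ℓ e * (l e / ℓ.1 e)) ^ 2 * (ℓ.1 e / l e * ∫ x in (0 : ℝ)..l e,
        (G.limitGraph l).onLine w.1.2 e x * (G.limitGraph l).onLine w.1.2 e x))) L
        (𝓝 (∑ e : {e : E // 0 < l e}, (2 * (1 * 1) * (∫ x in (0 : ℝ)..l e,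
        (G.limitGraph l).onLine w.1.2 e x * (G.limitGraph l).onLine w.1.2 e x) -
        (1 * 1) ^ 2 * (1 * ∫ x in (0 : ℝ)..l e,
        (G.limitGraph l).onLine w.1.2 e x * (G.limitGraph l).onLine w.1.2 e x)))) := by
      refine tendsto_finsetSum _ fun e _ => ?_
      have h1 := ((tendsto_rescaleFactor l e.1).mono_left hL).mul
        ((tendsto_div_length e.2).mono_left hL)
      exact ((h1.const_mul 2).mul (h' e _ ((G.limitGraph l).isPrimitiveOn_of_mem w e).1)).sub
        ((h1.pow 2).mul (((tendsto_length_div e.2).mono_left hL).mul_const _))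
    have h1 := hE.sub hcross
    have h2 : ∀ a : ℝ, 2 * (1 * 1) * a - (1 * 1) ^ 2 * (1 * a) = a := fun a => by ring
    simp only [h2] at h1
    rw [MetricGraph.norm_sq_derivMap] at h1
    have h3 := h1.congr' (f₂ := fun ℓ => ∑ e, ∫ x in (0 : ℝ)..(G.withLengths ℓ).len e,
      (G.withLengths ℓ).onLine (D' ℓ) e x * (G.withLengths ℓ).onLine (D' ℓ) e x) <| by
      refine Eventually.of_forall fun ℓ => ?_
      simp only
      rw [MetricGraph.norm_sq_derivMap, sum_eq_sum_pos_add (l := l), add_sub_right_comm,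
        ← Finset.sum_sub_distrib, sum_eq_sum_pos_add (l := l)]
      have hon : ∀ e, ∀ x ∈ Set.Icc 0 (ℓ.1 e), (G.withLengths ℓ).onLine (D' ℓ) e x =
          (G.withLengths ℓ).onLine (u ℓ).1.2 e x -
            rescaleFactor l ℓ e * G.pullDeriv ℓ w.1.2 e x := by
        intro e x hx
        rw [← (G.withLengths ℓ).onLine_ofLine
          (fun e x => rescaleFactor l ℓ e * G.pullDeriv ℓ w.1.2 e x) e hx]
        rfl
      congr 1
      · refine Finset.sum_congr rfl fun e _ => ?_
        refine (integral_deriv_sub_rescale_of_pos (u ℓ) w e).symm.trans ?_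
        exact (G.withLengths ℓ).integral_onLine_congr fun x hx => by rw [hon e x hx]
      · refine Finset.sum_congr rfl fun e _ => ?_
        exact (G.withLengths ℓ).integral_onLine_congr fun x hx => by
          rw [hon e x hx, pullDeriv_of_not_pos e.2, mul_zero, sub_zero]
    refine (h3.trans (le_of_eq ?_))
    congr 1
    exact sub_self _
  have h5 := hval.add hder
  simp only [← Finset.sum_add_distrib, add_zero] at h5
  have h6 := ((ENNReal.continuous_rpow_const (y := (1 / 2 : ℝ))).tendsto _).comp
    ((ENNReal.continuous_ofReal.tendsto _).comp h5)
  rw [ENNReal.ofReal_zero, ENNReal.zero_rpow_of_pos (by norm_num)] at h6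
  exact tendsto_of_tendsto_of_tendsto_of_le_of_le tendsto_const_nhds h6 (fun _ => zero_le)
    fun ℓ => (G.withLengths ℓ).h1Norm_le (hD ℓ)

end

theorem UniformlyConverges.const_smul {L : Filter {ℓ : E → ℝ // ∀ e, 0 < ℓ e}}
    {u : ∀ ℓ, (G.withLengths ℓ).energySpace} {v : (G.limitGraph l).energySpace}
    (hl : ∀ e, 0 ≤ l e) (h : UniformlyConverges L u v)
    {s : ℝ} (hs : |s| = 1) : UniformlyConverges L (fun ℓ => s • u ℓ) (s • v) := by
  intro ε hε
  filter_upwards [h ε hε] with ℓ hℓ e x hx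
  have e1 : G.pullFun ℓ (s • v).1.1 e x = s * G.pullFun ℓ v.1.1 e x := by
    rw [← onLine_pull_fst hl _ e hx, ← onLine_pull_fst hl _ e hx, map_smul]
    rfl
  have e2 : (G.withLengths ℓ).onLine (s • u ℓ).1.1 e x =
      s * (G.withLengths ℓ).onLine (u ℓ).1.1 e x := rfl
  rw [e1, e2, ← mul_sub, abs_mul, hs, one_mul]
  exact hℓ e x hx

theorem DerivWeaklyConverges.const_smul {L : Filter {ℓ : E → ℝ // ∀ e, 0 < ℓ e}}
    {u : ∀ ℓ, (G.withLengths ℓ).energySpace} {v : (G.limitGraph l).energySpace}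
    (h : DerivWeaklyConverges L u v) (s : ℝ) :
    DerivWeaklyConverges L (fun ℓ => s • u ℓ) (s • v) := by
  intro e p hp
  have h1 := (h e p hp).const_mul s
  simp only [← intervalIntegral.integral_const_mul, ← mul_assoc] at h1
  exact h1

theorem UniformlyConverges.congr' {L : Filter {ℓ : E → ℝ // ∀ e, 0 < ℓ e}}
    {u u' : ∀ ℓ, (G.withLengths ℓ).energySpace} {v : (G.limitGraph l).energySpace}
    (h : UniformlyConverges L u v) (hu : ∀ᶠ ℓ in L, u ℓ = u' ℓ) : UniformlyConverges L u' v := by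
  intro ε hε
  filter_upwards [h ε hε, hu] with ℓ h1 h2
  rwa [← h2]

theorem DerivWeaklyConverges.congr' {L : Filter {ℓ : E → ℝ // ∀ e, 0 < ℓ e}}
    {u u' : ∀ ℓ, (G.withLengths ℓ).energySpace} {v : (G.limitGraph l).energySpace}
    (h : DerivWeaklyConverges L u v) (hu : ∀ᶠ ℓ in L, u ℓ = u' ℓ) :
    DerivWeaklyConverges L u' v := by
  intro e p hp
  refine (h e p hp).congr' ?_
  filter_upwards [hu] with ℓ h1
  rw [h1]

/-! ### Convergence of eigenvalues and stability of simplicity. -/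

variable [Fintype E]

/-- Convergence of the eigenvalues. -/
theorem Connected.tendsto_formEigenvalue (hG : G.Connected) (hl : ∀ e, 0 ≤ l e)
    (hpos : ∃ e, 0 < l e) {k : ℕ} (hk : 1 ≤ k) :
    Tendsto (fun ℓ => formEigenvalue (G.withLengths ℓ).valMap (G.withLengths ℓ).derivMap k)
      (lengthsNear l)
      (𝓝 (formEigenvalue (G.limitGraph l).valMap (G.limitGraph l).derivMap k)) := by
  obtain ⟨e₀, he₀⟩ := hpos
  have : Nonempty E := ⟨e₀⟩
  have : Nonempty {e : E // 0 < l e} := ⟨⟨e₀, he₀⟩⟩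
  set μ := formEigenvalue (G.limitGraph l).valMap (G.limitGraph l).derivMap k
  have hμ := (G.limitGraph l).energyCompact.hasEigenfamily_formEigenvalue hk
    ((G.limitGraph l).exists_hasEigenfamily k)
  have hfam := fun ℓ => (G.withLengths ℓ).energyCompact.hasEigenfamily_formEigenvalue hk
    ((G.withLengths ℓ).exists_hasEigenfamily k)
  have hup : ∀ η, μ < η → ∀ᶠ ℓ in lengthsNear l,
      formEigenvalue (G.withLengths ℓ).valMap (G.withLengths ℓ).derivMap k ≤ η := fun η hη =>
    (eventually_hasEigenfamily hl (hμ.nonneg hk) hη hμ).mono fun ℓ h => h.formEigenvalue_le hk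
  choose ν u h1 h2 using hfam
  rw [tendsto_iff_ultrafilter]
  intro 𝒰 h𝒰
  have hup1 : ∀ᶠ ℓ in 𝒰,
      formEigenvalue (G.withLengths ℓ).valMap (G.withLengths ℓ).derivMap k ≤ μ + 1 :=
    h𝒰 (hup (μ + 1) (lt_add_one μ))
  have hlim : ∀ i, ∃ (m : ℝ) (v : (G.limitGraph l).energySpace),
      Tendsto (fun ℓ => ν ℓ i) 𝒰 (𝓝 m) ∧
      v ∈ weakEigenspace (G.limitGraph l).valMap (G.limitGraph l).derivMap m ∧
      UniformlyConverges 𝒰 (fun ℓ => u ℓ i) v ∧ DerivWeaklyConverges 𝒰 (fun ℓ => u ℓ i) v :=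
    fun i => hG.exists_limit_eigenvector hl ⟨e₀, he₀⟩ 𝒰 h𝒰 (fun ℓ => u ℓ i) (fun ℓ => ν ℓ i)
      (Eventually.of_forall fun ℓ => (h1 ℓ i).2) (Eventually.of_forall fun ℓ => (h2 ℓ).1 i)
      (hup1.mono fun ℓ h => (h1 ℓ i).1.trans h)
  choose m v hm hv huv _ using hlim
  obtain ⟨x, hx⟩ := 𝒰.exists_tendsto_of_abs_le (B := μ + 1) (a := fun ℓ =>
    formEigenvalue (G.withLengths ℓ).valMap (G.withLengths ℓ).derivMap k)
    (hup1.mono fun ℓ h => by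
      rwa [abs_of_nonneg (HasEigenfamily.nonneg ⟨ν ℓ, u ℓ, h1 ℓ, h2 ℓ⟩ hk)])
  have hxμ : x ≤ μ := le_of_forall_gt_imp_ge_of_dense fun η hη => le_of_tendsto hx (h𝒰 (hup η hη))
  -- Limits of the k orthonormal eigenfunctions are orthonormal eigenfunctions of the limit graph,
  -- with eigenvalues at most `x`.
  have hμx : μ ≤ x := by
    refine HasEigenfamily.formEigenvalue_le ⟨m, v, fun i => ⟨?_, hv i⟩, ?_⟩ hk
    · exact le_of_tendsto_of_tendsto' (hm i) hx fun ℓ => (h1 ℓ i).1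
    · rw [orthonormal_iff_ite]
      intro i j
      refine tendsto_nhds_unique ((huv i).tendsto_inner_valMap hl h𝒰 (huv j)) ?_
      simp only [orthonormal_iff_ite.1 (h2 _) i j]
      exact tendsto_const_nhds
  rwa [le_antisymm hxμ hμx] at hx

/-- Simplicity is stable. -/
theorem Connected.eventually_finrank_eq_one (hG : G.Connected) (hl : ∀ e, 0 ≤ l e)
    (hpos : ∃ e, 0 < l e) {k : ℕ} (hk : 1 ≤ k)
    (hs : Module.finrank ℝ ((weakEigenspace (G.limitGraph l).valMap (G.limitGraph l).derivMap
      (formEigenvalue (G.limitGraph l).valMap (G.limitGraph l).derivMap k)).map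
      (G.limitGraph l).valMap) = 1) :
    ∀ᶠ ℓ in lengthsNear l,
      Module.finrank ℝ ((weakEigenspace (G.withLengths ℓ).valMap (G.withLengths ℓ).derivMap
      (formEigenvalue (G.withLengths ℓ).valMap (G.withLengths ℓ).derivMap k)).map
      (G.withLengths ℓ).valMap) = 1 := by
  have hlimk := hG.tendsto_formEigenvalue hl hpos hk
  have : Nonempty E := ⟨hpos.choose⟩
  -- If simplicity fails along an ultrafilter, there are orthonormal eigenfunctions `u` and `v` for
  -- the same eigenvalue; their limits are orthonormal in a one-dimensional space.
  refine mem_iff_ultrafilter.2 fun 𝒰 h𝒰 => ?_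
  by_contra hcon
  replace hcon : ∀ᶠ ℓ in (𝒰 : Filter _), Module.finrank ℝ ((weakEigenspace
      (G.withLengths ℓ).valMap (G.withLengths ℓ).derivMap
      (formEigenvalue (G.withLengths ℓ).valMap (G.withLengths ℓ).derivMap k)).map
      (G.withLengths ℓ).valMap) ≠ 1 := Ultrafilter.compl_mem_iff_notMem.2 hcon
  choose u hu hu1 using fun ℓ =>
    (G.withLengths ℓ).energyCompact.exists_mem_weakEigenspace_formEigenvalue hk
      ((G.withLengths ℓ).exists_hasEigenfamily k)
  have hex : ∀ ℓ, ∃ v, Module.finrank ℝ ((weakEigenspace (G.withLengths ℓ).valMap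
      (G.withLengths ℓ).derivMap
      (formEigenvalue (G.withLengths ℓ).valMap (G.withLengths ℓ).derivMap k)).map
      (G.withLengths ℓ).valMap) ≠ 1 → v ∈ weakEigenspace (G.withLengths ℓ).valMap
      (G.withLengths ℓ).derivMap
      (formEigenvalue (G.withLengths ℓ).valMap (G.withLengths ℓ).derivMap k) ∧
      ‖(G.withLengths ℓ).valMap v‖ = 1 ∧
      inner ℝ ((G.withLengths ℓ).valMap (u ℓ)) ((G.withLengths ℓ).valMap v) = 0 := by
    intro ℓ
    by_cases h : Module.finrank ℝ ((weakEigenspace (G.withLengths ℓ).valMap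
      (G.withLengths ℓ).derivMap
      (formEigenvalue (G.withLengths ℓ).valMap (G.withLengths ℓ).derivMap k)).map
      (G.withLengths ℓ).valMap) = 1
    · exact ⟨0, fun h' => absurd h h'⟩
    · obtain ⟨v, hv⟩ := exists_orthonormal_of_finrank_ne_one (hu ℓ) (hu1 ℓ) h
      exact ⟨v, fun _ => hv⟩
  choose v hv using hex
  have hbd := (hlimk.mono_left h𝒰).eventually (ge_mem_nhds (lt_add_one _))
  obtain ⟨m, a, hm, ha, hua, -⟩ := hG.exists_limit_eigenvector hl hpos 𝒰 h𝒰 u _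
    (Eventually.of_forall hu) (Eventually.of_forall hu1) hbd
  obtain ⟨m', b, hm', hb, hvb, -⟩ := hG.exists_limit_eigenvector hl hpos 𝒰 h𝒰 v _
    (hcon.mono fun ℓ h => (hv ℓ h).1) (hcon.mono fun ℓ h => (hv ℓ h).2.1) hbd
  obtain rfl := tendsto_nhds_unique hm (hlimk.mono_left h𝒰)
  obtain rfl := tendsto_nhds_unique hm' (hlimk.mono_left h𝒰)
  have ha1 : ‖(G.limitGraph l).valMap a‖ = 1 :=
    tendsto_nhds_unique (hua.tendsto_norm_valMap hl h𝒰) (by simp only [hu1]; exact tendsto_const_nhds)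
  have hb1 : ‖(G.limitGraph l).valMap b‖ = 1 :=
    tendsto_nhds_unique (hvb.tendsto_norm_valMap hl h𝒰)
      (tendsto_const_nhds.congr' (hcon.mono fun ℓ h => (hv ℓ h).2.1.symm))
  have hab : inner ℝ ((G.limitGraph l).valMap a) ((G.limitGraph l).valMap b) = 0 :=
    tendsto_nhds_unique (hua.tendsto_inner_valMap hl h𝒰 hvb)
      (tendsto_const_nhds.congr' (hcon.mono fun ℓ h => (hv ℓ h).2.2.symm))
  rcases eq_or_eq_neg_of_finrank_eq_one ha ha1 hb hb1 hs with h | h <;>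
    simp [h, inner_neg_right, ha1] at hab

end DiscreteGraph
end

/-! ### Proof of the theorem. -/

theorem theoremA1 {V E : Type*} [Finite V] [Fintype E] (G : DiscreteGraph V E)
    (hG : G.Connected) (l : E → ℝ) (hl : ∀ e, 0 ≤ l e) (k : ℕ) (hk : 1 ≤ k)
    (hsimple : (G.limitGraph l).IsSimple k) :
    (∀ᶠ ℓ in lengthsNear l, (G.withLengths ℓ).IsSimple k) ∧
    Tendsto (fun ℓ => (G.withLengths ℓ).eigenvalue k) (lengthsNear l)
      (𝓝 ((G.limitGraph l).eigenvalue k)) ∧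
    ∀ ψ : (G.limitGraph l).Fun, (G.limitGraph l).IsNormalizedEigenfunction k ψ →
      ∀ φ : (ℓ : {ℓ : E → ℝ // ∀ e, 0 < ℓ e}) → (G.withLengths ℓ).Fun,
        (∀ᶠ ℓ in lengthsNear l, (G.withLengths ℓ).IsNormalizedEigenfunction k (φ ℓ)) →
        ∃ σ : {ℓ : E → ℝ // ∀ e, 0 < ℓ e} → ℝ, (∀ ℓ, σ ℓ = 1 ∨ σ ℓ = -1) ∧
          Tendsto (fun ℓ => (G.withLengths ℓ).h1Norm (σ ℓ • φ ℓ - G.rescale l ℓ ψ))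
            (lengthsNear l) (𝓝 0) ∧
          Tendsto (fun ℓ => (G.withLengths ℓ).supNorm (σ ℓ • φ ℓ - G.rescale l ℓ ψ))
            (lengthsNear l) (𝓝 0) := by
  -- Were all edges collapsed, the function space and hence the eigenspace would be trivial,
  -- contradicting simplicity.
  have hpos : ∃ e, 0 < l e := by
    by_contra! hcon
    have : IsEmpty {e : E // 0 < l e} := ⟨fun e => (hcon e).not_gt e.2⟩
    have h1 : Module.finrank ℝ ((G.limitGraph l).eigenspace ((G.limitGraph l).eigenvalue k)) = 0 :=
      Module.finrank_zero_of_subsingleton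
    exact absurd (h1.symm.trans hsimple) zero_ne_one
  have hs := hsimple
  unfold MetricGraph.IsSimple at hs
  rw [MetricGraph.finrank_eigenspace, MetricGraph.eigenvalue_eq] at hs
  have hlimk : Tendsto (fun ℓ => (G.withLengths ℓ).eigenvalue k) (lengthsNear l)
      (𝓝 ((G.limitGraph l).eigenvalue k)) := by
    simp only [MetricGraph.eigenvalue_eq]
    exact hG.tendsto_formEigenvalue hl hpos hk
  refine ⟨?_, hlimk, fun ψ hψ φ hφ => ?_⟩
  · filter_upwards [hG.eventually_finrank_eq_one hl hpos hk hs] with ℓ hℓ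
    unfold MetricGraph.IsSimple
    rwa [MetricGraph.finrank_eigenspace, MetricGraph.eigenvalue_eq]
  rw [← MetricGraph.eigenvalue_eq] at hs
  obtain ⟨w, hw, hw1, rfl⟩ := hψ.exists_weak
  have hex : ∀ ℓ, ∃ u : (G.withLengths ℓ).energySpace,
      (G.withLengths ℓ).IsNormalizedEigenfunction k (φ ℓ) →
      u ∈ weakEigenspace (G.withLengths ℓ).valMap (G.withLengths ℓ).derivMap
        ((G.withLengths ℓ).eigenvalue k) ∧ ‖(G.withLengths ℓ).valMap u‖ = 1 ∧ u.1.1 = φ ℓ := by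
    intro ℓ
    by_cases h : (G.withLengths ℓ).IsNormalizedEigenfunction k (φ ℓ)
    · obtain ⟨u, hu⟩ := h.exists_weak
      exact ⟨u, fun _ => hu⟩
    · exact ⟨0, fun h' => absurd h' h⟩
  choose u hu using hex
  -- The sign makes the inner product with the transplanted limit eigenfunction nonnegative. It is
  -- fixed before any ultrafilter, so a single choice works for all of them.
  set P : {ℓ : E → ℝ // ∀ e, 0 < ℓ e} → ℝ := fun ℓ =>
    inner ℝ ((G.withLengths ℓ).valMap (u ℓ)) ((G.withLengths ℓ).valMap (G.pull ℓ hl w))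
  set σ : {ℓ : E → ℝ // ∀ e, 0 < ℓ e} → ℝ := fun ℓ => if 0 ≤ P ℓ then 1 else -1
  suffices key : ∀ 𝒰 : Ultrafilter {ℓ : E → ℝ // ∀ e, 0 < ℓ e}, (𝒰 : Filter _) ≤ lengthsNear l →
      Tendsto (fun ℓ => (G.withLengths ℓ).h1Norm (σ ℓ • φ ℓ - G.rescale l ℓ w.1.1)) 𝒰 (𝓝 0) ∧
      Tendsto (fun ℓ => (G.withLengths ℓ).supNorm (σ ℓ • φ ℓ - G.rescale l ℓ w.1.1)) 𝒰 (𝓝 0) by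
    refine ⟨σ, fun ℓ => ?_, (tendsto_iff_ultrafilter _ _ _).2 fun 𝒰 h𝒰 => (key 𝒰 h𝒰).1,
      (tendsto_iff_ultrafilter _ _ _).2 fun 𝒰 h𝒰 => (key 𝒰 h𝒰).2⟩
    simp only [σ]
    split_ifs
    · exact Or.inl rfl
    · exact Or.inr rfl
  intro 𝒰 h𝒰
  have hφ' := h𝒰 hφ
  replace hφ' : ∀ᶠ ℓ in 𝒰, (G.withLengths ℓ).IsNormalizedEigenfunction k (φ ℓ) := hφ'
  have hbd := (hlimk.mono_left h𝒰).eventually (ge_mem_nhds (lt_add_one _))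
  obtain ⟨m, v, hm, hv, huv, huv'⟩ := hG.exists_limit_eigenvector hl hpos 𝒰 h𝒰 u _
    (hφ'.mono fun ℓ h => (hu ℓ h).1) (hφ'.mono fun ℓ h => (hu ℓ h).2.1) hbd
  obtain rfl := tendsto_nhds_unique hm (hlimk.mono_left h𝒰)
  have hv1 : ‖(G.limitGraph l).valMap v‖ = 1 :=
    tendsto_nhds_unique (huv.tendsto_norm_valMap hl h𝒰)
      (tendsto_const_nhds.congr' (hφ'.mono fun ℓ h => (hu ℓ h).2.1.symm))
  -- By simplicity the limit `v` is `w` or `-w` as a function. Accordingly `P` tends to 1 or −1, so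
  -- `σ` is eventually the matching sign.
  obtain ⟨s, hs1, hsv, hsσ⟩ : ∃ s : ℝ, |s| = 1 ∧ (s • v).1.1 = w.1.1 ∧ ∀ᶠ ℓ in 𝒰, s = σ ℓ := by
    have hP : Tendsto P 𝒰 (𝓝 (inner ℝ ((G.limitGraph l).valMap v) ((G.limitGraph l).valMap w))) :=
      huv.tendsto_inner_valMap hl h𝒰 (DiscreteGraph.uniformlyConverges_pull hl w)
    rcases eq_or_eq_neg_of_finrank_eq_one hw hw1 hv hv1 hs with h | h
    · refine ⟨1, abs_one, ?_, ?_⟩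
      · rw [← sub_eq_zero, ← map_sub, MetricGraph.valMap_eq_zero_iff] at h
        rw [one_smul]
        exact sub_eq_zero.1 h
      · rw [h, real_inner_self_eq_norm_sq, hw1, one_pow] at hP
        filter_upwards [hP.eventually (lt_mem_nhds zero_lt_one)] with ℓ hℓ
        exact (if_pos hℓ.le).symm
    · refine ⟨-1, by simp, ?_, ?_⟩
      · rw [← sub_eq_zero, sub_neg_eq_add, ← map_add, MetricGraph.valMap_eq_zero_iff] at h
        change (-1 : ℝ) • v.1.1 = w.1.1
        rw [neg_one_smul]
        exact neg_eq_of_add_eq_zero_right h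
      · rw [h, inner_neg_left, real_inner_self_eq_norm_sq, hw1, one_pow] at hP
        filter_upwards [hP.eventually (gt_mem_nhds (by norm_num : (-1 : ℝ) < 0))] with ℓ hℓ
        exact (if_neg hℓ.not_ge).symm
  have hc : ∀ᶠ ℓ in 𝒰, s • u ℓ = σ ℓ • u ℓ := hsσ.mono fun ℓ h => by rw [h]
  have hU := (huv.const_smul hl hs1).congr' hc
  have hW := (huv'.const_smul s).congr' hc
  -- The energy of a normalised eigenfunction is its eigenvalue, so this is the convergence of
  -- eigenvalues.
  have hE : Tendsto (fun ℓ => ‖(G.withLengths ℓ).derivMap (σ ℓ • u ℓ)‖ ^ 2) 𝒰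
      (𝓝 (‖(G.limitGraph l).derivMap (s • v)‖ ^ 2)) := by
    rw [norm_sq_of_mem_weakEigenspace (Submodule.smul_mem _ s hv), map_smul, norm_smul, hv1,
      Real.norm_eq_abs, hs1, mul_one, one_pow, mul_one]
    refine hm.congr' ?_
    filter_upwards [hφ', hsσ] with ℓ h1 h2
    rw [← h2, norm_sq_of_mem_weakEigenspace (Submodule.smul_mem _ s (hu ℓ h1).1), map_smul,
      norm_smul, (hu ℓ h1).2.1, Real.norm_eq_abs, hs1, mul_one, one_pow, mul_one]
  have hfin : ∀ᶠ ℓ in 𝒰, (σ ℓ • u ℓ).1.1 - G.rescale l ℓ (s • v).1.1 =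
      σ ℓ • φ ℓ - G.rescale l ℓ w.1.1 := by
    filter_upwards [hφ'] with ℓ h1
    rw [hsv, ← (hu ℓ h1).2.2]
    rfl
  exact ⟨(DiscreteGraph.tendsto_h1Norm h𝒰 hU hW hE).congr' (hfin.mono fun ℓ h => by rw [h]),
    (hU.tendsto_supNorm h𝒰).congr' (hfin.mono fun ℓ h => by rw [h])⟩
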